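/- Let $P>0$ and let $V:\mathbb R\to\mathbb R$. Let $\mu_V$ be the equilibrium measure, i.e. the minimizer over probability measures $\mu$ on $\mathbb R$ of $$\mathcal E_V^P(\mu)=\int_{\mathbb R}\Big[V+\ln\frac{d\mu}{dx}\Big]d\mu-P\iint_{\mathbb R^2}\ln|x-y|\,d\mu(x)\,d\mu(y)\quad\text{if }\mu\ll dx,\qquad \mathcal E_V^P(\mu)=+\infty\ \text{otherwise},$$ and let $\rho_V$ be its density. Assume: (i) $V\in\mathcal C^3(\mathbb R)$, $V(x)\to+\infty$ and $|V'(x)|\to+\infty$ as $|x|\to\infty$, and $\mu_V$ satisfies the Poincaré inequality: there is $C>0$ such that $\int \big(f-\int f\,d\mu_V\big)^2d\mu_V\le C\int |f'|^2d\mu_V$ for all compactly supported $f\in\mathcal C^1(\mathbb R)$; (ii) for every polynomial $Q\in\mathbb R[X]$ and every $\alpha>0$, $Q(V'(x))e^{-V(x)}=o(|x|^{-\alpha})$ as $|x|\to\infty$; (iii) for every real sequence $(x_N)$ with $|x_N|\to\infty$ and all real $a<b$, $\frac{1}{V'(x_N)^2}\sup_{a\le x\le b}|V''(x_N+x)|\to0$;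 (iv) $V'^{-2}$ is integrable at infinity, and $V''/V'=O(1)$ and $V^{(3)}/V'=O(1)$ as $|x|\to\infty$. Let $L^2_0(\mu_V)=\{u\in L^2(\mu_V):\int u\,d\mu_V=0\}$. Let $\mathcal A[\phi]=-(\phi'\rho_V)'/\rho_V$, with derivatives in the weak sense. Its domain $\mathcal D_{L^2(\mu_V)}(\mathcal A)$ is the set of $\phi=\rho_V^{-1/2}u$ with $u\in H^1(\mathbb R)$, $uV'\in L^2(\mathbb R)$ and $\sqrt{\rho_V}\,\mathcal A[\rho_V^{-1/2}u]\in L^2(\mathbb R)$. Let $\mathcal D_{L^2_0(\mu_V)}(\mathcal A)=\mathcal D_{L^2(\mu_V)}(\mathcal A)\cap L^2_0(\mu_V)$. Then there exist a sequence $0<\lambda_1<\lambda_2<\dots$ going to infinity and a sequence $(\phi_n)_{n\ge1}$ in $\mathcal D_{L^2_0(\mu_V)}(\mathcal A)$ such that: - $\mathrm{Span}\{\phi_n : n\ge1\}$ is dense in $L^2_0(\mu_V)$; - $\langle\phi_i,\phi_j\rangle_{L^2(\mu_V)}=\delta_{i,j}$ for all $i,j\ge 1$; - $\mathcal A[\phi_n]=\lambda_n\phi_n$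 for all $n\ge1$. Furthermore $\mathcal A:\mathcal D_{L^2_0(\mu_V)}(\mathcal A)\to L^2_0(\mu_V)$ is bijective, and for every $u\in L^2_0(\mu_V)$ $$\mathcal A^{-1}[u]=\sum_{n\ge1}\lambda_n^{-1}\langle u,\phi_n\rangle_{L^2(\mu_V)}\,\phi_n ,$$ with convergence in $L^2(\mu_V)$. -/

import Mathlib

open MeasureTheory Filter Topology Asymptotics
open scoped ContDiff ENNReal

noncomputable section

namespace HighTemp

/-! ### The equilibrium measure -/

/-- The density of `μ` with respect to Lebesgue measure. It is used only up to equality almost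
everywhere. -/
def density (μ : Measure ℝ) (x : ℝ) : ℝ := (μ.rnDeriv volume x).toReal

open scoped Classical in
/-- The energy functional
`E(μ) = ∫ [V + ln (dμ/dx)] dμ - P ∬ ln |x - y| dμ(x) dμ(y)`
if `μ` is absolutely continuous (and both integrals are finite), and `+∞` otherwise. For a
potential that grows faster than linearly the first integral is well defined in `(-∞, +∞]`, and
the second one is `< +∞` as soon as the first one is finite. -/
def energy (V : ℝ → ℝ) (P : ℝ) (μ : Measure ℝ) : EReal :=
  if μ ≪ volume ∧ Integrable (fun x => V x + Real.log (density μ x)) μ ∧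
      Integrable (fun p : ℝ × ℝ => Real.log |p.1 - p.2|) (μ.prod μ) then
    (((∫ x, (V x + Real.log (density μ x)) ∂μ)
      - P * ∫ p : ℝ × ℝ, Real.log |p.1 - p.2| ∂(μ.prod μ) : ℝ) : EReal)
  else ⊤

/-- `μ` minimizes the energy among all probability measures on the line. -/
def IsEquilibriumMeasure (V : ℝ → ℝ) (P : ℝ) (μ : Measure ℝ) : Prop :=
  IsProbabilityMeasure μ ∧
    ∀ ν : Measure ℝ, IsProbabilityMeasure ν → energy V P μ ≤ energy V P ν

/-- The Poincaré inequality for a probability measure on the line. -/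
def PoincareInequality (μ : Measure ℝ) : Prop :=
  ∃ C : ℝ, 0 < C ∧ ∀ f : ℝ → ℝ, ContDiff ℝ 1 f → HasCompactSupport f →
    ∫ x, (f x - ∫ y, f y ∂μ) ^ 2 ∂μ ≤ C * ∫ x, (deriv f x) ^ 2 ∂μ

/-- The standing assumptions on the potential `V` with equilibrium measure `μ`. The filter
`cocompact ℝ` is the filter `|x| → ∞`. -/
structure AdmissiblePotential (V : ℝ → ℝ) (μ : Measure ℝ) : Prop where
  contDiff : ContDiff ℝ 3 V
  tendsto_top : Tendsto V (cocompact ℝ) atTop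
  abs_deriv_tendsto_top : Tendsto (fun x => |deriv V x|) (cocompact ℝ) atTop
  poincare : PoincareInequality μ
  polynomial_decay : ∀ (Q : Polynomial ℝ) (α : ℝ), 0 < α →
    (fun x => Q.eval (deriv V x) * Real.exp (-V x)) =o[cocompact ℝ] fun x => |x| ^ (-α)
  second_deriv_small : ∀ x : ℕ → ℝ, Tendsto (fun N => |x N|) atTop atTop →
    ∀ a b : ℝ, a < b →
      Tendsto (fun N => 1 / (deriv V (x N)) ^ 2 *
        sSup ((fun t => |iteratedDeriv 2 V (x N + t)|) '' Set.Icc a b)) atTop (𝓝 0)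
  inv_sq_integrable : IntegrableAtFilter (fun x => 1 / (deriv V x) ^ 2) (cocompact ℝ) volume
  second_deriv_bound :
    (fun x => iteratedDeriv 2 V x / deriv V x) =O[cocompact ℝ] fun _ => (1 : ℝ)
  third_deriv_bound :
    (fun x => iteratedDeriv 3 V x / deriv V x) =O[cocompact ℝ] fun _ => (1 : ℝ)

/-! ### Weak derivatives and Sobolev spaces on the line -/

/-- `g` is the weak (distributional) derivative of `u`, both being locally integrable. -/
def HasWeakDeriv (u g : ℝ → ℝ) : Prop :=
  LocallyIntegrable u ∧ LocallyIntegrable g ∧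
    ∀ ψ : ℝ → ℝ, ContDiff ℝ ∞ ψ → HasCompactSupport ψ →
      ∫ x, u x * deriv ψ x = -∫ x, g x * ψ x

/-- `u ∈ H¹(ℝ)`. -/
def MemH1 (u : ℝ → ℝ) : Prop :=
  MemLp u 2 volume ∧ ∃ g, MemLp g 2 volume ∧ HasWeakDeriv u g

/-- `u ∈ H¹(ℝ)` and `u V' ∈ L²(ℝ)`. -/
def MemH1V (V u : ℝ → ℝ) : Prop :=
  MemH1 u ∧ MemLp (fun x => u x * deriv V x) 2 volume

/-- `-(φ' ρ)' / ρ = f`, where `ρ` is the density of `μ` and the derivatives are weak ones: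
`φ` has a weak derivative `φ'`, and `φ' ρ` has the weak derivative `-f ρ`. -/
def IsSturmLiouville (μ : Measure ℝ) (φ f : ℝ → ℝ) : Prop :=
  ∃ φ' : ℝ → ℝ, HasWeakDeriv φ φ' ∧
    HasWeakDeriv (fun x => φ' x * density μ x) (fun x => -(f x * density μ x))

/-! ### Elementary facts -/

lemma HasWeakDeriv.congr {u u₁ g g₁ : ℝ → ℝ} (h : HasWeakDeriv u g)
    (hu : u =ᵐ[volume] u₁) (hg : g =ᵐ[volume] g₁) : HasWeakDeriv u₁ g₁ := by
  refine ⟨h.1.congr hu, h.2.1.congr hg, fun ψ h1 h2 => ?_⟩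
  have e1 : ∫ x, u₁ x * deriv ψ x = ∫ x, u x * deriv ψ x :=
    integral_congr_ae (by filter_upwards [hu] with x hx; rw [hx])
  have e2 : ∫ x, g₁ x * ψ x = ∫ x, g x * ψ x :=
    integral_congr_ae (by filter_upwards [hg] with x hx; rw [hx])
  rw [e1, e2]
  exact h.2.2 ψ h1 h2

lemma integrable_mul_of_hasCompactSupport {u ψ : ℝ → ℝ} (hu : LocallyIntegrable u)
    (hψ : Continuous ψ) (hc : HasCompactSupport ψ) : Integrable (fun x => u x * ψ x) := by
  simpa [mul_comm] using hu.integrable_smul_left_of_hasCompactSupport hψ hc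

lemma HasWeakDeriv.add {u₁ g₁ u₂ g₂ : ℝ → ℝ} (h₁ : HasWeakDeriv u₁ g₁)
    (h₂ : HasWeakDeriv u₂ g₂) :
    HasWeakDeriv (fun x => u₁ x + u₂ x) (fun x => g₁ x + g₂ x) := by
  refine ⟨h₁.1.add h₂.1, h₁.2.1.add h₂.2.1, fun ψ hs hc => ?_⟩
  have hd : Continuous (deriv ψ) := hs.continuous_deriv (by simp)
  simp only [add_mul]
  rw [integral_add (integrable_mul_of_hasCompactSupport h₁.1 hd hc.deriv)
      (integrable_mul_of_hasCompactSupport h₂.1 hd hc.deriv),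
    integral_add (integrable_mul_of_hasCompactSupport h₁.2.1 hs.continuous hc)
      (integrable_mul_of_hasCompactSupport h₂.2.1 hs.continuous hc),
    h₁.2.2 ψ hs hc, h₂.2.2 ψ hs hc]
  ring

lemma HasWeakDeriv.const_mul {u g : ℝ → ℝ} (h : HasWeakDeriv u g) (c : ℝ) :
    HasWeakDeriv (fun x => c * u x) (fun x => c * g x) := by
  refine ⟨h.1.smul c, h.2.1.smul c, fun ψ hs hc => ?_⟩
  simp only [mul_assoc]
  rw [integral_const_mul, integral_const_mul, h.2.2 ψ hs hc]
  ring

lemma HasWeakDeriv.ae_eq_zero {u g : ℝ → ℝ} (h : HasWeakDeriv u g) (hu : u =ᵐ[volume] 0) :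
    g =ᵐ[volume] 0 := by
  refine ae_eq_zero_of_integral_contDiff_smul_eq_zero h.2.1 fun ψ hs hc => ?_
  have h0 : ∫ x, u x * deriv ψ x = 0 :=
    integral_eq_zero_of_ae (by filter_upwards [hu] with x hx; simp [hx])
  have h1 := h.2.2 ψ hs hc
  rw [h0] at h1
  simp only [smul_eq_mul, mul_comm (ψ _)]
  linarith

lemma mul_density_congr {μ : Measure ℝ} [IsFiniteMeasure μ] {f g : ℝ → ℝ} (h : f =ᵐ[μ] g) :
    (fun x => f x * density μ x) =ᵐ[volume] fun x => g x * density μ x := by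
  have h1 : f =ᵐ[volume.withDensity (μ.rnDeriv volume)] g :=
    ae_mono (Measure.withDensity_rnDeriv_le μ volume) h
  have h2 := (ae_withDensity_iff (Measure.measurable_rnDeriv μ volume)).1 h1
  filter_upwards [h2] with x hx
  by_cases h0 : μ.rnDeriv volume x = 0
  · simp [density, h0]
  · rw [hx h0]

lemma density_ne_zero {μ : Measure ℝ} [IsFiniteMeasure μ] (hμ : μ ≪ volume) :
    ∀ᵐ x ∂μ, density μ x ≠ 0 := by
  filter_upwards [Measure.rnDeriv_pos hμ, hμ.ae_le (Measure.rnDeriv_lt_top μ volume)] with x h1 h2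
  exact (ENNReal.toReal_pos h1.ne' h2.ne).ne'

/-! ### The operator `A` -/

/-- The graph of `A`: the pairs `(φ, f)` in `L²(μ)` with `φ = u / √ρ` for some `u ∈ H¹(ℝ)` with
`u V' ∈ L²(ℝ)`, and `-(φ' ρ)' / ρ = f` weakly. (That `f` lies in `L²(μ)` says that
`√ρ f = √ρ A[u / √ρ]` lies in `L²(ℝ)`.) -/
def graphA (V : ℝ → ℝ) (μ : Measure ℝ) [IsFiniteMeasure μ] :
    Submodule ℝ (Lp ℝ 2 μ × Lp ℝ 2 μ) where
  carrier := {p | ∃ u : ℝ → ℝ, MemH1V V u ∧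
    p.1 =ᵐ[μ] (fun x => u x / √(density μ x)) ∧
    IsSturmLiouville μ (fun x => u x / √(density μ x)) p.2}
  zero_mem' := by
    have h0 : HasWeakDeriv (fun _ => 0) (fun _ => 0) :=
      ⟨locallyIntegrable_zero, locallyIntegrable_zero, by simp⟩
    refine ⟨fun _ => 0, ⟨⟨by simp, fun _ => 0, by simp, h0⟩, by simp⟩, ?_, fun _ => 0, ?_, ?_⟩
    · filter_upwards [Lp.coeFn_zero ℝ 2 μ] with x hx
      simpa using hx
    · simpa using h0
    · refine h0.congr (by simp) ?_
      have := mul_density_congr (Lp.coeFn_zero ℝ 2 μ)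
      filter_upwards [this] with x hx
      simpa using hx.symm
  add_mem' := by
    rintro ⟨φ₁, f₁⟩ ⟨φ₂, f₂⟩ ⟨u₁, ⟨⟨hu₁, g₁, hg₁, hug₁⟩, hV₁⟩, e₁, d₁, hd₁, hs₁⟩
      ⟨u₂, ⟨⟨hu₂, g₂, hg₂, hug₂⟩, hV₂⟩, e₂, d₂, hd₂, hs₂⟩
    refine ⟨fun x => u₁ x + u₂ x,
      ⟨⟨hu₁.add hu₂, fun x => g₁ x + g₂ x, hg₁.add hg₂, hug₁.add hug₂⟩, ?_⟩, ?_,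
      fun x => d₁ x + d₂ x, ?_, ?_⟩
    · simp only [add_mul]
      exact hV₁.add hV₂
    · filter_upwards [e₁, e₂, Lp.coeFn_add φ₁ φ₂] with x h1 h2 h3
      simp only [Prod.mk_add_mk, h3, Pi.add_apply, h1, h2, add_div]
    · simp only [add_div]
      exact hd₁.add hd₂
    · refine (hs₁.add hs₂).congr (Eventually.of_forall fun x => (add_mul _ _ _).symm) ?_
      filter_upwards [mul_density_congr (Lp.coeFn_add f₁ f₂)] with x hx
      simp only [Prod.mk_add_mk, hx, Pi.add_apply]
      ring
  smul_mem' := by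
    rintro c ⟨φ, f⟩ ⟨u, ⟨⟨hu, g, hg, hug⟩, hV⟩, e, d, hd, hs⟩
    refine ⟨fun x => c * u x,
      ⟨⟨hu.const_mul c, fun x => c * g x, hg.const_mul c, hug.const_mul c⟩, ?_⟩, ?_,
      fun x => c * d x, ?_, ?_⟩
    · simp only [mul_assoc]
      exact hV.const_mul c
    · filter_upwards [e, Lp.coeFn_smul c φ] with x h1 h2
      simp only [Prod.smul_mk, h2, Pi.smul_apply, h1, smul_eq_mul, mul_div_assoc]
    · simp only [mul_div_assoc]
      exact hd.const_mul c
    · refine (hs.const_mul c).congr (Eventually.of_forall fun x => (mul_assoc _ _ _).symm) ?_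
      filter_upwards [mul_density_congr (Lp.coeFn_smul c f)] with x hx
      simp only [Prod.smul_mk, hx, Pi.smul_apply, smul_eq_mul]
      ring

/-- The unbounded operator `A[φ] = -(φ' ρ)' / ρ` of `L²(μ)`, whose domain is `D_{L²(μ)}(A)`. -/
def opA (V : ℝ → ℝ) (μ : Measure ℝ) [IsFiniteMeasure μ] : Lp ℝ 2 μ →ₗ.[ℝ] Lp ℝ 2 μ :=
  (graphA V μ).toLinearPMap

/-- If `μ` is absolutely continuous, then `graphA V μ` is single-valued, and so it is the graph
of `opA V μ`. -/
lemma opA_graph (V : ℝ → ℝ) (μ : Measure ℝ) [IsFiniteMeasure μ] (hμ : μ ≪ volume) :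
    (opA V μ).graph = graphA V μ := by
  refine Submodule.toLinearPMap_graph_eq _ ?_
  rintro ⟨φ, f⟩ ⟨u, -, e, d, hd, hs⟩ h0
  simp only at h0 e hs ⊢
  subst h0
  have h1 : (fun x => u x / √(density μ x)) =ᵐ[μ] fun _ => 0 := by
    filter_upwards [e, Lp.coeFn_zero ℝ 2 μ] with x hx hx0
    rw [← hx, hx0]; rfl
  have h2 : (fun x => u x / √(density μ x)) =ᵐ[volume] 0 := by
    filter_upwards [mul_density_congr h1] with x hx
    by_cases hz : density μ x = 0
    · simp [hz]
    · simpa [hz] using hx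
  have h3 := hd.ae_eq_zero h2
  have h4 : (fun x => d x * density μ x) =ᵐ[volume] 0 := by
    filter_upwards [h3] with x hx
    simp [hx]
  have h5 := hs.ae_eq_zero h4
  rw [Lp.eq_zero_iff_ae_eq_zero]
  filter_upwards [hμ.ae_le h5, density_ne_zero hμ] with x hx hz
  simpa [hz] using hx

/-- `L²₀(μ)`, the functions of `L²(μ)` with mean zero. -/
def L20 (μ : Measure ℝ) [IsFiniteMeasure μ] : Submodule ℝ (Lp ℝ 2 μ) where
  carrier := {f | ∫ x, f x ∂μ = 0}
  zero_mem' := by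
    simp only [Set.mem_ofPred_eq]
    exact integral_eq_zero_of_ae (Lp.coeFn_zero ℝ 2 μ)
  add_mem' := by
    intro f g hf hg
    simp only [Set.mem_ofPred_eq] at *
    rw [integral_congr_ae (Lp.coeFn_add f g)]
    simp only [Pi.add_apply]
    rw [integral_add ((Lp.memLp f).integrable (by norm_num))
      ((Lp.memLp g).integrable (by norm_num)), hf, hg, add_zero]
  smul_mem' := by
    intro c f hf
    simp only [Set.mem_ofPred_eq] at *
    rw [integral_congr_ae (Lp.coeFn_smul c f)]
    simp only [Pi.smul_apply]
    rw [integral_smul, hf, smul_zero]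

/-- The restriction of `A` to its domain `D_{L²₀(μ)}(A)` of mean zero functions. -/
def opA0 (V : ℝ → ℝ) (μ : Measure ℝ) [IsFiniteMeasure μ] : Lp ℝ 2 μ →ₗ.[ℝ] Lp ℝ 2 μ :=
  (opA V μ).domRestrict (L20 μ)

end HighTemp

end

noncomputable section

namespace HighTemp

/-! ### The energy in terms of densities -/

section withDensity

variable {α : Type*} [MeasurableSpace α] {ν : Measure α} {q f : α → ℝ}

lemma integrable_withDensity_ofReal_iff (hq : Measurable q) (h0 : ∀ x, 0 ≤ q x) :
    Integrable f (ν.withDensity fun x => ENNReal.ofReal (q x)) ↔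
      Integrable (fun x => q x * f x) ν := by
  rw [integrable_withDensity_iff_integrable_smul' hq.ennreal_ofReal
    (ae_of_all _ fun _ => ENNReal.ofReal_lt_top)]
  simp [ENNReal.toReal_ofReal, h0]

lemma integral_withDensity_ofReal (hq : Measurable q) (h0 : ∀ x, 0 ≤ q x) :
    ∫ x, f x ∂(ν.withDensity fun x => ENNReal.ofReal (q x)) = ∫ x, q x * f x ∂ν := by
  rw [integral_withDensity_eq_integral_toReal_smul hq.ennreal_ofReal
    (ae_of_all _ fun _ => ENNReal.ofReal_lt_top)]
  simp [ENNReal.toReal_ofReal, h0]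

end withDensity

/-- `∬ log |x - y| p(x) q(y) dx dy`. -/
def logEnergy (p q : ℝ → ℝ) : ℝ := ∫ z : ℝ × ℝ, p z.1 * q z.2 * Real.log |z.1 - z.2|

/-- `∫ (V + log q) q`. -/
def entropy (V q : ℝ → ℝ) : ℝ := ∫ x, q x * (V x + Real.log (q x))

/-- `∬ log |x - y| p(x) q(y) dx dy` converges absolutely. -/
def LogIntegrable (p q : ℝ → ℝ) : Prop :=
  Integrable (fun z : ℝ × ℝ => p z.1 * q z.2 * Real.log |z.1 - z.2|)

/-- `q` is a probability density of finite energy. -/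
structure FiniteEnergy (V q : ℝ → ℝ) : Prop where
  measurable : Measurable q
  nonneg : ∀ x, 0 ≤ q x
  integrable : Integrable q
  integral_eq_one : ∫ x, q x = 1
  entropy : Integrable fun x => q x * (V x + Real.log (q x))
  log : LogIntegrable q q

lemma measurable_density (μ : Measure ℝ) : Measurable (density μ) :=
  (Measure.measurable_rnDeriv μ volume).ennreal_toReal

lemma density_nonneg (μ : Measure ℝ) (x : ℝ) : 0 ≤ density μ x := ENNReal.toReal_nonneg

lemma withDensity_density {μ : Measure ℝ} [IsFiniteMeasure μ] (hμ : μ ≪ volume) :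
    (volume.withDensity fun x => ENNReal.ofReal (density μ x)) = μ := by
  conv_rhs => rw [← Measure.withDensity_rnDeriv_eq μ volume hμ]
  refine withDensity_congr_ae ?_
  filter_upwards [Measure.rnDeriv_lt_top μ volume] with x hx
  exact ENNReal.ofReal_toReal hx.ne

lemma density_withDensity {q : ℝ → ℝ} (hq : Measurable q) (h0 : ∀ x, 0 ≤ q x) :
    density (volume.withDensity fun x => ENNReal.ofReal (q x)) =ᵐ[volume] q := by
  filter_upwards [Measure.rnDeriv_withDensity volume hq.ennreal_ofReal] with x hx
  rw [density, hx, ENNReal.toReal_ofReal (h0 x)]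

lemma prod_withDensity_ofReal {p q : ℝ → ℝ} (hp : Measurable p) (hp0 : ∀ x, 0 ≤ p x)
    (hq : Measurable q) :
    (volume.withDensity fun x => ENNReal.ofReal (p x)).prod
        (volume.withDensity fun x => ENNReal.ofReal (q x)) =
      (volume : Measure (ℝ × ℝ)).withDensity fun z => ENNReal.ofReal (p z.1 * q z.2) := by
  rw [prod_withDensity hp.ennreal_ofReal hq.ennreal_ofReal]
  congr 1
  ext z
  rw [ENNReal.ofReal_mul (hp0 _)]

section energy

variable {V : ℝ → ℝ} {P : ℝ} {q : ℝ → ℝ}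

lemma integrable_log_prod_withDensity_iff (hq : Measurable q) (h0 : ∀ x, 0 ≤ q x) :
    Integrable (fun p : ℝ × ℝ => Real.log |p.1 - p.2|)
      ((volume.withDensity fun x => ENNReal.ofReal (q x)).prod
        (volume.withDensity fun x => ENNReal.ofReal (q x))) ↔ LogIntegrable q q := by
  rw [prod_withDensity_ofReal hq h0 hq, integrable_withDensity_ofReal_iff
    (q := fun z : ℝ × ℝ => q z.1 * q z.2) ((hq.comp measurable_fst).mul (hq.comp measurable_snd)) fun z => mul_nonneg (h0 _) (h0 _)]
  rfl

lemma mul_log_density_withDensity (hq : Measurable q) (h0 : ∀ x, 0 ≤ q x) :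
    (fun x => q x * (V x + Real.log (density
      (volume.withDensity fun x => ENNReal.ofReal (q x)) x))) =ᵐ[volume]
      fun x => q x * (V x + Real.log (q x)) := by
  filter_upwards [density_withDensity hq h0] with x hx
  rw [hx]

lemma energy_withDensity (h : FiniteEnergy V q) :
    energy V P (volume.withDensity fun x => ENNReal.ofReal (q x)) =
      ((entropy V q - P * logEnergy q q : ℝ) : EReal) := by
  have h1 := h.measurable
  have h2 := h.nonneg
  have h3 : Integrable (fun x => V x + Real.log (density
      (volume.withDensity fun x => ENNReal.ofReal (q x)) x))
      (volume.withDensity fun x => ENNReal.ofReal (q x)) := by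
    rw [integrable_withDensity_ofReal_iff h1 h2]
    exact (integrable_congr (mul_log_density_withDensity h1 h2)).2 h.entropy
  rw [energy, if_pos ⟨withDensity_absolutelyContinuous _ _, h3,
    (integrable_log_prod_withDensity_iff h1 h2).2 h.log⟩,
    integral_withDensity_ofReal h1 h2, prod_withDensity_ofReal h1 h2 h1,
    integral_withDensity_ofReal (q := fun z : ℝ × ℝ => q z.1 * q z.2)
      ((h1.comp measurable_fst).mul (h1.comp measurable_snd))
      fun z => mul_nonneg (h2 _) (h2 _), integral_congr_ae (mul_log_density_withDensity h1 h2)]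
  rfl

lemma isProbabilityMeasure_withDensity_ofReal (h0 : ∀ x, 0 ≤ q x) (hi : Integrable q)
    (h1 : ∫ x, q x = 1) :
    IsProbabilityMeasure (volume.withDensity fun x => ENNReal.ofReal (q x)) := by
  refine ⟨?_⟩
  rw [withDensity_apply _ MeasurableSet.univ, Measure.restrict_univ,
    ← ofReal_integral_eq_lintegral_ofReal hi (ae_of_all _ h0), h1, ENNReal.ofReal_one]

lemma integral_density_eq_one {μ : Measure ℝ} [IsProbabilityMeasure μ] (hμ : μ ≪ volume) :
    ∫ x, density μ x = 1 := by
  rw [show (fun x => density μ x) = fun x => (μ.rnDeriv volume x).toReal from rfl,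
    Measure.integral_toReal_rnDeriv hμ]
  simp

lemma finiteEnergy_density {μ : Measure ℝ} [IsProbabilityMeasure μ] (h : energy V P μ ≠ ⊤) :
    μ ≪ volume ∧ FiniteEnergy V (density μ) := by
  rw [energy] at h
  split_ifs at h with hc
  · obtain ⟨hac, hent, hlog⟩ := hc
    have hm := measurable_density μ
    have h0 := density_nonneg μ
    refine ⟨hac, hm, h0, Measure.integrable_toReal_rnDeriv, integral_density_eq_one hac, ?_, ?_⟩
    · rw [← integrable_withDensity_ofReal_iff hm h0, withDensity_density hac]
      exact hent
    · rw [← integrable_log_prod_withDensity_iff hm h0, withDensity_density hac]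
      exact hlog
  · exact absurd rfl h

/-- The density of the equilibrium measure minimizes the energy. -/
lemma IsEquilibriumMeasure.density_le {μ : Measure ℝ} [IsProbabilityMeasure μ]
    (hμ : IsEquilibriumMeasure V P μ) {q₀ : ℝ → ℝ} (hq₀ : FiniteEnergy V q₀) :
    μ ≪ volume ∧ FiniteEnergy V (density μ) ∧ ∀ q, FiniteEnergy V q →
      entropy V (density μ) - P * logEnergy (density μ) (density μ) ≤
        entropy V q - P * logEnergy q q := by
  have key : ∀ q, FiniteEnergy V q → energy V P μ ≤
      ((entropy V q - P * logEnergy q q : ℝ) : EReal) := fun q hq => by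
    rw [← energy_withDensity hq]
    exact hμ.2 _ (isProbabilityMeasure_withDensity_ofReal hq.nonneg hq.integrable
      hq.integral_eq_one)
  obtain ⟨h1, h2⟩ := finiteEnergy_density ((key q₀ hq₀).trans_lt (EReal.coe_lt_top _)).ne
  refine ⟨h1, h2, fun q hq => ?_⟩
  have := key q hq
  rw [← withDensity_density h1, energy_withDensity h2] at this
  exact_mod_cast this

end energy

/-! ### Integrability of the logarithmic kernel -/

lemma log_one_add_abs_add_le (x y : ℝ) :
    Real.log (1 + |x + y|) ≤ Real.log (1 + |x|) + Real.log (1 + |y|) := by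
  rw [← Real.log_mul (by positivity) (by positivity)]
  apply Real.log_le_log (by positivity)
  nlinarith [abs_add_le x y, abs_nonneg x, abs_nonneg y, mul_nonneg (abs_nonneg x) (abs_nonneg y)]

lemma log_one_add_abs_nonneg (x : ℝ) : 0 ≤ Real.log (1 + |x|) :=
  Real.log_nonneg (by linarith [abs_nonneg x])

lemma log_abs_le (z : ℝ) : Real.log |z| ≤ Real.log (1 + |z|) := by
  rcases eq_or_ne z 0 with rfl | hz
  · simp
  · exact Real.log_le_log (abs_pos.2 hz) (by linarith)

lemma log_one_add_abs_le (z : ℝ) : Real.log (1 + |z|) ≤ Real.log 2 + |Real.log (|z|)| := by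
  rcases le_total |z| 1 with h | h
  · have : Real.log (1 + |z|) ≤ Real.log 2 := Real.log_le_log (by positivity) (by linarith)
    linarith [abs_nonneg (Real.log |z|)]
  · calc Real.log (1 + |z|) ≤ Real.log (2 * |z|) := Real.log_le_log (by positivity) (by linarith)
      _ = Real.log 2 + Real.log |z| := Real.log_mul (by norm_num) (by positivity)
      _ ≤ _ := by gcongr; exact le_abs_self _

/-- The singular part of the logarithmic kernel. -/
def logSing (z : ℝ) : ℝ := (Set.Icc (-1) 1).indicator (fun z => Real.log |z|) z

lemma integrable_logSing : Integrable logSing := by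
  have h : IntervalIntegrable Real.log volume (-1) 1 := intervalIntegral.intervalIntegrable_log'
  rw [intervalIntegrable_iff_integrableOn_Icc_of_le (by norm_num)] at h
  refine (h.integrable_indicator measurableSet_Icc).congr (ae_of_all _ fun z => ?_)
  by_cases hz : z ∈ Set.Icc (-1 : ℝ) 1 <;> simp [logSing, hz]

lemma abs_log_abs_le (z : ℝ) : |Real.log (|z|)| ≤ |logSing z| + Real.log (1 + |z|) := by
  by_cases h : z ∈ Set.Icc (-1 : ℝ) 1
  · rw [logSing, Set.indicator_of_mem h]
    linarith [log_one_add_abs_nonneg z]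
  · rw [logSing, Set.indicator_of_notMem h, abs_zero, zero_add]
    have h1 : 1 < |z| := by
      by_contra! hc
      exact h (abs_le.1 hc)
    rw [abs_of_nonneg (Real.log_nonneg h1.le)]
    exact log_abs_le z

lemma measurable_log_abs_sub : Measurable fun z : ℝ × ℝ => Real.log |z.1 - z.2| :=
  Real.measurable_log.comp ((measurable_fst.sub measurable_snd).norm)

/-- A bounded density with a logarithmic moment has finite logarithmic energy against every
density with a logarithmic moment. -/
lemma LogIntegrable.of_bounded {p q : ℝ → ℝ} (hpm : Measurable p) {M : ℝ} (hM : ∀ x, |p x| ≤ M)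
    (hp : Integrable p) (hpl : Integrable fun x => p x * Real.log (1 + |x|))
    (hqm : Measurable q)
    (hq : Integrable q) (hql : Integrable fun x => q x * Real.log (1 + |x|)) :
    LogIntegrable p q := by
  have h1 : Integrable (fun z : ℝ × ℝ => p z.1 * (q z.2 * logSing (z.1 - z.2))) :=
    (hq.convolution_integrand (ContinuousLinearMap.mul ℝ ℝ) integrable_logSing).bdd_mul
      (hpm.comp measurable_fst).aestronglyMeasurable (ae_of_all _ fun z => hM z.1)
  have h2 : Integrable (fun z : ℝ × ℝ => (p z.1 * Real.log (1 + |z.1|)) * q z.2) := hpl.mul_prod hq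
  have h3 : Integrable (fun z : ℝ × ℝ => p z.1 * (q z.2 * Real.log (1 + |z.2|))) := hp.mul_prod hql
  refine Integrable.mono' ((h1.norm.add h2.norm).add h3.norm)
    (((hpm.comp measurable_fst).mul (hqm.comp measurable_snd)).mul
      measurable_log_abs_sub).aestronglyMeasurable (ae_of_all _ fun z => ?_)
  have e : Real.log (1 + |z.1 - z.2|) ≤ Real.log (1 + |z.1|) + Real.log (1 + |z.2|) := by
    simpa [sub_eq_add_neg] using log_one_add_abs_add_le z.1 (-z.2)
  have := (abs_log_abs_le (z.1 - z.2)).trans (add_le_add_right e _)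
  simp only [Pi.add_apply, norm_mul, Real.norm_eq_abs, abs_of_nonneg (log_one_add_abs_nonneg _)]
  calc |p z.1| * |q z.2| * |Real.log (|z.1 - z.2|)| ≤ |p z.1| * |q z.2| *
          (|logSing (z.1 - z.2)| + (Real.log (1 + |z.1|) + Real.log (1 + |z.2|))) := by gcongr
    _ = _ := by ring

lemma LogIntegrable.symm {p q : ℝ → ℝ} (h : LogIntegrable p q) : LogIntegrable q p := by
  have := Integrable.swap h
  refine this.congr (ae_of_all _ fun z => ?_)
  simp only [Function.comp_apply, Prod.fst_swap, Prod.snd_swap, abs_sub_comm z.2 z.1]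
  ring

lemma logEnergy_comm (p q : ℝ → ℝ) : logEnergy p q = logEnergy q p := by
  rw [logEnergy, logEnergy, Measure.volume_eq_prod, ← integral_prod_swap]
  refine integral_congr_ae (ae_of_all _ fun z => ?_)
  simp only [Prod.fst_swap, Prod.snd_swap, abs_sub_comm z.2 z.1]
  ring

lemma integrable_mul_log_one_add_abs {q : ℝ → ℝ} (hq : Integrable q) (h0 : ∀ x, 0 ≤ q x)
    (h1 : ∫ x, q x = 1) (hl : LogIntegrable q q) :
    Integrable fun x => q x * Real.log (1 + |x|) := by
  have hae := Integrable.prod_left_ae hl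
  have hne : ∃ y, q y ≠ 0 ∧ Integrable (fun x => q x * q y * Real.log |x - y|) := by
    by_contra! hc
    have : q =ᵐ[volume] 0 := by
      filter_upwards [hae] with y hy
      by_contra h
      exact hc y h hy
    rw [integral_congr_ae this] at h1
    simp at h1
  obtain ⟨y, hy, hi⟩ := hne
  have hi2 : Integrable (fun x => q x * Real.log |x - y|) := by
    refine (hi.mul_const (q y)⁻¹).congr (ae_of_all _ fun x => ?_)
    field_simp
  refine Integrable.mono' ((hi2.norm.add (hq.mul_const (Real.log 2))).add
    (hq.mul_const (Real.log (1 + |y|)))) (hq.aestronglyMeasurable.mul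
    (Real.measurable_log.comp (measurable_const.add measurable_id.norm)).aestronglyMeasurable)
    (ae_of_all _ fun x => ?_)
  have e := log_one_add_abs_add_le (x - y) y
  rw [sub_add_cancel] at e
  have e2 := e.trans (add_le_add_left (log_one_add_abs_le (x - y)) _)
  simp only [Pi.add_apply, norm_mul, Real.norm_eq_abs, abs_of_nonneg (log_one_add_abs_nonneg _),
    abs_of_nonneg (h0 x)]
  calc q x * Real.log (1 + |x|) ≤ q x * _ := mul_le_mul_of_nonneg_left e2 (h0 x)
    _ = _ := by ring

/-- The normalized indicator function of a bounded set of positive measure. -/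
lemma finiteEnergy_uniform {V : ℝ → ℝ} (hV : Continuous V) {B : Set ℝ} (hB : MeasurableSet B)
    {R : ℝ} (hR : B ⊆ Set.Icc (-R) R) (hpos : 0 < volume.real B) :
    FiniteEnergy V (B.indicator fun _ => (volume.real B)⁻¹) ∧
      (Integrable fun x => B.indicator (fun _ => (volume.real B)⁻¹) x * Real.log (1 + |x|)) ∧
      (Integrable fun x => B.indicator (fun _ => (volume.real B)⁻¹) x * V x) := by
  set c := (volume.real B)⁻¹ with hc
  have hfin : volume B ≠ ⊤ := ((measure_mono hR).trans_lt (by simp)).ne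
  have hm : Measurable (B.indicator fun _ => c) := measurable_const.indicator hB
  have hmul : ∀ f : ℝ → ℝ, Continuous f → Integrable fun x => B.indicator (fun _ => c) x * f x := by
    intro f hf
    have : (fun x => B.indicator (fun _ => c) x * f x) = B.indicator fun x => c * f x := by
      ext x; by_cases hx : x ∈ B <;> simp [hx]
    rw [this, integrable_indicator_iff hB]
    exact ((continuous_const.mul hf).integrableOn_Icc).mono_set hR
  have hi : Integrable (B.indicator fun _ => c) := by
    simpa using hmul (fun _ => 1) continuous_const
  have hl := hmul (fun x => Real.log (1 + |x|))
    (Continuous.log (by fun_prop) fun x => by positivity)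
  refine ⟨⟨hm, fun x => Set.indicator_nonneg (fun _ _ => by positivity) x, hi, ?_, ?_, ?_⟩, hl,
    hmul V hV⟩
  · rw [integral_indicator_const _ hB, smul_eq_mul, hc, mul_inv_cancel₀ hpos.ne']
  · refine (hmul (fun x => V x + Real.log c) (by fun_prop)).congr (ae_of_all _ fun x => ?_)
    by_cases hx : x ∈ B <;> simp [hx]
  · refine LogIntegrable.of_bounded hm (M := c) (fun x => ?_) hi hl hm hi hl
    by_cases hx : x ∈ B <;> simp [hx, hc, abs_of_pos hpos]

/-! ### The Euler-Lagrange equation -/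

lemma LogIntegrable.combination {p q : ℝ → ℝ} (hpp : LogIntegrable p p) (hpq : LogIntegrable p q)
    (hqq : LogIntegrable q q) (a b : ℝ) :
    LogIntegrable (fun x => a * p x + b * q x) (fun x => a * p x + b * q x) ∧
      logEnergy (fun x => a * p x + b * q x) (fun x => a * p x + b * q x) =
        a ^ 2 * logEnergy p p + 2 * a * b * logEnergy p q + b ^ 2 * logEnergy q q := by
  have e : (fun z : ℝ × ℝ => (a * p z.1 + b * q z.1) * (a * p z.2 + b * q z.2) *
      Real.log |z.1 - z.2|) = fun z => (a ^ 2 * (p z.1 * p z.2 * Real.log |z.1 - z.2|) +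
        a * b * (p z.1 * q z.2 * Real.log |z.1 - z.2|)) +
        (a * b * (q z.1 * p z.2 * Real.log |z.1 - z.2|) +
        b ^ 2 * (q z.1 * q z.2 * Real.log |z.1 - z.2|)) := by
    ext z; ring
  have h1 := Integrable.const_mul hpp (a ^ 2)
  have h2 := Integrable.const_mul hpq (a * b)
  have h3 := Integrable.const_mul hpq.symm (a * b)
  have h4 := Integrable.const_mul hqq (b ^ 2)
  constructor
  · rw [LogIntegrable, e]
    exact (h1.add h2).add (h3.add h4)
  · rw [logEnergy, e, integral_add (h1.fun_add h2) (h3.fun_add h4), integral_add h1 h2,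
      integral_add h3 h4, integral_const_mul, integral_const_mul, integral_const_mul,
      integral_const_mul]
    change a ^ 2 * logEnergy p p + a * b * logEnergy p q + (a * b * logEnergy q p +
      b ^ 2 * logEnergy q q) = _
    rw [logEnergy_comm q p]
    ring

lemma LogIntegrable.bdd_mul {p q f g : ℝ → ℝ} (h : LogIntegrable p q) (hf : Measurable f)
    (hg : Measurable g) {M N : ℝ} (hM : ∀ x, |f x| ≤ M) (hN : ∀ x, |g x| ≤ N) :
    LogIntegrable (fun x => f x * p x) (fun x => g x * q x) := by
  have hM0 : 0 ≤ M := (abs_nonneg _).trans (hM 0)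
  have := Integrable.bdd_mul (c := M * N) h
    ((hf.comp measurable_fst).mul (hg.comp measurable_snd)).aestronglyMeasurable
    (ae_of_all _ fun z => by
      simp only [Pi.mul_apply, Function.comp_apply, norm_mul, Real.norm_eq_abs]
      exact mul_le_mul (hM _) (hN _) (abs_nonneg _) hM0)
  refine this.congr (ae_of_all _ fun z => ?_)
  simp only [Pi.mul_apply, Function.comp_apply]
  ring

/-- The logarithmic potential `∫ log |x - y| q(y) dy`. -/
def logPot (q : ℝ → ℝ) (x : ℝ) : ℝ := ∫ y, q y * Real.log |x - y|

lemma logEnergy_eq_integral_logPot {p q : ℝ → ℝ} (h : LogIntegrable p q) :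
    (Integrable fun x => p x * logPot q x) ∧ logEnergy p q = ∫ x, p x * logPot q x := by
  have e : (fun x => p x * logPot q x) = fun x => ∫ y, p x * q y * Real.log |x - y| := by
    ext x
    rw [logPot, ← integral_const_mul]
    congr 1
    ext y
    ring
  rw [e]
  exact ⟨Integrable.integral_prod_left h, integral_prod _ h⟩

/-- A quadratic polynomial which is nonnegative near its zero `0` has no linear term. -/
lemma eq_zero_of_forall_nonneg {a M : ℝ} (h : ∀ t : ℝ, |t| ≤ 1 / 2 → 0 ≤ t * a + t ^ 2 * M) :
    a = 0 := by
  by_contra ha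
  have hM : 0 < |M| + |a| + 1 := by positivity
  set K := 2 * (|M| + |a| + 1) with hK
  have hKpos : 0 < K := by positivity
  have h1 := h (-(a / K)) (by
    rw [abs_neg, abs_div, abs_of_pos hKpos, div_le_div_iff₀ hKpos (by norm_num)]
    nlinarith [abs_nonneg M])
  have h2 : -(a / K) * a + (-(a / K)) ^ 2 * M = a ^ 2 / K ^ 2 * (M - K) := by
    field_simp; ring
  rw [h2] at h1
  have h3 : 0 < a ^ 2 / K ^ 2 := by positivity
  have h4 : M - K < 0 := by linarith [le_abs_self M, abs_nonneg M, abs_nonneg a]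
  nlinarith

/-- A density which minimizes the energy. -/
structure IsMinimizer (V : ℝ → ℝ) (P : ℝ) (ρ : ℝ → ℝ) : Prop where
  finiteEnergy : FiniteEnergy V ρ
  le : ∀ q, FiniteEnergy V q →
    entropy V ρ - P * logEnergy ρ ρ ≤ entropy V q - P * logEnergy q q

variable {V : ℝ → ℝ} {P : ℝ} {ρ : ℝ → ℝ}

lemma one_add_mul_log_one_add_le {s : ℝ} (h : -1 < s) :
    (1 + s) * Real.log (1 + s) ≤ s + s ^ 2 := by
  have := Real.log_le_sub_one_of_pos (show 0 < 1 + s by linarith)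
  nlinarith

/-- The first variation of the energy vanishes. -/
lemma IsMinimizer.first_variation (h : IsMinimizer V P ρ) {g : ℝ → ℝ} (hg : Measurable g)
    (hg1 : ∀ x, |g x| ≤ 1) (hg0 : ∫ x, g x * ρ x = 0) :
    ∫ x, g x * (ρ x * (V x + Real.log (ρ x)) - 2 * P * (ρ x * logPot ρ x)) = 0 := by
  obtain ⟨hm, hn, hi, hone, hent, hlog⟩ := h.finiteEnergy
  have hgi : Integrable fun x => g x * ρ x :=
    hi.bdd_mul hg.aestronglyMeasurable (ae_of_all _ hg1)
  have hge : Integrable fun x => g x * (ρ x * (V x + Real.log (ρ x))) :=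
    hent.bdd_mul hg.aestronglyMeasurable (ae_of_all _ hg1)
  have hgg : Integrable fun x => g x ^ 2 * ρ x := by
    refine (hgi.bdd_mul hg.aestronglyMeasurable (ae_of_all _ hg1)).congr (ae_of_all _ fun x => ?_)
    simp only
    ring
  have hlg : LogIntegrable ρ (fun x => g x * ρ x) := by
    simpa using hlog.bdd_mul (f := fun _ => 1) measurable_const hg (M := 1) (by simp) hg1
  have hgl : LogIntegrable (fun x => g x * ρ x) (fun x => g x * ρ x) :=
    hlog.bdd_mul hg hg hg1 hg1
  obtain ⟨hU, -⟩ := logEnergy_eq_integral_logPot hlog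
  have hUg := (logEnergy_eq_integral_logPot hlg.symm)
  have hgU : Integrable fun x => g x * (2 * P * (ρ x * logPot ρ x)) :=
    (hU.const_mul _).bdd_mul hg.aestronglyMeasurable (ae_of_all _ hg1)
  have key : ∫ x, g x * (ρ x * (V x + Real.log (ρ x)) - 2 * P * (ρ x * logPot ρ x)) =
      (∫ x, g x * (ρ x * (V x + Real.log (ρ x)))) - 2 * P * logEnergy ρ (fun x => g x * ρ x) := by
    simp only [mul_sub]
    rw [integral_sub hge hgU, logEnergy_comm, hUg.2, ← integral_const_mul]
    congr 2
    ext x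
    ring
  rw [key]
  refine eq_zero_of_forall_nonneg
    (M := (∫ x, g x ^ 2 * ρ x) - P * logEnergy (fun x => g x * ρ x) (fun x => g x * ρ x))
    fun t ht => ?_
  have hs : ∀ x, |t * g x| ≤ 1 / 2 := fun x => by
    rw [abs_mul]; nlinarith [hg1 x, abs_nonneg t, abs_nonneg (g x)]
  have hpos : ∀ x, 0 < 1 + t * g x := fun x => by linarith [(abs_le.1 (hs x)).1]
  have eq : (fun x => ρ x * (1 + t * g x)) = fun x => 1 * ρ x + t * (g x * ρ x) := by
    ext x; ring
  have hcomb := hlog.combination hlg hgl 1 t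
  have hent' : (fun x => ρ x * (1 + t * g x) * (V x + Real.log (ρ x * (1 + t * g x)))) =
      fun x => (ρ x * (V x + Real.log (ρ x)) + t * (g x * (ρ x * (V x + Real.log (ρ x))))) +
        ((1 + t * g x) * Real.log (1 + t * g x)) * ρ x := by
    ext x
    rcases eq_or_ne (ρ x) 0 with h0 | h0
    · simp [h0]
    · rw [Real.log_mul h0 (hpos x).ne']; ring
  have hb : ∀ x, |(1 + t * g x) * Real.log (1 + t * g x)| ≤ 2 := fun x => by
    have h1 := one_add_mul_log_one_add_le (s := t * g x) (by linarith [hpos x])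
    have h2 := Real.one_sub_inv_le_log_of_pos (hpos x)
    have h3 : t * g x ≤ (1 + t * g x) * Real.log (1 + t * g x) := by
      calc t * g x = (1 + t * g x) * (1 - (1 + t * g x)⁻¹) := by
            rw [mul_sub, mul_inv_cancel₀ (hpos x).ne']; ring
        _ ≤ _ := mul_le_mul_of_nonneg_left h2 (hpos x).le
    have h4 := abs_le.1 (hs x)
    rw [abs_le]
    constructor <;> nlinarith
  have hmt : Measurable fun x => 1 + t * g x := measurable_const.add (hg.const_mul t)
  have hlast : Integrable fun x => ((1 + t * g x) * Real.log (1 + t * g x)) * ρ x :=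
    hi.bdd_mul (hmt.mul (Real.measurable_log.comp hmt)).aestronglyMeasurable (ae_of_all _ hb)
  have hfe : FiniteEnergy V fun x => ρ x * (1 + t * g x) := by
    refine ⟨hm.mul hmt, fun x => mul_nonneg (hn x) (hpos x).le, ?_, ?_, ?_, ?_⟩
    · rw [eq]
      exact (hi.const_mul 1).add (hgi.const_mul t)
    · rw [eq, integral_add (hi.const_mul 1) (hgi.const_mul t), integral_const_mul,
        integral_const_mul, hg0, hone]
      ring
    · rw [hent']
      exact (hent.add (hge.const_mul t)).add hlast
    · rw [eq]
      exact hcomb.1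
  have hle := h.le _ hfe
  have e1 : entropy V (fun x => ρ x * (1 + t * g x)) ≤ entropy V ρ +
      t * (∫ x, g x * (ρ x * (V x + Real.log (ρ x)))) + t ^ 2 * ∫ x, g x ^ 2 * ρ x := by
    rw [entropy, hent', integral_add (hent.fun_add (hge.const_mul t)) hlast,
      integral_add hent (hge.const_mul t), integral_const_mul]
    have : ∫ x, ((1 + t * g x) * Real.log (1 + t * g x)) * ρ x ≤
        ∫ x, (t * (g x * ρ x) + t ^ 2 * (g x ^ 2 * ρ x)) := by
      refine integral_mono hlast ((hgi.const_mul t).add (hgg.const_mul _)) fun x => ?_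
      have := one_add_mul_log_one_add_le (s := t * g x) (by linarith [hpos x])
      calc _ ≤ (t * g x + (t * g x) ^ 2) * ρ x := mul_le_mul_of_nonneg_right this (hn x)
        _ = _ := by ring
    rw [integral_add (hgi.const_mul t) (hgg.const_mul _), integral_const_mul,
      integral_const_mul, hg0] at this
    rw [entropy]
    linarith
  rw [eq] at hle e1
  rw [hcomb.2] at hle
  linarith

/-- The Euler-Lagrange equation on the set where the density is positive. -/
lemma IsMinimizer.exists_euler_lagrange (h : IsMinimizer V P ρ) :
    ∃ κ : ℝ, ∀ᵐ x, ρ x * (V x + Real.log (ρ x) - 2 * P * logPot ρ x) = κ * ρ x := by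
  obtain ⟨hm, hn, hi, hone, hent, hlog⟩ := h.finiteEnergy
  obtain ⟨hU, -⟩ := logEnergy_eq_integral_logPot hlog
  set D : ℝ → ℝ := fun x => ρ x * (V x + Real.log (ρ x)) - 2 * P * (ρ x * logPot ρ x) with hD
  have hDi : Integrable D := hent.sub (hU.const_mul _)
  refine ⟨∫ x, D x, ?_⟩
  have hae : D =ᵐ[volume] fun x => (∫ x, D x) * ρ x := by
    refine hDi.ae_eq_of_forall_setIntegral_eq _ _ (hi.const_mul _) fun A hA _ => ?_
    rw [integral_const_mul]
    set m := ∫ x in A, ρ x with hmdef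
    have hm0 : 0 ≤ m := integral_nonneg hn
    have hm1 : m ≤ 1 := by
      rw [← hone]
      exact setIntegral_le_integral hi (ae_of_all _ hn)
    have hind : ∀ f : ℝ → ℝ, Integrable f →
        ∫ x, (A.indicator (fun _ => (1 : ℝ)) x - m) * f x = (∫ x in A, f x) - m * ∫ x, f x := by
      intro f hf
      rw [← integral_indicator hA, ← integral_const_mul,
        ← integral_sub (hf.indicator hA) (hf.const_mul m)]
      congr 1
      ext x
      by_cases hx : x ∈ A <;> simp [hx, sub_mul]
    have := h.first_variation (g := fun x => A.indicator (fun _ => (1 : ℝ)) x - m)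
      ((measurable_const.indicator hA).sub measurable_const) (fun x => by
        by_cases hx : x ∈ A <;> simp only [hx, Set.indicator_of_mem, Set.indicator_of_notMem,
          not_false_eq_true, abs_le] <;> constructor <;> linarith) (by
        rw [hind _ hi, hone]; simp [hmdef])
    rw [hind _ hDi] at this
    linarith
  filter_upwards [hae] with x hx
  rw [← hx, hD]
  ring

/-- The density of a minimizer is positive. -/
lemma IsMinimizer.ae_pos (hV : Continuous V) (h : IsMinimizer V P ρ) : ∀ᵐ x, 0 < ρ x := by
  obtain ⟨hm, hn, hi, hone, hent, hlog⟩ := h.finiteEnergy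
  suffices hz : ∀ n : ℕ, volume (ρ ⁻¹' {0} ∩ Set.Icc (-(n : ℝ)) n) = 0 by
    have h0 : volume (ρ ⁻¹' {0}) = 0 := by
      have : ρ ⁻¹' {0} ⊆ ⋃ n : ℕ, ρ ⁻¹' {0} ∩ Set.Icc (-(n : ℝ)) n := fun x hx => by
        obtain ⟨n, hn⟩ := exists_nat_ge |x|
        exact Set.mem_iUnion.2 ⟨n, hx, abs_le.1 hn⟩
      exact measure_mono_null this (measure_iUnion_null hz)
    have : ∀ᵐ x, ρ x ≠ 0 := by
      rw [ae_iff]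
      simpa [Set.preimage] using h0
    filter_upwards [this] with x hx
    exact lt_of_le_of_ne (hn x) hx.symm
  intro n
  by_contra hne
  set B := ρ ⁻¹' {0} ∩ Set.Icc (-(n : ℝ)) n with hB
  have hBm : MeasurableSet B := (hm (measurableSet_singleton 0)).inter measurableSet_Icc
  have hfin : volume B ≠ ⊤ := ((measure_mono Set.inter_subset_right).trans_lt (by simp)).ne
  have hpos : 0 < volume.real B := ENNReal.toReal_pos hne hfin
  obtain ⟨hfe, hβl, hβV⟩ := finiteEnergy_uniform hV hBm Set.inter_subset_right hpos
  set c := (volume.real B)⁻¹ with hc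
  have hcpos : 0 < c := inv_pos.2 hpos
  set β := B.indicator fun _ => c with hβ
  have hbl : LogIntegrable β ρ := LogIntegrable.of_bounded hfe.measurable (M := c) (fun x => by
    by_cases hx : x ∈ B <;> simp [hβ, hx, abs_of_pos hcpos, hcpos.le]) hfe.integrable hβl hm hi
    (integrable_mul_log_one_add_abs hi hn hone hlog)
  set S := entropy V ρ
  set L1 := logEnergy ρ ρ
  set L2 := logEnergy ρ β
  set L3 := logEnergy β β
  set b := (∫ x, β x * V x) + Real.log c
  have key : ∀ t : ℝ, 0 < t → t ≤ 1 / 2 →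
      0 ≤ t * (Real.log t + (|S| + |b| + |P| * (2 * |L1| + 2 * |L2| + |L3|))) := by
    intro t ht0 ht1
    have ht2 : 0 < 1 - t := by linarith
    have hcomb := hlog.combination hbl.symm hfe.log (1 - t) t
    have hent' : (fun x => ((1 - t) * ρ x + t * β x) *
        (V x + Real.log ((1 - t) * ρ x + t * β x))) = fun x =>
        ((1 - t) * (ρ x * (V x + Real.log (ρ x))) + (1 - t) * Real.log (1 - t) * ρ x) +
        (t * (β x * V x) + t * (Real.log t + Real.log c) * β x) := by
      ext x
      by_cases hx : x ∈ B
      · have h0 : ρ x = 0 := hx.1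
        have h1 : β x = c := by simp [hβ, hx]
        rw [h0, h1, ← Real.log_mul ht0.ne' hcpos.ne']
        simp
        ring
      · have h1 : β x = 0 := by simp [hβ, hx]
        rw [h1]
        rcases eq_or_ne (ρ x) 0 with h0 | h0
        · simp [h0]
        · simp only [mul_zero, add_zero, zero_mul]
          rw [Real.log_mul ht2.ne' h0]
          ring
    have i1 : Integrable fun x => (1 - t) * (ρ x * (V x + Real.log (ρ x))) := hent.const_mul _
    have i2 : Integrable fun x => (1 - t) * Real.log (1 - t) * ρ x := hi.const_mul _
    have i3 : Integrable fun x => t * (β x * V x) := hβV.const_mul _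
    have i4 : Integrable fun x => t * (Real.log t + Real.log c) * β x := hfe.integrable.const_mul _
    have hq : FiniteEnergy V fun x => (1 - t) * ρ x + t * β x := by
      refine ⟨(hm.const_mul _).add (hfe.measurable.const_mul _), fun x => ?_,
        (hi.const_mul _).add (hfe.integrable.const_mul _), ?_, ?_, hcomb.1⟩
      · exact add_nonneg (mul_nonneg ht2.le (hn x)) (mul_nonneg ht0.le (hfe.nonneg x))
      · rw [integral_add (hi.const_mul _) (hfe.integrable.const_mul _), integral_const_mul,
          integral_const_mul, hone, hfe.integral_eq_one]
        ring
      · rw [hent']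
        exact (i1.add i2).add (i3.add i4)
    have hle := h.le _ hq
    have e1 : entropy V (fun x => (1 - t) * ρ x + t * β x) =
        (1 - t) * S + (1 - t) * Real.log (1 - t) + t * Real.log t + t * b := by
      rw [entropy, hent', integral_add (i1.fun_add i2) (i3.fun_add i4), integral_add i1 i2,
        integral_add i3 i4, integral_const_mul, integral_const_mul, integral_const_mul,
        integral_const_mul, hone, hfe.integral_eq_one]
      change (1 - t) * S + _ + _ = _
      ring
    rw [hcomb.2, e1] at hle
    have hlog0 : (1 - t) * Real.log (1 - t) ≤ 0 :=
      mul_nonpos_of_nonneg_of_nonpos ht2.le (Real.log_nonpos ht2.le (by linarith))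
    have b1 : -(t * S) ≤ t * |S| := by nlinarith [neg_abs_le S]
    have b2 : t * b ≤ t * |b| := by nlinarith [le_abs_self b]
    have b3 : -(P * (((1 - t) ^ 2 - 1) * L1 + 2 * (1 - t) * t * L2 + t ^ 2 * L3)) ≤
        t * (|P| * (2 * |L1| + 2 * |L2| + |L3|)) := by
      refine (neg_le_abs _).trans ?_
      rw [abs_mul]
      have : |((1 - t) ^ 2 - 1) * L1 + 2 * (1 - t) * t * L2 + t ^ 2 * L3| ≤
          t * (2 * |L1| + 2 * |L2| + |L3|) := by
        refine (abs_add_three _ _ _).trans ?_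
        rw [abs_mul, abs_mul _ L2, abs_mul _ L3, show |(1 - t) ^ 2 - 1| = t * (2 - t) by
          rw [abs_of_nonpos (by nlinarith)]; ring, abs_of_nonneg (show 0 ≤ 2 * (1 - t) * t by
          positivity), abs_of_nonneg (show 0 ≤ t ^ 2 by positivity)]
        have a1 := mul_nonneg ht0.le (abs_nonneg L1)
        have a2 := mul_nonneg ht0.le (abs_nonneg L2)
        have a3 := mul_nonneg ht0.le (abs_nonneg L3)
        nlinarith
      calc _ ≤ |P| * (t * (2 * |L1| + 2 * |L2| + |L3|)) := by gcongr
        _ = _ := by ring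
    nlinarith
  set M := |S| + |b| + |P| * (2 * |L1| + 2 * |L2| + |L3|) with hM
  have hM0 : 0 ≤ M := by positivity
  have ht : Real.exp (-(M + 1)) ≤ 1 / 2 := by
    have : Real.exp (-1) < 0.3678794412 := Real.exp_neg_one_lt_d9
    refine (Real.exp_le_exp.2 (show -(M + 1) ≤ -1 by linarith)).trans (by linarith)
  have := key _ (Real.exp_pos _) ht
  rw [Real.log_exp] at this
  nlinarith [Real.exp_pos (-(M + 1))]

/-- The density of the equilibrium measure is positive and satisfies the Euler-Lagrange
equation. -/
lemma IsEquilibriumMeasure.euler_lagrange {μ : Measure ℝ} [IsProbabilityMeasure μ]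
    (hμ : IsEquilibriumMeasure V P μ) (hV : Continuous V) :
    μ ≪ volume ∧ FiniteEnergy V (density μ) ∧ ∃ κ : ℝ, ∀ᵐ x, density μ x =
      Real.exp (-V x + 2 * P * logPot (density μ) x + κ) := by
  obtain ⟨h1, h2, h3⟩ := hμ.density_le (finiteEnergy_uniform hV (measurableSet_Icc (a := (-1 : ℝ))
    (b := 1)) (R := 1) le_rfl (by simp)).1
  have hmin : IsMinimizer V P (density μ) := ⟨h2, h3⟩
  obtain ⟨κ, hκ⟩ := hmin.exists_euler_lagrange
  refine ⟨h1, h2, κ, ?_⟩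
  filter_upwards [hκ, hmin.ae_pos hV] with x hx hpos
  have : V x + Real.log (density μ x) - 2 * P * logPot (density μ) x = κ := by
    rw [mul_comm κ] at hx
    exact mul_left_cancel₀ hpos.ne' hx
  rw [← this, show -V x + 2 * P * logPot (density μ) x + (V x + Real.log (density μ x) -
    2 * P * logPot (density μ) x) = Real.log (density μ x) by ring, Real.exp_log hpos]

/-! ### The logarithmic potential of a bounded density -/

/-- `1 / √|z|` on `[-1, 1]`. -/
def sqrtSing (z : ℝ) : ℝ := (Set.Icc (-1) 1).indicator (fun z => (√|z|)⁻¹) z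

lemma sqrtSing_nonneg (z : ℝ) : 0 ≤ sqrtSing z :=
  Set.indicator_nonneg (fun _ _ => by positivity) z

lemma integrable_sqrtSing : Integrable sqrtSing := by
  have h1 : IntervalIntegrable (fun z : ℝ => (√|z|)⁻¹) volume 0 1 := by
    have : IntervalIntegrable (fun z : ℝ => z ^ (-(1 / 2) : ℝ)) volume 0 1 :=
      intervalIntegral.intervalIntegrable_rpow' (by norm_num)
    refine this.congr fun z hz => ?_
    rw [Set.uIoc_of_le zero_le_one] at hz
    rw [abs_of_pos hz.1, Real.rpow_neg hz.1.le, Real.sqrt_eq_rpow]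
  have h2 : IntervalIntegrable (fun z : ℝ => (√|z|)⁻¹) volume (-1) 0 := by
    simpa using (h1.comp_sub_left 0).symm
  have h := h2.trans h1
  rw [intervalIntegrable_iff_integrableOn_Icc_of_le (by norm_num)] at h
  exact h.integrable_indicator measurableSet_Icc

lemma inv_sqrt_abs_le (z : ℝ) : (√|z|)⁻¹ ≤ sqrtSing z + 1 := by
  by_cases h : z ∈ Set.Icc (-1 : ℝ) 1
  · simp [sqrtSing, h]
  · have h1 : 1 < |z| := by
      by_contra! hc
      exact h (abs_le.1 hc)
    have : (√|z|)⁻¹ ≤ 1 := inv_le_one_of_one_le₀ (Real.one_le_sqrt.2 h1.le)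
    simpa [sqrtSing, h] using this

lemma abs_log_sub_log_le {a b : ℝ} (ha : a ≠ 0) (hb : b ≠ 0) :
    |Real.log |a| - Real.log (|b|)| ≤ 2 * √|a - b| * ((√|a|)⁻¹ + (√|b|)⁻¹) := by
  have key : ∀ s t : ℝ, 0 < s → s ≤ t → |Real.log s - Real.log t| ≤ 2 * √(t - s) * (√s)⁻¹ := by
    intro s t hs hst
    have ht := hs.trans_le hst
    have hs' := Real.sqrt_pos.2 hs
    rw [abs_sub_comm, abs_of_nonneg (sub_nonneg.2 (Real.log_le_log hs hst)),
      ← Real.log_div ht.ne' hs.ne']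
    have h1 : Real.log (t / s) = 2 * Real.log (√t / √s) := by
      rw [← Real.sqrt_div ht.le, Real.log_sqrt (by positivity)]; ring
    have h2 := Real.log_le_sub_one_of_pos (show 0 < √t / √s by positivity)
    have h3 : √t ≤ √(t - s) + √s := by
      rw [Real.sqrt_le_left (by positivity)]
      nlinarith [Real.sq_sqrt (sub_nonneg.2 hst), Real.sq_sqrt hs.le,
        mul_nonneg (Real.sqrt_nonneg (t - s)) (Real.sqrt_nonneg s)]
    calc Real.log (t / s) ≤ 2 * (√t / √s - 1) := by linarith
      _ = 2 * ((√t - √s) * (√s)⁻¹) := by field_simp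
      _ ≤ 2 * (√(t - s) * (√s)⁻¹) := by gcongr; linarith
      _ = _ := by ring
  have hle : ∀ s t : ℝ, s ≤ t → t - s ≤ |t - s| := fun s t _ => le_abs_self _
  rcases le_total |a| |b| with h | h
  · refine (key _ _ (abs_pos.2 ha) h).trans ?_
    have : √(|b| - |a|) ≤ √|a - b| := Real.sqrt_le_sqrt (by
      rw [abs_sub_comm]; exact abs_sub_abs_le_abs_sub b a)
    calc _ ≤ 2 * √|a - b| * (√|a|)⁻¹ := by gcongr
      _ ≤ _ := by gcongr; simp
  · rw [abs_sub_comm]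
    refine (key _ _ (abs_pos.2 hb) h).trans ?_
    have : √(|a| - |b|) ≤ √|a - b| := Real.sqrt_le_sqrt (abs_sub_abs_le_abs_sub a b)
    calc _ ≤ 2 * √|a - b| * (√|b|)⁻¹ := by gcongr
      _ ≤ _ := by gcongr; simp

lemma log_one_add_abs_sub_le (x y : ℝ) :
    Real.log (1 + |x - y|) ≤ Real.log (1 + |x|) + Real.log (1 + |y|) := by
  simpa [sub_eq_add_neg] using log_one_add_abs_add_le x (-y)

lemma ae_sub_ne_zero (x : ℝ) : ∀ᵐ y : ℝ, x - y ≠ 0 := by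
  filter_upwards [Measure.ae_ne volume x] with y hy
  exact sub_ne_zero.2 hy.symm

lemma logPot_le {q : ℝ → ℝ} (h0 : ∀ x, 0 ≤ q x) (hi : Integrable q) (h1 : ∫ x, q x = 1)
    (hl : Integrable fun x => q x * Real.log (1 + |x|)) (x : ℝ) :
    logPot q x ≤ Real.log (1 + |x|) + ∫ y, q y * Real.log (1 + |y|) := by
  by_cases hx : Integrable fun y => q y * Real.log |x - y|
  · have : logPot q x ≤ ∫ y, (q y * Real.log (1 + |x|) + q y * Real.log (1 + |y|)) := by
      refine integral_mono hx ((hi.mul_const _).add hl) fun y => ?_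
      simp only
      rw [← mul_add]
      exact mul_le_mul_of_nonneg_left ((log_abs_le _).trans (log_one_add_abs_sub_le x y)) (h0 y)
    rwa [integral_add (hi.mul_const _) hl, integral_mul_const, h1, one_mul] at this
  · rw [logPot, integral_undef hx]
    exact add_nonneg (log_one_add_abs_nonneg x)
      (integral_nonneg fun y => mul_nonneg (h0 y) (log_one_add_abs_nonneg y))

/-- A bounded probability density with a logarithmic moment. -/
structure BoundedDensity (q : ℝ → ℝ) (M : ℝ) : Prop where
  nonneg : ∀ x, 0 ≤ q x
  le : ∀ x, q x ≤ M
  integrable : Integrable q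
  integral_eq_one : ∫ x, q x = 1
  logMoment : Integrable fun x => q x * Real.log (1 + |x|)

namespace BoundedDensity

variable {q : ℝ → ℝ} {M : ℝ}

lemma integrable_mul_log_one_add (h : BoundedDensity q M) (x : ℝ) :
    Integrable fun y => q y * Real.log (1 + |x - y|) := by
  refine Integrable.mono' ((h.integrable.mul_const (Real.log (1 + |x|))).add h.logMoment)
    (h.integrable.aestronglyMeasurable.mul
      (Measurable.aestronglyMeasurable (by fun_prop))) (ae_of_all _ fun y => ?_)
  rw [Real.norm_eq_abs, abs_of_nonneg (mul_nonneg (h.nonneg y) (log_one_add_abs_nonneg _)),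
    Pi.add_apply, ← mul_add]
  exact mul_le_mul_of_nonneg_left (log_one_add_abs_sub_le x y) (h.nonneg y)

lemma integrable_mul_log (h : BoundedDensity q M) (x : ℝ) :
    Integrable fun y => q y * Real.log |x - y| := by
  refine Integrable.mono' (((integrable_logSing.comp_sub_left x).norm.const_mul M).add
    (h.integrable_mul_log_one_add x)) (h.integrable.aestronglyMeasurable.mul
      (Measurable.aestronglyMeasurable (by fun_prop))) (ae_of_all _ fun y => ?_)
  rw [norm_mul, Real.norm_eq_abs, abs_of_nonneg (h.nonneg y), Pi.add_apply]
  calc q y * ‖Real.log |x - y|‖ ≤ q y * (|logSing (x - y)| + Real.log (1 + |x - y|)) :=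
        mul_le_mul_of_nonneg_left (abs_log_abs_le _) (h.nonneg y)
    _ ≤ _ := by
      rw [mul_add]
      exact add_le_add_left (mul_le_mul_of_nonneg_right (h.le y) (abs_nonneg _)) _

lemma integrable_mul_inv_sqrt (h : BoundedDensity q M) (x : ℝ) :
    (Integrable fun y => q y * (√|x - y|)⁻¹) ∧
      ∫ y, q y * (√|x - y|)⁻¹ ≤ M * (∫ z, sqrtSing z) + 1 := by
  have hb : ∀ y, q y * (√|x - y|)⁻¹ ≤ M * sqrtSing (x - y) + q y := fun y => by
    calc q y * (√|x - y|)⁻¹ ≤ q y * (sqrtSing (x - y) + 1) :=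
          mul_le_mul_of_nonneg_left (inv_sqrt_abs_le _) (h.nonneg y)
      _ = q y * sqrtSing (x - y) + q y := by ring
      _ ≤ _ := by
        gcongr
        · exact sqrtSing_nonneg _
        · exact h.le y
  have hi1 : Integrable fun y => M * sqrtSing (x - y) :=
    (integrable_sqrtSing.comp_sub_left x).const_mul M
  have hi : Integrable fun y => q y * (√|x - y|)⁻¹ := by
    refine Integrable.mono' (hi1.add h.integrable) (h.integrable.aestronglyMeasurable.mul
      (Measurable.aestronglyMeasurable (by fun_prop))) (ae_of_all _ fun y => ?_)
    rw [Real.norm_eq_abs, abs_of_nonneg (mul_nonneg (h.nonneg y) (by positivity))]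
    exact hb y
  refine ⟨hi, (integral_mono hi (hi1.add h.integrable) hb).trans ?_⟩
  simp only [Pi.add_apply]
  rw [integral_add hi1 h.integrable, integral_const_mul, h.integral_eq_one,
    integral_sub_left_eq_self sqrtSing volume x]

/-- The logarithmic potential of a bounded density is Hölder continuous. -/
lemma abs_logPot_sub_le (h : BoundedDensity q M) (x x' : ℝ) :
    |logPot q x - logPot q x'| ≤ 4 * (M * (∫ z, sqrtSing z) + 1) * √|x - x'| := by
  rw [logPot, logPot, ← integral_sub (h.integrable_mul_log x) (h.integrable_mul_log x')]
  obtain ⟨i1, b1⟩ := h.integrable_mul_inv_sqrt x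
  obtain ⟨i2, b2⟩ := h.integrable_mul_inv_sqrt x'
  have hi := (i1.fun_add i2).const_mul (2 * √|x - x'|)
  have : ‖∫ y, q y * Real.log |x - y| - q y * Real.log |x' - y|‖ ≤
      ∫ y, 2 * √|x - x'| * (q y * (√|x - y|)⁻¹ + q y * (√|x' - y|)⁻¹) := by
    refine norm_integral_le_of_norm_le hi ?_
    filter_upwards [ae_sub_ne_zero x, ae_sub_ne_zero x'] with y h1 h2
    rw [← mul_sub, norm_mul, Real.norm_eq_abs, Real.norm_eq_abs, abs_of_nonneg (h.nonneg y)]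
    have := abs_log_sub_log_le h1 h2
    rw [sub_sub_sub_cancel_right] at this
    calc _ ≤ q y * _ := mul_le_mul_of_nonneg_left this (h.nonneg y)
      _ = _ := by ring
  rw [integral_const_mul, integral_add i1 i2, Real.norm_eq_abs] at this
  refine this.trans ?_
  nlinarith [Real.sqrt_nonneg |x - x'|]

/-- The regularized potential `½ ∫ log((x - y)² + ε²) q(y) dy`. -/
def regPot (q : ℝ → ℝ) (ε x : ℝ) : ℝ := ∫ y, q y * (Real.log ((x - y) ^ 2 + ε ^ 2) / 2)

/-- The derivative of the regularized potential. -/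
def regHilbert (q : ℝ → ℝ) (ε x : ℝ) : ℝ := ∫ y, q y * ((x - y) / ((x - y) ^ 2 + ε ^ 2))

/-- The Hilbert transform, as the absolutely convergent integral
`½ ∫ (q(x - s) - q(x + s)) / s ds`. -/
def hilbert (q : ℝ → ℝ) (x : ℝ) : ℝ := ∫ s, (q (x - s) - q (x + s)) / 2 * s⁻¹

lemma abs_log_reg_le {a ε : ℝ} (ha : a ≠ 0) (hε1 : ε ^ 2 ≤ 1) :
    |Real.log (a ^ 2 + ε ^ 2) / 2| ≤ |Real.log (|a|)| + Real.log (1 + |a|) := by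
  have ha2 : 0 < a ^ 2 := by positivity
  have h1 : Real.log |a| ≤ Real.log (a ^ 2 + ε ^ 2) / 2 := by
    have := Real.log_le_log ha2 (show a ^ 2 ≤ a ^ 2 + ε ^ 2 by nlinarith)
    rw [← sq_abs a, Real.log_pow] at this
    push_cast at this
    rw [sq_abs] at this
    linarith
  have h2 : Real.log (a ^ 2 + ε ^ 2) / 2 ≤ Real.log (1 + |a|) := by
    have := Real.log_le_log (show 0 < a ^ 2 + ε ^ 2 by positivity)
      (show a ^ 2 + ε ^ 2 ≤ (1 + |a|) ^ 2 by nlinarith [sq_abs a, abs_nonneg a])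
    rw [Real.log_pow] at this
    push_cast at this
    linarith
  rw [abs_le]
  constructor
  · linarith [neg_abs_le (Real.log |a|), log_one_add_abs_nonneg a]
  · linarith [abs_nonneg (Real.log |a|)]

lemma integrable_reg_bound (h : BoundedDensity q M) (x : ℝ) :
    Integrable fun y => q y * (|Real.log (|x - y|)| + Real.log (1 + |x - y|)) := by
  refine ((h.integrable_mul_log x).norm.add (h.integrable_mul_log_one_add x)).congr
    (ae_of_all _ fun y => ?_)
  simp only [Pi.add_apply, norm_mul, Real.norm_eq_abs, abs_of_nonneg (h.nonneg y)]
  ring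

lemma norm_reg_le (h : BoundedDensity q M) {ε : ℝ} (hε1 : ε ^ 2 ≤ 1) (x : ℝ) :
    ∀ᵐ y, ‖q y * (Real.log ((x - y) ^ 2 + ε ^ 2) / 2)‖ ≤
      q y * (|Real.log (|x - y|)| + Real.log (1 + |x - y|)) := by
  filter_upwards [ae_sub_ne_zero x] with y hy
  rw [norm_mul, Real.norm_eq_abs, Real.norm_eq_abs, abs_of_nonneg (h.nonneg y)]
  exact mul_le_mul_of_nonneg_left (abs_log_reg_le hy hε1) (h.nonneg y)

lemma aestronglyMeasurable_reg (h : BoundedDensity q M) (ε x : ℝ) :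
    AEStronglyMeasurable (fun y => q y * (Real.log ((x - y) ^ 2 + ε ^ 2) / 2)) :=
  h.integrable.aestronglyMeasurable.mul (Measurable.aestronglyMeasurable (by fun_prop))

lemma tendsto_regPot (h : BoundedDensity q M) {ε : ℕ → ℝ} (hε : Tendsto ε atTop (𝓝 0))
    (hε1 : ∀ n, ε n ^ 2 ≤ 1) (x : ℝ) :
    Tendsto (fun n => regPot q (ε n) x) atTop (𝓝 (logPot q x)) := by
  refine tendsto_integral_of_dominated_convergence _
    (fun n => h.aestronglyMeasurable_reg (ε n) x) (h.integrable_reg_bound x)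
    (fun n => h.norm_reg_le (hε1 n) x) ?_
  filter_upwards [ae_sub_ne_zero x] with y hy
  refine Tendsto.const_mul _ ?_
  have h1 : Tendsto (fun n => (x - y) ^ 2 + ε n ^ 2) atTop (𝓝 ((x - y) ^ 2)) := by
    simpa using (hε.pow 2).const_add ((x - y) ^ 2)
  have h2 := ((Real.continuousAt_log (by positivity : (x - y) ^ 2 ≠ 0)).tendsto.comp h1).div_const 2
  have h3 : Real.log ((x - y) ^ 2) / 2 = Real.log |x - y| := by
    rw [Real.log_pow, Real.log_abs]; push_cast; ring
  rwa [h3] at h2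

lemma abs_cauchy_kernel_le {ε : ℝ} (hε : 0 < ε) (a : ℝ) : |a / (a ^ 2 + ε ^ 2)| ≤ (2 * ε)⁻¹ := by
  rw [abs_div, abs_of_pos (show 0 < a ^ 2 + ε ^ 2 by positivity), div_le_iff₀ (by positivity),
    inv_mul_eq_div, le_div_iff₀ (by positivity)]
  nlinarith [sq_nonneg (|a| - ε), sq_abs a]

lemma hasDerivAt_regPot (h : BoundedDensity q M) {ε : ℝ} (hε : 0 < ε) (hε1 : ε ^ 2 ≤ 1) (x : ℝ) :
    HasDerivAt (regPot q ε) (regHilbert q ε x) x := by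
  refine (hasDerivAt_integral_of_dominated_loc_of_deriv_le (s := Set.univ)
    (F' := fun x y => q y * ((x - y) / ((x - y) ^ 2 + ε ^ 2)))
    (bound := fun y => q y * (2 * ε)⁻¹) univ_mem
    (Eventually.of_forall fun x => h.aestronglyMeasurable_reg ε x)
    ((h.integrable_reg_bound x).mono' (h.aestronglyMeasurable_reg ε x) (h.norm_reg_le hε1 x))
    (h.integrable.aestronglyMeasurable.mul (Measurable.aestronglyMeasurable (by fun_prop)))
    (ae_of_all _ fun y x _ => ?_) (h.integrable.mul_const _) (ae_of_all _ fun y x _ => ?_)).2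
  · rw [norm_mul, Real.norm_eq_abs, abs_of_nonneg (h.nonneg y)]
    exact mul_le_mul_of_nonneg_left (abs_cauchy_kernel_le hε _) (h.nonneg y)
  · refine HasDerivAt.const_mul _ ?_
    have h1 : HasDerivAt (fun x : ℝ => (x - y) ^ 2 + ε ^ 2) (2 * (x - y)) x := by
      simpa using (((hasDerivAt_id x).sub_const y).pow 2).add_const (ε ^ 2)
    convert! (h1.log (by positivity)).div_const 2 using 1
    field_simp

lemma continuous_regHilbert (h : BoundedDensity q M) {ε : ℝ} (hε : 0 < ε) :
    Continuous (regHilbert q ε) := by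
  refine continuous_of_dominated (bound := fun y => q y * (2 * ε)⁻¹)
    (fun x => h.integrable.aestronglyMeasurable.mul
      (Measurable.aestronglyMeasurable (by fun_prop)))
    (fun x => ae_of_all _ fun y => ?_) (h.integrable.mul_const _) (ae_of_all _ fun y => ?_)
  · rw [norm_mul, Real.norm_eq_abs, abs_of_nonneg (h.nonneg y)]
    exact mul_le_mul_of_nonneg_left (abs_cauchy_kernel_le hε _) (h.nonneg y)
  · exact continuous_const.mul (Continuous.div (by fun_prop) (by fun_prop)
      fun x => by positivity)

lemma regHilbert_eq (h : BoundedDensity q M) {ε : ℝ} (hε : 0 < ε) (x : ℝ) :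
    regHilbert q ε x = ∫ s, (q (x - s) - q (x + s)) / 2 * (s / (s ^ 2 + ε ^ 2)) := by
  have hk : AEStronglyMeasurable (fun s : ℝ => s / (s ^ 2 + ε ^ 2)) :=
    Measurable.aestronglyMeasurable (by fun_prop)
  have i1 : Integrable fun s => q (x - s) * (s / (s ^ 2 + ε ^ 2)) := by
    simpa only [mul_comm] using (h.integrable.comp_sub_left x).bdd_mul hk
      (ae_of_all _ fun s => abs_cauchy_kernel_le hε s)
  have i2 : Integrable fun s => q (x + s) * (s / (s ^ 2 + ε ^ 2)) := by
    simpa only [mul_comm] using (h.integrable.comp_add_left x).bdd_mul hk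
      (ae_of_all _ fun s => abs_cauchy_kernel_le hε s)
  have e1 : regHilbert q ε x = ∫ s, q (x - s) * (s / (s ^ 2 + ε ^ 2)) := by
    rw [regHilbert, ← integral_sub_left_eq_self _ volume x]
    simp
  have e2 : ∫ s, q (x + s) * (s / (s ^ 2 + ε ^ 2)) = -∫ s, q (x - s) * (s / (s ^ 2 + ε ^ 2)) := by
    rw [← integral_neg_eq_self, ← integral_neg]
    congr 1
    ext s
    simp only [neg_sq, neg_div, mul_neg]
    rfl
  have e3 : ∀ s, (q (x - s) - q (x + s)) / 2 * (s / (s ^ 2 + ε ^ 2)) =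
      1 / 2 * (q (x - s) * (s / (s ^ 2 + ε ^ 2))) - 1 / 2 * (q (x + s) * (s / (s ^ 2 + ε ^ 2))) :=
    fun s => by ring
  simp only [e3]
  rw [integral_sub (i1.const_mul _) (i2.const_mul _), integral_const_mul, integral_const_mul, e1, e2]
  ring

/-- The uniform local Hölder condition under which the Hilbert transform converges absolutely. -/
def LocallyHolder (q : ℝ → ℝ) (C : ℝ) : Prop :=
  ∀ x y, |x - y| ≤ 2 → |q x - q y| ≤ C * √|x - y|

lemma abs_hilbert_kernel_le (h : BoundedDensity q M) {C : ℝ} (hC0 : 0 ≤ C)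
    (hC : LocallyHolder q C) (x s : ℝ) {θ η : ℝ} (hθ : 0 ≤ θ) (hη : 0 ≤ η)
    (hθη : 1 < |s| → θ ≤ η) :
    |(q (x - s) - q (x + s)) / 2| * |s|⁻¹ * θ ≤
      C * (sqrtSing s * θ) + η * ((q (x - s) + q (x + s)) / 2) := by
  have hq1 := h.nonneg (x - s)
  have hq2 := h.nonneg (x + s)
  rcases eq_or_ne s 0 with rfl | hs
  · simp only [abs_zero, inv_zero, mul_zero, zero_mul]
    have := sqrtSing_nonneg 0
    positivity
  have hs' : 0 < |s| := abs_pos.2 hs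
  by_cases h1 : |s| ≤ 1
  · have e : sqrtSing s = (√|s|)⁻¹ := by
      simp [sqrtSing, abs_le.1 h1]
    have h2 := hC (x - s) (x + s) (by
      rw [show x - s - (x + s) = -(2 * s) by ring, abs_neg, abs_mul, abs_two]; linarith)
    rw [show x - s - (x + s) = -(2 * s) by ring, abs_neg, abs_mul, abs_two] at h2
    have h3 : √(2 * |s|) ≤ 2 * √|s| := by
      rw [Real.sqrt_le_left (by positivity), mul_pow, Real.sq_sqrt hs'.le]
      linarith
    have h4 : |(q (x - s) - q (x + s)) / 2| ≤ C * √|s| := by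
      rw [abs_div, abs_two, div_le_iff₀ (by norm_num)]
      nlinarith
    have h5 : √|s| * |s|⁻¹ = (√|s|)⁻¹ := by
      have := Real.sqrt_pos.2 hs'
      field_simp
      exact (Real.sq_sqrt hs'.le)
    calc |(q (x - s) - q (x + s)) / 2| * |s|⁻¹ * θ ≤ C * √|s| * |s|⁻¹ * θ := by gcongr
      _ = C * (sqrtSing s * θ) := by rw [e, ← h5]; ring
      _ ≤ _ := by linarith [show 0 ≤ η * ((q (x - s) + q (x + s)) / 2) by positivity]
  · push Not at h1
    have h2 : |s|⁻¹ ≤ 1 := inv_le_one_of_one_le₀ h1.le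
    have h3 : |(q (x - s) - q (x + s)) / 2| ≤ (q (x - s) + q (x + s)) / 2 := by
      rw [abs_le]; constructor <;> linarith
    calc |(q (x - s) - q (x + s)) / 2| * |s|⁻¹ * θ ≤ (q (x - s) + q (x + s)) / 2 * 1 * η := by
          gcongr
          exact hθη h1
      _ = η * ((q (x - s) + q (x + s)) / 2) := by ring
      _ ≤ _ := by
        linarith [mul_nonneg hC0 (mul_nonneg (sqrtSing_nonneg s) hθ)]

lemma integrable_average (h : BoundedDensity q M) (x : ℝ) :
    (Integrable fun s => (q (x - s) + q (x + s)) / 2) ∧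
      ∫ s, (q (x - s) + q (x + s)) / 2 = 1 := by
  have i1 := h.integrable.comp_sub_left x
  have i2 := h.integrable.comp_add_left x
  refine ⟨(i1.add i2).div_const 2, ?_⟩
  rw [integral_div, integral_add i1 i2, integral_sub_left_eq_self q volume x,
    integral_add_left_eq_self q x, h.integral_eq_one]
  norm_num

lemma integrable_hilbert_kernel (h : BoundedDensity q M) {C : ℝ} (hC0 : 0 ≤ C)
    (hC : LocallyHolder q C) (x : ℝ) :
    (Integrable fun s => (q (x - s) - q (x + s)) / 2 * s⁻¹) ∧
      |hilbert q x| ≤ C * (∫ z, sqrtSing z) + 1 := by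
  obtain ⟨i1, e1⟩ := h.integrable_average x
  have i2 := integrable_sqrtSing.const_mul C
  have hb : ∀ s, ‖(q (x - s) - q (x + s)) / 2 * s⁻¹‖ ≤
      C * sqrtSing s + (q (x - s) + q (x + s)) / 2 := fun s => by
    have := h.abs_hilbert_kernel_le hC0 hC x s zero_le_one zero_le_one fun _ => le_rfl
    rw [norm_mul, norm_inv, Real.norm_eq_abs, Real.norm_eq_abs]
    linarith
  refine ⟨(i2.add i1).mono' ?_ (ae_of_all _ hb), ?_⟩
  · exact ((((h.integrable.comp_sub_left x).sub (h.integrable.comp_add_left x)).div_const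
      2).aestronglyMeasurable).mul (Measurable.aestronglyMeasurable (by fun_prop))
  · have := norm_integral_le_of_norm_le (i2.add i1) (ae_of_all _ hb)
    simp only [Pi.add_apply] at this
    rwa [integral_add i2 i1, e1, integral_const_mul] at this

/-- The error made by regularizing the Hilbert transform. -/
def regError (ε : ℝ) : ℝ := ∫ s, sqrtSing s * (ε ^ 2 / (s ^ 2 + ε ^ 2))

lemma reg_factor_le (s ε : ℝ) : ε ^ 2 / (s ^ 2 + ε ^ 2) ≤ 1 :=
  div_le_one_of_le₀ (by nlinarith [sq_nonneg s]) (by positivity)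

lemma integrable_regError (ε : ℝ) :
    Integrable fun s => sqrtSing s * (ε ^ 2 / (s ^ 2 + ε ^ 2)) :=
  integrable_sqrtSing.mono' (integrable_sqrtSing.aestronglyMeasurable.mul
    (Measurable.aestronglyMeasurable (by fun_prop))) (ae_of_all _ fun s => by
      have := sqrtSing_nonneg s
      rw [Real.norm_eq_abs, abs_of_nonneg (by positivity)]
      exact mul_le_of_le_one_right this (reg_factor_le s ε))

lemma tendsto_regError {ε : ℕ → ℝ} (hε : Tendsto ε atTop (𝓝 0)) :
    Tendsto (fun n => regError (ε n)) atTop (𝓝 0) := by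
  have : Tendsto (fun n => regError (ε n)) atTop (𝓝 (∫ _ : ℝ, (0 : ℝ))) := by
    refine tendsto_integral_of_dominated_convergence sqrtSing
      (fun n => (integrable_regError (ε n)).aestronglyMeasurable) integrable_sqrtSing
      (fun n => ae_of_all _ fun s => ?_) ?_
    · have := sqrtSing_nonneg s
      rw [Real.norm_eq_abs, abs_of_nonneg (by positivity)]
      exact mul_le_of_le_one_right this (reg_factor_le s (ε n))
    · filter_upwards [Measure.ae_ne volume (0 : ℝ)] with s hs
      have h1 : Tendsto (fun n => ε n ^ 2 / (s ^ 2 + ε n ^ 2)) atTop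
          (𝓝 (0 ^ 2 / (s ^ 2 + 0 ^ 2))) :=
        (hε.pow 2).div ((hε.pow 2).const_add _) (by positivity)
      simpa using h1.const_mul (sqrtSing s)
  simpa using this

lemma abs_regHilbert_sub_hilbert_le (h : BoundedDensity q M) {C : ℝ} (hC0 : 0 ≤ C)
    (hC : LocallyHolder q C) {ε : ℝ} (hε : 0 < ε) (x : ℝ) :
    |regHilbert q ε x - hilbert q x| ≤ C * regError ε + ε ^ 2 := by
  obtain ⟨i1, e1⟩ := h.integrable_average x
  obtain ⟨i2, -⟩ := h.integrable_hilbert_kernel hC0 hC x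
  have i3 : Integrable fun s => (q (x - s) - q (x + s)) / 2 * (s / (s ^ 2 + ε ^ 2)) := by
    refine ((((h.integrable.comp_sub_left x).sub (h.integrable.comp_add_left x)).div_const
      2).bdd_mul (Measurable.aestronglyMeasurable (f := fun s : ℝ => s / (s ^ 2 + ε ^ 2))
        (by fun_prop)) (ae_of_all _ fun s => abs_cauchy_kernel_le hε s)).congr
        (ae_of_all _ fun s => ?_)
    simp only [Pi.sub_apply]
    ring
  have i4 := (integrable_regError ε).const_mul C
  have i5 := i1.const_mul (ε ^ 2)
  rw [h.regHilbert_eq hε, hilbert, ← integral_sub i3 i2]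
  have := norm_integral_le_of_norm_le (i4.fun_add i5)
    (f := fun s => (q (x - s) - q (x + s)) / 2 * (s / (s ^ 2 + ε ^ 2)) -
      (q (x - s) - q (x + s)) / 2 * s⁻¹) (ae_of_all _ fun s => ?_)
  · rwa [integral_add i4 i5, integral_const_mul, integral_const_mul, e1, mul_one] at this
  · have hk : |s / (s ^ 2 + ε ^ 2) - s⁻¹| = |s|⁻¹ * (ε ^ 2 / (s ^ 2 + ε ^ 2)) := by
      rcases eq_or_ne s 0 with rfl | hs
      · simp
      · have : s / (s ^ 2 + ε ^ 2) - s⁻¹ = -(s⁻¹ * (ε ^ 2 / (s ^ 2 + ε ^ 2))) := by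
          field_simp
          ring
        rw [this, abs_neg, abs_mul, abs_inv,
          abs_of_nonneg (show 0 ≤ ε ^ 2 / (s ^ 2 + ε ^ 2) by positivity)]
    rw [← mul_sub, norm_mul, Real.norm_eq_abs, Real.norm_eq_abs, hk, ← mul_assoc]
    refine h.abs_hilbert_kernel_le hC0 hC x s (by positivity) (by positivity) fun hs => ?_
    refine div_le_self (by positivity) ?_
    nlinarith [sq_abs s, sq_nonneg ε]

/-- The logarithmic potential of a locally Hölder continuous density is continuously
differentiable, and its derivative is the Hilbert transform. -/
lemma hasDerivAt_logPot (h : BoundedDensity q M) {C : ℝ} (hC0 : 0 ≤ C)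
    (hC : LocallyHolder q C) :
    Continuous (hilbert q) ∧ ∀ x, HasDerivAt (logPot q) (hilbert q x) x := by
  set ε : ℕ → ℝ := fun n => 1 / ((n : ℝ) + 1) with hεdef
  have hε : Tendsto ε atTop (𝓝 0) := tendsto_one_div_add_atTop_nhds_zero_nat
  have hε0 : ∀ n, 0 < ε n := fun n => by positivity
  have hε1 : ∀ n, ε n ^ 2 ≤ 1 := fun n => by
    have : ε n ≤ 1 := div_le_one_of_le₀ (by linarith [n.cast_nonneg (α := ℝ)]) (by positivity)
    nlinarith [hε0 n]
  have hunif : TendstoUniformly (fun n => regHilbert q (ε n)) (hilbert q) atTop := by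
    rw [Metric.tendstoUniformly_iff]
    intro δ hδ
    have h1 : Tendsto (fun n => C * regError (ε n) + ε n ^ 2) atTop (𝓝 0) := by
      simpa using ((tendsto_regError hε).const_mul C).add (hε.pow 2)
    filter_upwards [h1.eventually_lt_const hδ] with n hn x
    rw [dist_comm, Real.dist_eq]
    exact (h.abs_regHilbert_sub_hilbert_le hC0 hC (hε0 n) x).trans_lt hn
  refine ⟨hunif.continuous (Frequently.of_forall fun n => h.continuous_regHilbert (hε0 n)), ?_⟩
  exact hasDerivAt_of_tendstoUniformly hunif
    (Eventually.of_forall fun n x => h.hasDerivAt_regPot (hε0 n) (hε1 n) x)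
    fun x => h.tendsto_regPot hε hε1 x

end BoundedDensity

/-! ### Regularity of the equilibrium density -/

/-- `μ` has a positive continuously differentiable density `r` with `r' = r (h - V')`, where `h`
is continuous and bounded. -/
structure RegularDensity (V r h : ℝ → ℝ) (μ : Measure ℝ) : Prop where
  pos : ∀ x, 0 < r x
  hasDerivAt : ∀ x, HasDerivAt r (r x * (h x - deriv V x)) x
  continuous_h : Continuous h
  bounded_h : ∃ B, ∀ x, |h x| ≤ B
  measure_eq : μ = volume.withDensity fun x => ENNReal.ofReal (r x)
  integrable : Integrable fun x => (1 + deriv V x ^ 2) * r x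

lemma exists_bound_of_isLittleO {f : ℝ → ℝ} (hf : Continuous f) {α : ℝ} (hα : 0 < α)
    (h : f =o[cocompact ℝ] fun x => |x| ^ (-α)) :
    ∃ C, 0 ≤ C ∧ ∀ x, |f x| * (1 + |x|) ^ α ≤ C := by
  have h1 : ∀ᶠ x in cocompact ℝ, |f x| * (1 + |x|) ^ α ≤ 2 ^ α := by
    have h2 : ∀ᶠ x : ℝ in cocompact ℝ, 1 ≤ |x| :=
      tendsto_norm_cocompact_atTop.eventually_ge_atTop 1
    filter_upwards [h.bound one_pos, h2] with x hx hx1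
    rw [one_mul, Real.norm_eq_abs, Real.norm_eq_abs,
      abs_of_nonneg (by positivity : 0 ≤ |x| ^ (-α))] at hx
    calc |f x| * (1 + |x|) ^ α ≤ |x| ^ (-α) * (2 * |x|) ^ α := by
          gcongr
          linarith
      _ = 2 ^ α := by
          rw [Real.mul_rpow (by norm_num) (by positivity), Real.rpow_neg (by positivity)]
          have : 0 < |x| ^ α := by positivity
          field_simp
  rw [Filter.Eventually, mem_cocompact] at h1
  obtain ⟨K, hK, hKs⟩ := h1
  have hc : Continuous fun x => |f x| * (1 + |x|) ^ α :=
    hf.abs.mul (Continuous.rpow_const (by fun_prop) fun x => Or.inr hα.le)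
  obtain ⟨C, hC⟩ := hK.exists_bound_of_continuousOn hc.continuousOn
  refine ⟨max C (2 ^ α), le_max_of_le_right (by positivity), fun x => ?_⟩
  by_cases hx : x ∈ K
  · exact (le_abs_self _).trans ((hC x hx).trans (le_max_left _ _))
  · exact le_trans (hKs hx) (le_max_right _ _)

lemma abs_exp_sub_exp_le {a b c : ℝ} (ha : Real.exp a ≤ c) (hb : Real.exp b ≤ c) :
    |Real.exp a - Real.exp b| ≤ c * |a - b| := by
  have key : ∀ s t : ℝ, Real.exp t ≤ c → s ≤ t → |Real.exp t - Real.exp s| ≤ c * |t - s| := by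
    intro s t ht hst
    rw [abs_of_nonneg (sub_nonneg.2 (Real.exp_le_exp.2 hst)), abs_of_nonneg (sub_nonneg.2 hst)]
    have h1 : Real.exp s = Real.exp t * Real.exp (s - t) := by rw [← Real.exp_add]; ring_nf
    have h2 := Real.add_one_le_exp (s - t)
    have h3 := Real.exp_pos t
    nlinarith
  rcases le_total a b with h | h
  · rw [abs_sub_comm, abs_sub_comm a]; exact key a b hb h
  · exact key b a ha h

lemma one_add_abs_rpow_le {p : ℝ} (hp : 0 ≤ p) {x y : ℝ} (h : |x - y| ≤ 2) :
    (1 + |y|) ^ p ≤ 3 ^ p * (1 + |x|) ^ p := by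
  rw [← Real.mul_rpow (by norm_num) (by positivity)]
  refine Real.rpow_le_rpow (by positivity) ?_ hp
  have := abs_sub_abs_le_abs_sub y x
  rw [abs_sub_comm] at this
  linarith [abs_nonneg x]

section

variable {V : ℝ → ℝ} {P : ℝ} {μ : Measure ℝ}

lemma AdmissiblePotential.continuous_deriv (hV : AdmissiblePotential V μ) :
    Continuous (deriv V) := hV.contDiff.continuous_deriv (by norm_num)

lemma AdmissiblePotential.differentiable (hV : AdmissiblePotential V μ) :
    Differentiable ℝ V := hV.contDiff.differentiable (by norm_num)

lemma AdmissiblePotential.exists_bound (hV : AdmissiblePotential V μ) (Q : Polynomial ℝ)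
    {p : ℝ} (hp : 0 ≤ p) : ∃ C, 0 ≤ C ∧ ∀ x,
      |Q.eval (deriv V x)| * (Real.exp (-V x) * (1 + |x|) ^ p) ≤ C * (1 + |x|) ^ (-2 : ℝ) := by
  obtain ⟨C, hC0, hC⟩ := exists_bound_of_isLittleO
    ((Q.continuous.comp hV.continuous_deriv).mul
      (Real.continuous_exp.comp hV.contDiff.continuous.neg)) (by linarith : 0 < p + 2)
    (hV.polynomial_decay Q (p + 2) (by linarith))
  refine ⟨C, hC0, fun x => ?_⟩
  have h1 := hC x
  simp only [Pi.mul_apply, Function.comp_apply, Pi.neg_apply] at h1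
  have hx : 0 < 1 + |x| := by positivity
  rw [abs_mul, abs_of_pos (Real.exp_pos _), Real.rpow_add hx] at h1
  rw [Real.rpow_neg hx.le, ← div_eq_mul_inv, le_div_iff₀ (by positivity)]
  linarith

lemma exists_locallyHolder (hP : 0 < P) (hV : AdmissiblePotential V μ) {U : ℝ → ℝ} {m κ K : ℝ}
    (hK : 0 ≤ K)
    (hU : ∀ x, U x ≤ Real.log (1 + |x|) + m) (hU' : ∀ x y, |U x - U y| ≤ K * √|x - y|) :
    ∃ C, 0 ≤ C ∧ BoundedDensity.LocallyHolder (fun x => Real.exp (-V x + 2 * P * U x + κ)) C := by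
  set A := Real.exp (2 * P * m + κ) with hA
  set w : ℝ → ℝ := fun x => (1 + |x|) ^ (2 * P) with hw
  set T : ℝ := 3 ^ (2 * P) with hT
  have hT1 : 1 ≤ T := Real.one_le_rpow (by norm_num) (by positivity)
  have hw0 : ∀ x, 0 < w x := fun x => by positivity
  have hG : ∀ x, Real.exp (2 * P * U x + κ) ≤ A * w x := fun x => by
    have : w x = Real.exp (Real.log (1 + |x|) * (2 * P)) := Real.rpow_def_of_pos (by positivity) _
    rw [this, hA, ← Real.exp_add]
    exact Real.exp_le_exp.2 (by nlinarith [hU x])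
  have hle1 : ∀ x : ℝ, (1 + |x|) ^ (-2 : ℝ) ≤ 1 := fun x =>
    Real.rpow_le_one_of_one_le_of_nonpos (by linarith [abs_nonneg x]) (by norm_num)
  obtain ⟨C0, hC0, hC0'⟩ := hV.exists_bound 1 (by positivity : 0 ≤ 2 * P)
  obtain ⟨C1, hC1, hC1'⟩ := hV.exists_bound Polynomial.X (by positivity : 0 ≤ 2 * P)
  have b0 : ∀ x, Real.exp (-V x) * w x ≤ C0 := fun x => by
    have := hC0' x
    simp only [Polynomial.eval_one, abs_one, one_mul] at this
    exact this.trans (mul_le_of_le_one_right hC0 (hle1 x))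
  have b1 : ∀ x, |deriv V x| * (Real.exp (-V x) * w x) ≤ C1 := fun x => by
    have := hC1' x
    simp only [Polynomial.eval_X] at this
    exact this.trans (mul_le_of_le_one_right hC1 (hle1 x))
  refine ⟨A * T * (2 * P) * K * C0 + A * (T * C1 * 2), by positivity, fun x y hxy => ?_⟩
  set s := √|x - y| with hs
  have hs0 : 0 ≤ s := Real.sqrt_nonneg _
  have hss : |x - y| ≤ 2 * s := by
    have h1 : |x - y| = s * s := (Real.mul_self_sqrt (abs_nonneg _)).symm
    have h2 : s ≤ 2 := by
      rw [hs, Real.sqrt_le_left (by norm_num)]; linarith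
    nlinarith
  have hwx : w y ≤ T * w x := one_add_abs_rpow_le (by positivity) hxy
  have t1 : |Real.exp (2 * P * U x + κ) - Real.exp (2 * P * U y + κ)| ≤
      A * (T * w x) * (2 * P * (K * s)) := by
    have hAw : A * w x ≤ A * (T * w x) := by
      have := hw0 x
      gcongr
      nlinarith
    refine (abs_exp_sub_exp_le ((hG x).trans hAw) ((hG y).trans (by gcongr))).trans ?_
    have : |2 * P * U x + κ - (2 * P * U y + κ)| ≤ 2 * P * (K * s) := by
      rw [show 2 * P * U x + κ - (2 * P * U y + κ) = 2 * P * (U x - U y) by ring, abs_mul,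
        abs_of_pos (by positivity : 0 < 2 * P)]
      gcongr
      exact hU' x y
    have := hw0 x
    gcongr
  have t2 : w y * |Real.exp (-V x) - Real.exp (-V y)| ≤ T * C1 * (2 * s) := by
    have hder : ∀ z ∈ Metric.closedBall y 2, HasDerivWithinAt (fun z => w y * Real.exp (-V z))
        (w y * (Real.exp (-V z) * (-deriv V z))) (Metric.closedBall y 2) z := fun z _ =>
      (((hV.differentiable z).hasDerivAt.neg.exp).const_mul (w y)).hasDerivWithinAt
    have := (convex_closedBall y 2).norm_image_sub_le_of_norm_hasDerivWithin_le (C := T * C1) hder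
      (fun z hz => by
        have hzy : w y ≤ T * w z := one_add_abs_rpow_le (by positivity) hz
        rw [norm_mul, norm_mul, norm_neg, Real.norm_eq_abs, Real.norm_eq_abs, Real.norm_eq_abs,
          abs_of_pos (hw0 y), abs_of_pos (Real.exp_pos _)]
        calc w y * (Real.exp (-V z) * |deriv V z|) ≤
              T * w z * (Real.exp (-V z) * |deriv V z|) := by gcongr
          _ = T * (|deriv V z| * (Real.exp (-V z) * w z)) := by ring
          _ ≤ T * C1 := by gcongr; exact b1 z)
      (Metric.mem_closedBall_self (by norm_num)) (show x ∈ Metric.closedBall y 2 from hxy)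
    rw [← mul_sub, norm_mul, Real.norm_eq_abs, Real.norm_eq_abs, Real.norm_eq_abs,
      abs_of_pos (hw0 y)] at this
    exact this.trans (by gcongr)
  have e : ∀ z, Real.exp (-V z + 2 * P * U z + κ) =
      Real.exp (-V z) * Real.exp (2 * P * U z + κ) := fun z => by
    rw [← Real.exp_add]; ring_nf
  simp only [e]
  calc |Real.exp (-V x) * Real.exp (2 * P * U x + κ) - Real.exp (-V y) * Real.exp (2 * P * U y + κ)|
      = |Real.exp (-V x) * (Real.exp (2 * P * U x + κ) - Real.exp (2 * P * U y + κ)) +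
          Real.exp (2 * P * U y + κ) * (Real.exp (-V x) - Real.exp (-V y))| := by ring_nf
    _ ≤ Real.exp (-V x) * |Real.exp (2 * P * U x + κ) - Real.exp (2 * P * U y + κ)| +
          Real.exp (2 * P * U y + κ) * |Real.exp (-V x) - Real.exp (-V y)| := by
        refine (abs_add_le _ _).trans ?_
        rw [abs_mul, abs_mul, abs_of_pos (Real.exp_pos _), abs_of_pos (Real.exp_pos _)]
    _ ≤ Real.exp (-V x) * (A * (T * w x) * (2 * P * (K * s))) +
          A * w y * |Real.exp (-V x) - Real.exp (-V y)| := by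
        gcongr
        exact hG y
    _ = A * T * (2 * P) * K * s * (Real.exp (-V x) * w x) +
          A * (w y * |Real.exp (-V x) - Real.exp (-V y)|) := by ring
    _ ≤ A * T * (2 * P) * K * s * C0 + A * (T * C1 * (2 * s)) := by
        gcongr
        exact b0 x
    _ = _ := by ring

/-- The equilibrium measure has a positive continuously differentiable density. -/
lemma IsEquilibriumMeasure.exists_regularDensity [IsProbabilityMeasure μ] (hP : 0 < P)
    (hμ : IsEquilibriumMeasure V P μ) (hV : AdmissiblePotential V μ) :
    ∃ r h, RegularDensity V r h μ := by
  obtain ⟨hac, hfe, κ, hae⟩ := hμ.euler_lagrange hV.contDiff.continuous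
  have hmom := integrable_mul_log_one_add_abs hfe.integrable hfe.nonneg hfe.integral_eq_one hfe.log
  set m := ∫ y, density μ y * Real.log (1 + |y|) with hm
  have hU := logPot_le hfe.nonneg hfe.integrable hfe.integral_eq_one hmom
  set U := logPot (density μ) with hUdef
  set r : ℝ → ℝ := fun x => Real.exp (-V x + 2 * P * U x + κ) with hr
  have hrae : density μ =ᵐ[volume] r := hae
  set A := Real.exp (2 * P * m + κ) with hA
  have hrle : ∀ x, r x ≤ A * (Real.exp (-V x) * (1 + |x|) ^ (2 * P)) := fun x => by
    rw [Real.rpow_def_of_pos (by positivity), hA, ← Real.exp_add, ← Real.exp_add]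
    exact Real.exp_le_exp.2 (by nlinarith [hU x])
  have hbound : ∀ Q : Polynomial ℝ, ∃ C, 0 ≤ C ∧ ∀ x,
      |Q.eval (deriv V x)| * r x ≤ C * (1 + |x|) ^ (-2 : ℝ) := fun Q => by
    obtain ⟨C, hC0, hC⟩ := hV.exists_bound Q (by positivity : 0 ≤ 2 * P)
    refine ⟨A * C, by positivity, fun x => ?_⟩
    calc |Q.eval (deriv V x)| * r x ≤
          |Q.eval (deriv V x)| * (A * (Real.exp (-V x) * (1 + |x|) ^ (2 * P))) := by
          gcongr
          exact hrle x
      _ = A * (|Q.eval (deriv V x)| * (Real.exp (-V x) * (1 + |x|) ^ (2 * P))) := by ring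
      _ ≤ A * (C * (1 + |x|) ^ (-2 : ℝ)) := mul_le_mul_of_nonneg_left (hC x) (Real.exp_pos _).le
      _ = _ := by ring
  obtain ⟨M, hM0, hM⟩ := hbound 1
  have hbd : BoundedDensity r M := by
    refine ⟨fun x => (Real.exp_pos _).le, fun x => ?_, hfe.integrable.congr hrae, ?_,
      hmom.congr ?_⟩
    · have := hM x
      simp only [Polynomial.eval_one, abs_one, one_mul] at this
      exact this.trans (mul_le_of_le_one_right hM0 (Real.rpow_le_one_of_one_le_of_nonpos
        (by linarith [abs_nonneg x]) (by norm_num)))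
    · rw [← integral_congr_ae hrae, hfe.integral_eq_one]
    · filter_upwards [hrae] with x hx
      rw [hx]
  have hpot : U = logPot r := by
    ext x
    refine integral_congr_ae ?_
    filter_upwards [hrae] with y hy
    rw [hy]
  have hSnn : 0 ≤ ∫ z, sqrtSing z := integral_nonneg sqrtSing_nonneg
  obtain ⟨C, hC0, hC⟩ := exists_locallyHolder (κ := κ) hP hV
    (K := 4 * (M * (∫ z, sqrtSing z) + 1)) (by positivity) hU
    (by rw [hpot]; exact hbd.abs_logPot_sub_le)
  obtain ⟨hHc, hHd⟩ := hbd.hasDerivAt_logPot hC0 hC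
  have hrd : ∀ x, HasDerivAt r
      (r x * (2 * P * BoundedDensity.hilbert r x - deriv V x)) x := fun x => by
    have h1 := hHd x
    rw [← hpot] at h1
    have h2 := (((hV.differentiable x).hasDerivAt.neg.add (h1.const_mul (2 * P))).add_const κ).exp
    convert! h2 using 1
    simp only [hr, Pi.add_apply, Pi.neg_apply]
    ring
  refine ⟨r, fun x => 2 * P * BoundedDensity.hilbert r x, fun x => Real.exp_pos _, hrd,
    continuous_const.mul hHc, ⟨2 * P * (C * (∫ z, sqrtSing z) + 1), fun x => ?_⟩, ?_, ?_⟩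
  · rw [abs_mul, abs_of_pos (by positivity : 0 < 2 * P)]
    exact mul_le_mul_of_nonneg_left (hbd.integrable_hilbert_kernel hC0 hC x).2 (by positivity)
  · rw [← withDensity_density hac]
    refine withDensity_congr_ae ?_
    filter_upwards [hrae] with x hx
    rw [hx]
  · obtain ⟨C2, hC20, hC2⟩ := hbound (1 + Polynomial.X ^ 2)
    have hrc : Continuous r := continuous_iff_continuousAt.2 fun x => (hrd x).continuousAt
    refine Integrable.mono' ((integrable_one_add_norm (E := ℝ) (μ := volume) (r := 2)
      (by simp)).const_mul C2) (((continuous_const.add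
        (hV.continuous_deriv.pow 2)).mul hrc).aestronglyMeasurable) (ae_of_all _ fun x => ?_)
    have := hC2 x
    simp only [Polynomial.eval_add, Polynomial.eval_one, Polynomial.eval_pow,
      Polynomial.eval_X] at this
    rw [norm_mul, Real.norm_eq_abs, Real.norm_eq_abs, abs_of_pos (Real.exp_pos _)]
    exact this

end

/-! ### Weak derivatives and primitives -/

lemma exists_support_subset_Ioo {ψ : ℝ → ℝ} (hc : HasCompactSupport ψ) :
    ∃ R : ℝ, 0 < R ∧ tsupport ψ ⊆ Set.Ioo (-R) R := by
  obtain ⟨R, hR⟩ := hc.isCompact.isBounded.subset_closedBall 0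
  refine ⟨|R| + 1, by positivity, fun x hx => ?_⟩
  have := hR hx
  rw [Metric.mem_closedBall, dist_zero_right, Real.norm_eq_abs] at this
  exact abs_lt.1 (by linarith [le_abs_self R])

lemma integral_eq_intervalIntegral_of_tsupport {f ψ : ℝ → ℝ} {R : ℝ}
    (hR : tsupport ψ ⊆ Set.Ioo (-R) R) (hf : ∀ x, ψ x = 0 → f x = 0) :
    ∫ x, f x = ∫ x in (-R)..R, f x := by
  refine (intervalIntegral.integral_eq_integral_of_support_subset fun x hx => ?_).symm
  have : x ∈ Set.Ioo (-R) R := hR (subset_tsupport ψ fun h => hx (hf x h))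
  exact ⟨this.1, this.2.le⟩

/-- A smooth compactly supported function of integral zero is the derivative of such a
function. -/
lemma exists_primitive_of_integral_eq_zero {θ : ℝ → ℝ} (hs : ContDiff ℝ ∞ θ)
    (hc : HasCompactSupport θ) (h0 : ∫ x, θ x = 0) :
    ∃ Θ : ℝ → ℝ, ContDiff ℝ ∞ Θ ∧ HasCompactSupport Θ ∧ deriv Θ = θ := by
  obtain ⟨R, hR0, hR⟩ := exists_support_subset_Ioo hc
  have hd : ∀ x, HasDerivAt (fun x => ∫ t in (-R)..x, θ t) (θ x) x := fun x =>
    (hs.continuous.integral_hasStrictDerivAt _ x).hasDerivAt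
  have hderiv : deriv (fun x => ∫ t in (-R)..x, θ t) = θ := funext fun x => (hd x).deriv
  have hz : ∀ x, x ∉ Set.Ioo (-R) R → θ x = 0 := fun x hx =>
    image_eq_zero_of_notMem_tsupport fun h => hx (hR h)
  refine ⟨fun x => ∫ t in (-R)..x, θ t, ?_, ?_, hderiv⟩
  · rw [contDiff_infty_iff_deriv, hderiv]
    exact ⟨fun x => (hd x).differentiableAt, hs⟩
  · refine HasCompactSupport.intro (isCompact_Icc (a := -R) (b := R)) fun x hx => ?_
    rw [Set.mem_Icc, not_and_or, not_le, not_le] at hx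
    rcases hx with hx | hx
    · rw [intervalIntegral.integral_symm, intervalIntegral.integral_of_le hx.le,
        setIntegral_eq_zero_of_forall_eq_zero, neg_zero]
      exact fun t ht => hz t fun h => absurd h.1 (not_lt.2 ht.2)
    · rw [intervalIntegral.integral_eq_integral_of_support_subset, h0]
      intro t ht
      have : t ∈ Set.Ioo (-R) R := by
        by_contra h
        exact ht (hz t h)
      exact ⟨this.1, (this.2.trans hx).le⟩

/-- A function with weak derivative zero is constant. -/
lemma HasWeakDeriv.ae_eq_const {w : ℝ → ℝ} (h : HasWeakDeriv w fun _ => 0) :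
    ∃ c : ℝ, w =ᵐ[volume] fun _ => c := by
  let b : ContDiffBump (0 : ℝ) := default
  set η := b.normed volume with hη
  have hηs : ContDiff ℝ ∞ η := b.contDiff_normed
  have hηc : HasCompactSupport η := b.hasCompactSupport_normed
  have hη1 : ∫ x, η x = 1 := b.integral_normed
  refine ⟨∫ x, w x * η x, ?_⟩
  refine ae_eq_of_integral_contDiff_smul_eq h.1 (locallyIntegrable_const _) fun ψ hs hc => ?_
  have i1 : Integrable ψ := hs.continuous.integrable_of_hasCompactSupport hc
  have i2 : Integrable η := hηs.continuous.integrable_of_hasCompactSupport hηc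
  obtain ⟨Θ, hΘs, hΘc, hΘ⟩ := exists_primitive_of_integral_eq_zero
    (θ := fun x => ψ x - (∫ y, ψ y) * η x) (hs.sub (contDiff_const.mul hηs))
    (hc.sub (hηc.mul_left (f := fun _ => ∫ y, ψ y)))
    (by rw [integral_sub i1 (i2.const_mul _), integral_const_mul, hη1]; ring)
  have h1 := h.2.2 Θ hΘs hΘc
  have e : ∀ x, w x * (ψ x - (∫ y, ψ y) * η x) = w x * ψ x - (∫ y, ψ y) * (w x * η x) :=
    fun x => by ring
  simp only [hΘ, zero_mul, integral_zero, neg_zero, e] at h1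
  rw [integral_sub (integrable_mul_of_hasCompactSupport h.1 hs.continuous hc)
    ((integrable_mul_of_hasCompactSupport h.1 hηs.continuous hηc).const_mul _),
    integral_const_mul] at h1
  simp only [smul_eq_mul]
  rw [integral_mul_const]
  simp only [mul_comm (ψ _)]
  linarith

/-- `F` is a primitive of the locally integrable function `g`. -/
structure IsPrimitive (F g : ℝ → ℝ) : Prop where
  locallyIntegrable : LocallyIntegrable g
  eq_add_integral : ∀ x, F x = F 0 + ∫ t in (0 : ℝ)..x, g t

lemma _root_.MeasureTheory.LocallyIntegrable.intervalIntegrable {g : ℝ → ℝ}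
    (hg : LocallyIntegrable g) (a b : ℝ) : IntervalIntegrable g volume a b :=
  (hg.integrableOn_isCompact isCompact_uIcc).intervalIntegrable

namespace IsPrimitive

variable {F G f g : ℝ → ℝ}

lemma ae_hasDerivAt (h : IsPrimitive F g) : ∀ᵐ x, HasDerivAt F (g x) x := by
  filter_upwards [_root_.LocallyIntegrable.ae_hasDerivAt_integral h.locallyIntegrable] with x hx
  rw [funext h.eq_add_integral]
  exact (hx 0).const_add _

lemma absolutelyContinuous (h : IsPrimitive F g) (a b : ℝ) :
    AbsolutelyContinuousOnInterval F a b := by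
  set l := min (min a b) 0
  set u := max (max a b) 0
  have hlu : l ≤ u := (min_le_right _ _).trans (le_max_right _ _)
  have h1 : AbsolutelyContinuousOnInterval (fun x => ∫ t in (0 : ℝ)..x, g t) l u :=
    (h.locallyIntegrable.intervalIntegrable _ _).absolutelyContinuousOnInterval_intervalIntegral
      (by rw [Set.uIcc_of_le hlu]; exact ⟨min_le_right _ _, le_max_right _ _⟩)
  have h2 : AbsolutelyContinuousOnInterval (fun _ : ℝ => F 0) l u :=
    (LipschitzWith.const (F 0)).lipschitzOnWith.absolutelyContinuousOnInterval
  have h3 := h2.add h1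
  have h4 : ((fun _ : ℝ => F 0) + fun x => ∫ t in (0 : ℝ)..x, g t) = F :=
    funext fun x => (h.eq_add_integral x).symm
  rw [h4] at h3
  refine h3.mono ?_
  rw [Set.uIcc_of_le hlu]
  exact Set.Icc_subset_Icc (min_le_left _ _) (le_max_left _ _)

lemma continuous (h : IsPrimitive F g) : Continuous F := by
  rw [funext h.eq_add_integral]
  exact continuous_const.add (intervalIntegral.continuous_primitive
    h.locallyIntegrable.intervalIntegrable 0)

lemma of_absolutelyContinuous (hF : ∀ a b, AbsolutelyContinuousOnInterval F a b)
    (hg : LocallyIntegrable g) (hd : ∀ᵐ x, HasDerivAt F (g x) x) : IsPrimitive F g := by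
  refine ⟨hg, fun x => ?_⟩
  have h1 := (hF 0 x).integral_deriv_eq_sub
  have h2 : ∫ t in (0 : ℝ)..x, deriv F t = ∫ t in (0 : ℝ)..x, g t := by
    refine intervalIntegral.integral_congr_ae ?_
    filter_upwards [hd] with t ht _ using ht.deriv
  linarith

lemma of_hasDerivAt (hF : ∀ x, HasDerivAt F (g x) x) (hg : Continuous g) : IsPrimitive F g := by
  refine ⟨hg.locallyIntegrable, fun x => ?_⟩
  rw [intervalIntegral.integral_eq_sub_of_hasDerivAt (fun t _ => hF t)
    (hg.intervalIntegrable _ _)]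
  ring

lemma mul (hF : IsPrimitive F f) (hG : IsPrimitive G g) :
    IsPrimitive (fun x => F x * G x) (fun x => f x * G x + F x * g x) := by
  refine of_absolutelyContinuous
    (fun a b => (hF.absolutelyContinuous a b).mul (hG.absolutelyContinuous a b)) ?_ ?_
  · have h1 := hF.locallyIntegrable.locallyIntegrableOn Set.univ
    have h2 := hG.locallyIntegrable.locallyIntegrableOn Set.univ
    rw [← locallyIntegrableOn_univ]
    exact (h1.mul_continuousOn hG.continuous.continuousOn isOpen_univ.isLocallyClosed).add
      (h2.continuousOn_mul hF.continuous.continuousOn isOpen_univ.isLocallyClosed)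
  · filter_upwards [hF.ae_hasDerivAt, hG.ae_hasDerivAt] with x h1 h2
    exact h1.mul h2

lemma hasWeakDeriv (h : IsPrimitive F g) : HasWeakDeriv F g := by
  refine ⟨h.continuous.locallyIntegrable, h.locallyIntegrable, fun ψ hs hc => ?_⟩
  obtain ⟨R, hR0, hR⟩ := exists_support_subset_Ioo hc
  have hψ : IsPrimitive ψ (deriv ψ) := of_hasDerivAt
    (fun x => (hs.differentiable (by simp) x).hasDerivAt) (hs.continuous_deriv (by simp))
  have h1 := (h.absolutelyContinuous (-R) R).integral_mul_deriv_eq_deriv_mul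
    (hψ.absolutelyContinuous (-R) R)
  have hz : ∀ x, x ∉ Set.Ioo (-R) R → ψ x = 0 := fun x hx =>
    image_eq_zero_of_notMem_tsupport fun h => hx (hR h)
  rw [hz R (by simp), hz (-R) (by simp)] at h1
  have h2 : ∫ x in (-R)..R, deriv F x * ψ x = ∫ x in (-R)..R, g x * ψ x := by
    refine intervalIntegral.integral_congr_ae ?_
    filter_upwards [h.ae_hasDerivAt] with t ht _
    rw [ht.deriv]
  rw [integral_eq_intervalIntegral_of_tsupport hR (f := fun x => g x * ψ x)
    (fun x hx => by simp [hx]), ← h2]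
  have hR' : tsupport (deriv ψ) ⊆ Set.Ioo (-R) R := Set.Subset.trans tsupport_deriv_subset hR
  rw [integral_eq_intervalIntegral_of_tsupport hR' (f := fun x => F x * deriv ψ x)
    (fun x hx => by simp [hx]), h1]
  ring

end IsPrimitive

lemma HasWeakDeriv.exists_isPrimitive {u g : ℝ → ℝ} (h : HasWeakDeriv u g) :
    ∃ F, IsPrimitive F g ∧ u =ᵐ[volume] F := by
  have h0 : IsPrimitive (fun x => ∫ t in (0 : ℝ)..x, g t) g := ⟨h.2.1, fun x => by simp⟩
  have h1 := h.add (h0.hasWeakDeriv.const_mul (-1))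
  obtain ⟨c, hc⟩ := (h1.congr EventuallyEq.rfl
    (ae_of_all _ fun x => show g x + -1 * g x = 0 by ring)).ae_eq_const
  refine ⟨fun x => c + ∫ t in (0 : ℝ)..x, g t, ⟨h.2.1, fun x => by simp⟩, ?_⟩
  filter_upwards [hc] with x hx
  linarith

/-- Weak derivatives are unique. -/
lemma HasWeakDeriv.unique {u u' g g' : ℝ → ℝ} (h : HasWeakDeriv u g) (h' : HasWeakDeriv u' g')
    (hu : u =ᵐ[volume] u') : g =ᵐ[volume] g' := by
  have h1 := (h.add (h'.const_mul (-1))).ae_eq_zero (by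
    filter_upwards [hu] with x hx
    simp [hx])
  filter_upwards [h1] with x hx
  simp only [Pi.zero_apply] at hx
  linarith

/-- The product rule. -/
lemma HasWeakDeriv.mul_of_hasDerivAt {u g a a' : ℝ → ℝ} (h : HasWeakDeriv u g)
    (ha : ∀ x, HasDerivAt a (a' x) x) (ha' : Continuous a') :
    HasWeakDeriv (fun x => a x * u x) (fun x => a' x * u x + a x * g x) := by
  obtain ⟨F, hF, hu⟩ := h.exists_isPrimitive
  refine ((IsPrimitive.of_hasDerivAt ha ha').mul hF).hasWeakDeriv.congr ?_ ?_ <;>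
  · filter_upwards [hu] with x hx
    rw [hx]

/-! ### Function spaces over a regular density -/

lemma AdmissiblePotential.hasDerivAt_deriv {V : ℝ → ℝ} {μ : Measure ℝ}
    (hV : AdmissiblePotential V μ) (x : ℝ) :
    HasDerivAt (deriv V) (iteratedDeriv 2 V x) x := by
  have h : ContDiff ℝ 2 (deriv V) := hV.contDiff.deriv' 
  have := (h.differentiable (by norm_num) x).hasDerivAt
  rwa [show iteratedDeriv 2 V x = deriv (deriv V) x by
    rw [iteratedDeriv_succ, iteratedDeriv_one]]

lemma AdmissiblePotential.continuous_iteratedDeriv_two {V : ℝ → ℝ} {μ : Measure ℝ}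
    (hV : AdmissiblePotential V μ) : Continuous (iteratedDeriv 2 V) :=
  hV.contDiff.continuous_iteratedDeriv 2 (by norm_num)

/-- The second derivative of the potential is controlled by the first one. -/
lemma AdmissiblePotential.exists_second_deriv_bound {V : ℝ → ℝ} {μ : Measure ℝ}
    (hV : AdmissiblePotential V μ) :
    ∃ C, 0 ≤ C ∧ ∀ x, |iteratedDeriv 2 V x| ≤ C * (1 + |deriv V x|) := by
  obtain ⟨c, hc0, hc⟩ := hV.second_deriv_bound.exists_nonneg
  have h1 : ∀ᶠ x in cocompact ℝ, |iteratedDeriv 2 V x| ≤ c * |deriv V x| := by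
    filter_upwards [hc.bound, hV.abs_deriv_tendsto_top.eventually_gt_atTop 0] with x hx hx0
    rw [norm_div, norm_one, mul_one, Real.norm_eq_abs, Real.norm_eq_abs, div_le_iff₀ hx0] at hx
    exact hx
  rw [Filter.Eventually, mem_cocompact] at h1
  obtain ⟨K, hK, hKs⟩ := h1
  obtain ⟨D, hD⟩ := hK.exists_bound_of_continuousOn hV.continuous_iteratedDeriv_two.continuousOn
  refine ⟨max c |D|, le_max_of_le_left hc0, fun x => ?_⟩
  have hx0 := abs_nonneg (deriv V x)
  by_cases hx : x ∈ K
  · have h2 := hD x hx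
    rw [Real.norm_eq_abs] at h2
    calc |iteratedDeriv 2 V x| ≤ max c |D| := h2.trans ((le_abs_self D).trans (le_max_right _ _))
      _ ≤ _ := le_mul_of_one_le_right (le_max_of_le_left hc0) (by linarith)
  · have h2 : |iteratedDeriv 2 V x| ≤ c * |deriv V x| := hKs hx
    calc |iteratedDeriv 2 V x| ≤ max c |D| * |deriv V x| :=
          h2.trans (mul_le_mul_of_nonneg_right (le_max_left _ _) hx0)
      _ ≤ _ := mul_le_mul_of_nonneg_left (by linarith) (le_max_of_le_left hc0)

/-- If `r` is integrable, then `c / r` is square integrable with respect to `r dx` only for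
`c = 0`. -/
lemma eq_zero_of_integrable_div {r : ℝ → ℝ} (hpos : ∀ x, 0 < r x) (hr : Integrable r) {c : ℝ}
    (hc : Integrable fun x => c ^ 2 / r x) : c = 0 := by
  by_contra h
  have h1 : Integrable fun x => r x + c ^ 2 / r x := hr.add hc
  have h2 : Integrable fun _ : ℝ => 2 * |c| := by
    refine h1.mono' aestronglyMeasurable_const (ae_of_all _ fun x => ?_)
    rw [Real.norm_eq_abs, abs_of_nonneg (by positivity)]
    have := hpos x
    have h3 : r x + c ^ 2 / r x - 2 * |c| = (r x - |c|) ^ 2 / r x := by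
      rw [← sq_abs c]
      field_simp
      ring
    have h4 : 0 ≤ (r x - |c|) ^ 2 / r x := by positivity
    linarith
  rw [integrable_const_iff] at h2
  rcases h2 with h2 | h2
  · exact h (by simpa using h2)
  · exact absurd h2.measure_univ_lt_top (by simp)

section L2

variable {μ : Measure ℝ}

lemma inner_toLp {b : ℝ → ℝ} (hb : MemLp b 2 μ) (f : Lp ℝ 2 μ) :
    inner ℝ (hb.toLp b) f = ∫ x, b x * f x ∂μ := by
  rw [L2.inner_def]
  refine integral_congr_ae ?_
  filter_upwards [hb.coeFn_toLp] with x hx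
  rw [hx, Real.inner_apply]

lemma norm_sq_toLp {b : ℝ → ℝ} (hb : MemLp b 2 μ) :
    ‖hb.toLp b‖ ^ 2 = ∫ x, b x ^ 2 ∂μ := by
  rw [← real_inner_self_eq_norm_sq, inner_toLp]
  refine integral_congr_ae ?_
  filter_upwards [hb.coeFn_toLp] with x hx
  rw [hx, sq]

end L2

namespace RegularDensity

variable {V r h : ℝ → ℝ} {μ : Measure ℝ}

lemma continuous (hr : RegularDensity V r h μ) : Continuous r :=
  continuous_iff_continuousAt.2 fun x => (hr.hasDerivAt x).continuousAt

lemma integral_eq (hr : RegularDensity V r h μ) (f : ℝ → ℝ) :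
    ∫ x, f x ∂μ = ∫ x, r x * f x := by
  rw [hr.measure_eq, integral_withDensity_ofReal hr.continuous.measurable fun x => (hr.pos x).le]

lemma integrable_iff (hr : RegularDensity V r h μ) {f : ℝ → ℝ} :
    Integrable f μ ↔ Integrable fun x => r x * f x := by
  rw [hr.measure_eq, integrable_withDensity_ofReal_iff hr.continuous.measurable
    fun x => (hr.pos x).le]

lemma absolutelyContinuous (hr : RegularDensity V r h μ) : μ ≪ volume := by
  rw [hr.measure_eq]
  exact withDensity_absolutelyContinuous _ _

lemma absolutelyContinuous' (hr : RegularDensity V r h μ) : volume ≪ μ := by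
  rw [hr.measure_eq]
  exact withDensity_absolutelyContinuous' hr.continuous.measurable.ennreal_ofReal.aemeasurable
    (ae_of_all _ fun x => by simpa using hr.pos x)

lemma ae_eq (hr : RegularDensity V r h μ) : ae μ = ae (volume : Measure ℝ) :=
  le_antisymm hr.absolutelyContinuous.ae_le hr.absolutelyContinuous'.ae_le

lemma density_ae_eq (hr : RegularDensity V r h μ) : density μ =ᵐ[volume] r := by
  have := density_withDensity hr.continuous.measurable fun x => (hr.pos x).le
  rwa [← hr.measure_eq] at this

lemma aestronglyMeasurable_iff (hr : RegularDensity V r h μ) {f : ℝ → ℝ} :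
    AEStronglyMeasurable f μ ↔ AEStronglyMeasurable f :=
  ⟨fun hf => hf.mono_ac hr.absolutelyContinuous', fun hf => hf.mono_ac hr.absolutelyContinuous⟩

lemma continuous_sqrt (hr : RegularDensity V r h μ) : Continuous fun x => √(r x) :=
  hr.continuous.sqrt

lemma sqrt_pos (hr : RegularDensity V r h μ) (x : ℝ) : 0 < √(r x) := Real.sqrt_pos.2 (hr.pos x)

lemma continuous_inv (hr : RegularDensity V r h μ) : Continuous fun x => (r x)⁻¹ :=
  hr.continuous.inv₀ fun x => (hr.pos x).ne'

lemma memLp_iff (hr : RegularDensity V r h μ) {f : ℝ → ℝ} :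
    MemLp f 2 μ ↔ MemLp (fun x => √(r x) * f x) 2 volume := by
  have key : AEStronglyMeasurable f volume → (MemLp f 2 μ ↔
      MemLp (fun x => √(r x) * f x) 2 volume) := fun hf => by
    rw [memLp_two_iff_integrable_sq (hr.aestronglyMeasurable_iff.2 hf),
      memLp_two_iff_integrable_sq (f := fun x => √(r x) * f x)
        (hr.continuous_sqrt.aestronglyMeasurable.mul hf),
      hr.integrable_iff]
    refine iff_of_eq (congrArg (Integrable · volume) (funext fun x => ?_))
    rw [mul_pow, Real.sq_sqrt (hr.pos x).le]
  constructor
  · intro hf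
    exact (key (hr.aestronglyMeasurable_iff.1 hf.1)).1 hf
  · intro hf
    refine (key ?_).2 hf
    have h1 : AEStronglyMeasurable (fun x => (√(r x))⁻¹ * (√(r x) * f x)) volume :=
      (hr.continuous_sqrt.inv₀ fun x => (hr.sqrt_pos x).ne').aestronglyMeasurable.mul hf.1
    refine h1.congr (ae_of_all _ fun x => ?_)
    exact inv_mul_cancel_left₀ (hr.sqrt_pos x).ne' _

lemma locallyIntegrable (hr : RegularDensity V r h μ) {f : ℝ → ℝ} (hf : Integrable f μ) :
    LocallyIntegrable f := by
  have h1 := ((hr.integrable_iff.1 hf).locallyIntegrable.locallyIntegrableOn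
    Set.univ).continuousOn_mul hr.continuous_inv.continuousOn isOpen_univ.isLocallyClosed
  rw [locallyIntegrableOn_univ] at h1
  refine h1.congr (ae_of_all _ fun x => ?_)
  exact inv_mul_cancel_left₀ (hr.pos x).ne' _

lemma hasDerivAt_sqrt (hr : RegularDensity V r h μ) (x : ℝ) :
    HasDerivAt (fun x => √(r x)) (√(r x) * ((h x - deriv V x) / 2)) x := by
  convert! (hr.hasDerivAt x).sqrt (hr.pos x).ne' using 1
  have h1 := hr.sqrt_pos x
  have h2 := Real.sq_sqrt (hr.pos x).le
  field_simp
  rw [h2]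
  ring

lemma hasDerivAt_inv_sqrt (hr : RegularDensity V r h μ) (x : ℝ) :
    HasDerivAt (fun x => (√(r x))⁻¹) (-((√(r x))⁻¹ * ((h x - deriv V x) / 2))) x := by
  convert! (hr.hasDerivAt_sqrt x).inv (hr.sqrt_pos x).ne' using 1
  have h1 := hr.sqrt_pos x
  field_simp

/-- The potential confines the functions of the form domain. -/
lemma exists_confinement (hr : RegularDensity V r h μ) (hV : AdmissiblePotential V μ) :
    ∃ C, 0 ≤ C ∧ ∀ (φ φ' : ℝ → ℝ) (M : ℝ), (∀ x, HasDerivAt φ (φ' x) x) → Continuous φ' →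
      (∀ x, |φ x| ≤ M) → (∀ x, |φ' x| ≤ M) →
      (Integrable fun x => (deriv V x * φ x) ^ 2 * r x) ∧
      ∫ x, (deriv V x * φ x) ^ 2 * r x ≤ C * ((∫ x, φ' x ^ 2 * r x) + ∫ x, φ x ^ 2 * r x) := by
  obtain ⟨C₂, hC₂, hV₂⟩ := hV.exists_second_deriv_bound
  obtain ⟨B, hB⟩ := hr.bounded_h
  have hB0 : 0 ≤ B := (abs_nonneg _).trans (hB 0)
  refine ⟨16 + 4 * (C₂ + C₂ ^ 2 + B ^ 2), by positivity, fun φ φ' M hφ hφ' hM hM' => ?_⟩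
  have hM0 : 0 ≤ M := (abs_nonneg _).trans (hM 0)
  have hφc : Continuous φ := continuous_iff_continuousAt.2 fun x => (hφ x).continuousAt
  have hVc := hV.continuous_deriv
  have hrc := hr.continuous
  have hV2c := hV.continuous_iteratedDeriv_two
  have hhc := hr.continuous_h
  have dom : ∀ (f : ℝ → ℝ) (D : ℝ), Continuous f → (∀ x, |f x| ≤ D * (1 + deriv V x ^ 2)) →
      Integrable fun x => f x * r x := fun f D hf hfD => by
    refine (hr.integrable.const_mul D).mono' (hf.mul hrc).aestronglyMeasurable
      (ae_of_all _ fun x => ?_)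
    rw [norm_mul, Real.norm_eq_abs, Real.norm_eq_abs, abs_of_pos (hr.pos x), ← mul_assoc]
    exact mul_le_mul_of_nonneg_right (hfD x) (hr.pos x).le
  have hφ2 : ∀ x, φ x ^ 2 ≤ M ^ 2 := fun x => sq_le_sq' (abs_le.1 (hM x)).1 (abs_le.1 (hM x)).2
  have hφ'2 : ∀ x, φ' x ^ 2 ≤ M ^ 2 := fun x =>
    sq_le_sq' (abs_le.1 (hM' x)).1 (abs_le.1 (hM' x)).2
  have hV1 : ∀ x, |deriv V x| ≤ 1 + deriv V x ^ 2 := fun x => by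
    nlinarith [sq_abs (deriv V x), sq_nonneg (|deriv V x| - 1)]
  have i1 : Integrable fun x => (deriv V x * φ x) ^ 2 * r x := by
    refine dom _ (M ^ 2) ((hVc.mul hφc).pow 2) fun x => ?_
    rw [abs_of_nonneg (sq_nonneg _), mul_pow]
    nlinarith [hφ2 x, sq_nonneg (deriv V x), sq_nonneg M, sq_nonneg (φ x)]
  have i2 : Integrable fun x => φ x ^ 2 * r x := by
    refine dom _ (M ^ 2) (hφc.pow 2) fun x => ?_
    rw [abs_of_nonneg (sq_nonneg _)]
    nlinarith [hφ2 x, mul_nonneg (sq_nonneg M) (sq_nonneg (deriv V x))]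
  have i3 : Integrable fun x => φ' x ^ 2 * r x := by
    refine dom _ (M ^ 2) (hφ'.pow 2) fun x => ?_
    rw [abs_of_nonneg (sq_nonneg _)]
    nlinarith [hφ'2 x, mul_nonneg (sq_nonneg M) (sq_nonneg (deriv V x))]
  set F : ℝ → ℝ := fun x => φ x ^ 2 * deriv V x * r x with hF
  set F' : ℝ → ℝ := fun x => (2 * φ x * φ' x * deriv V x + φ x ^ 2 * iteratedDeriv 2 V x +
    φ x ^ 2 * deriv V x * h x - (deriv V x * φ x) ^ 2) * r x with hF'
  have hder : ∀ x, HasDerivAt F (F' x) x := fun x => by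
    have := (((hφ x).pow 2).mul (hV.hasDerivAt_deriv x)).mul (hr.hasDerivAt x)
    convert! this using 1
    simp only [hF', Pi.mul_apply, Pi.pow_apply]
    push_cast
    ring
  have iF : Integrable F := by
    refine dom _ (M ^ 2) ((hφc.pow 2).mul hVc) fun x => ?_
    rw [abs_mul, abs_of_nonneg (sq_nonneg _)]
    exact mul_le_mul (hφ2 x) (hV1 x) (abs_nonneg _) (sq_nonneg _)
  have iF' : Integrable F' := by
    refine dom _ (M ^ 2 * (3 + 2 * C₂ + B)) (by fun_prop) fun x => ?_
    have a0 := hV1 x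
    have a1 : |2 * φ x * φ' x * deriv V x| ≤ 2 * M ^ 2 * (1 + deriv V x ^ 2) := by
      rw [abs_mul, abs_mul, abs_mul, abs_two]
      have : |φ x| * |φ' x| ≤ M * M := mul_le_mul (hM x) (hM' x) (abs_nonneg _) hM0
      calc 2 * |φ x| * |φ' x| * |deriv V x| = 2 * (|φ x| * |φ' x|) * |deriv V x| := by ring
        _ ≤ 2 * (M * M) * (1 + deriv V x ^ 2) := by gcongr
        _ = _ := by ring
    have a2 : |φ x ^ 2 * iteratedDeriv 2 V x| ≤ M ^ 2 * (2 * C₂) * (1 + deriv V x ^ 2) := by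
      rw [abs_mul, abs_of_nonneg (sq_nonneg _)]
      calc φ x ^ 2 * |iteratedDeriv 2 V x| ≤ M ^ 2 * (C₂ * (1 + |deriv V x|)) := by
            exact mul_le_mul (hφ2 x) (hV₂ x) (abs_nonneg _) (sq_nonneg _)
        _ ≤ M ^ 2 * (C₂ * (2 * (1 + deriv V x ^ 2))) := by
            gcongr
            nlinarith [sq_nonneg (deriv V x)]
        _ = _ := by ring
    have a3 : |φ x ^ 2 * deriv V x * h x| ≤ M ^ 2 * B * (1 + deriv V x ^ 2) := by
      rw [abs_mul, abs_mul, abs_of_nonneg (sq_nonneg _)]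
      calc φ x ^ 2 * |deriv V x| * |h x| ≤ M ^ 2 * (1 + deriv V x ^ 2) * B := by
            exact mul_le_mul (mul_le_mul (hφ2 x) (hV1 x) (abs_nonneg _) (sq_nonneg _)) (hB x)
              (abs_nonneg _) (by positivity)
        _ = _ := by ring
    have a4 : |(deriv V x * φ x) ^ 2| ≤ M ^ 2 * (1 + deriv V x ^ 2) := by
      rw [abs_of_nonneg (sq_nonneg _), mul_pow]
      nlinarith [hφ2 x, sq_nonneg (deriv V x), sq_nonneg M, sq_nonneg (φ x)]
    calc _ ≤ |2 * φ x * φ' x * deriv V x| + |φ x ^ 2 * iteratedDeriv 2 V x| +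
          |φ x ^ 2 * deriv V x * h x| + |(deriv V x * φ x) ^ 2| :=
          (abs_sub _ _).trans (add_le_add_left (abs_add_three _ _ _) _)
      _ ≤ _ := by linarith
  have hzero := integral_eq_zero_of_hasDerivAt_of_integrable hder iF' iF
  refine ⟨i1, ?_⟩
  set D := C₂ + C₂ ^ 2 + B ^ 2 with hD
  have hD0 : 0 ≤ D := by positivity
  have hpt : ∀ x, F' x + 1 / 4 * ((deriv V x * φ x) ^ 2 * r x) ≤
      4 * (φ' x ^ 2 * r x) + D * (φ x ^ 2 * r x) := fun x => by
    have b1 : 2 * φ x * φ' x * deriv V x ≤ (deriv V x * φ x) ^ 2 / 4 + 4 * φ' x ^ 2 := by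
      nlinarith [sq_nonneg (deriv V x * φ x / 2 - 2 * φ' x)]
    have b2 : iteratedDeriv 2 V x ≤ deriv V x ^ 2 / 4 + (C₂ + C₂ ^ 2) := by
      have := (le_abs_self _).trans (hV₂ x)
      nlinarith [sq_nonneg (|deriv V x| / 2 - C₂), sq_abs (deriv V x)]
    have b3 : deriv V x * h x ≤ deriv V x ^ 2 / 4 + B ^ 2 := by
      have h1 : h x ^ 2 ≤ B ^ 2 := sq_le_sq' (abs_le.1 (hB x)).1 (abs_le.1 (hB x)).2
      nlinarith [sq_nonneg (deriv V x / 2 - h x)]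
    have b4 : φ x ^ 2 * iteratedDeriv 2 V x + φ x ^ 2 * deriv V x * h x ≤
        (deriv V x * φ x) ^ 2 / 2 + D * φ x ^ 2 := by
      have := mul_le_mul_of_nonneg_left (add_le_add b2 b3) (sq_nonneg (φ x))
      calc _ = φ x ^ 2 * (iteratedDeriv 2 V x + deriv V x * h x) := by ring
        _ ≤ _ := this
        _ = _ := by rw [hD]; ring
    have b5 : 2 * φ x * φ' x * deriv V x + φ x ^ 2 * iteratedDeriv 2 V x +
        φ x ^ 2 * deriv V x * h x - (deriv V x * φ x) ^ 2 + 1 / 4 * (deriv V x * φ x) ^ 2 ≤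
        4 * φ' x ^ 2 + D * φ x ^ 2 := by linarith
    calc _ = (2 * φ x * φ' x * deriv V x + φ x ^ 2 * iteratedDeriv 2 V x +
        φ x ^ 2 * deriv V x * h x - (deriv V x * φ x) ^ 2 + 1 / 4 * (deriv V x * φ x) ^ 2) *
          r x := by rw [hF']; ring
      _ ≤ (4 * φ' x ^ 2 + D * φ x ^ 2) * r x := mul_le_mul_of_nonneg_right b5 (hr.pos x).le
      _ = _ := by ring
  have hint := integral_mono (iF'.add (i1.const_mul _)) ((i3.const_mul 4).add (i2.const_mul D)) hpt
  simp only [Pi.add_apply] at hint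
  rw [integral_add iF' (i1.const_mul _), integral_add (i3.const_mul 4) (i2.const_mul D), hzero,
    integral_const_mul, integral_const_mul, integral_const_mul] at hint
  have n2 : 0 ≤ ∫ x, φ x ^ 2 * r x := integral_nonneg fun x => mul_nonneg (sq_nonneg _) (hr.pos x).le
  have n3 : 0 ≤ ∫ x, φ' x ^ 2 * r x :=
    integral_nonneg fun x => mul_nonneg (sq_nonneg _) (hr.pos x).le
  nlinarith [mul_nonneg hD0 n3]

lemma integral_inv_mul (hr : RegularDensity V r h μ) (f g : ℝ → ℝ) :
    ∫ x, (r x)⁻¹ * f x * g x ∂μ = ∫ x, g x * f x := by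
  rw [hr.integral_eq]
  congr 1
  ext x
  have := (hr.pos x).ne'
  field_simp

lemma memLp_bdd_mul (hr : RegularDensity V r h μ) {f : ℝ → ℝ} (hf : MemLp f 2 μ) :
    MemLp (fun x => h x * f x) 2 μ := by
  obtain ⟨B, hB⟩ := hr.bounded_h
  exact MemLp.of_le_mul (c := B) hf (hr.continuous_h.aestronglyMeasurable.mul hf.1)
    (ae_of_all _ fun x => by
      rw [norm_mul]
      exact mul_le_mul_of_nonneg_right (hB x) (norm_nonneg _))

variable [IsProbabilityMeasure μ]

lemma integrable_density (hr : RegularDensity V r h μ) : Integrable r := by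
  simpa using hr.integrable_iff.1 (integrable_const (1 : ℝ) (μ := μ))

lemma integrable_lp (f : Lp ℝ 2 μ) : Integrable f μ := (Lp.memLp f).integrable (by norm_num)

/-- A square integrable function `c / r` vanishes. -/
lemma eq_zero_of_memLp (hr : RegularDensity V r h μ) {d : ℝ → ℝ} (hd : MemLp d 2 μ) {c : ℝ}
    (hc : (fun x => d x * r x) =ᵐ[volume] fun _ => c) : c = 0 ∧ d =ᵐ[volume] 0 := by
  have h1 := hr.integrable_iff.1 hd.integrable_sq
  have h2 : c = 0 := by
    refine eq_zero_of_integrable_div hr.pos hr.integrable_density (h1.congr ?_)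
    filter_upwards [hc] with x hx
    have := hr.pos x
    rw [← hx]
    field_simp
  refine ⟨h2, ?_⟩
  filter_upwards [hc] with x hx
  rw [h2] at hx
  exact (mul_eq_zero.1 hx).resolve_right (hr.pos x).ne'

/-! ### The weighted estimate -/

end RegularDensity

/-! ### The inverse of the derivative -/

/-- Smooth compactly supported functions. -/
def testSpace : Submodule ℝ (ℝ → ℝ) where
  carrier := {ψ | ContDiff ℝ ∞ ψ ∧ HasCompactSupport ψ}
  zero_mem' := ⟨contDiff_const, HasCompactSupport.zero⟩
  add_mem' h₁ h₂ := ⟨h₁.1.add h₂.1, h₁.2.add h₂.2⟩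
  smul_mem' c _ h := ⟨contDiff_const.smul h.1, h.2.smul_left (f := fun _ => c)⟩

namespace testSpace

variable (ψ : testSpace)

lemma contDiff : ContDiff ℝ ∞ (ψ : ℝ → ℝ) := ψ.2.1

lemma hasCompactSupport : HasCompactSupport (ψ : ℝ → ℝ) := ψ.2.2

lemma differentiable : Differentiable ℝ (ψ : ℝ → ℝ) := (contDiff ψ).differentiable (by simp)

lemma continuous : Continuous (ψ : ℝ → ℝ) := (contDiff ψ).continuous

lemma continuous_deriv : Continuous (deriv (ψ : ℝ → ℝ)) := (contDiff ψ).continuous_deriv (by simp)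

lemma memLp_deriv (μ : Measure ℝ) [IsFiniteMeasure μ] : MemLp (deriv (ψ : ℝ → ℝ)) 2 μ :=
  (continuous_deriv ψ).memLp_of_hasCompactSupport (hasCompactSupport ψ).deriv

lemma integrable (μ : Measure ℝ) [IsFiniteMeasure μ] : Integrable (ψ : ℝ → ℝ) μ :=
  (continuous ψ).integrable_of_hasCompactSupport (hasCompactSupport ψ)

lemma memLp_center (μ : Measure ℝ) [IsFiniteMeasure μ] :
    MemLp (fun x => (ψ : ℝ → ℝ) x - ∫ y, (ψ : ℝ → ℝ) y ∂μ) 2 μ :=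
  ((continuous ψ).memLp_of_hasCompactSupport (hasCompactSupport ψ)).sub (memLp_const _)

lemma exists_bound (c : ℝ) :
    ∃ M, (∀ x, |(ψ : ℝ → ℝ) x - c| ≤ M) ∧ ∀ x, |deriv (ψ : ℝ → ℝ) x| ≤ M := by
  obtain ⟨A, hA⟩ := (continuous ψ).bounded_above_of_compact_support (hasCompactSupport ψ)
  obtain ⟨B, hB⟩ :=
    (continuous_deriv ψ).bounded_above_of_compact_support (hasCompactSupport ψ).deriv
  refine ⟨max (A + |c|) B, fun x => ?_, fun x => (hB x).trans (le_max_right _ _)⟩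
  exact (abs_sub _ _).trans ((add_le_add_left (hA x) _).trans (le_max_left _ _))

end testSpace

section operators

variable (μ : Measure ℝ) [IsFiniteMeasure μ]

/-- The derivative of a test function, as an element of `L²(μ)`. -/
def derivL : testSpace →ₗ[ℝ] Lp ℝ 2 μ where
  toFun ψ := (testSpace.memLp_deriv ψ μ).toLp
  map_add' ψ χ := by
    rw [← MemLp.toLp_add]
    exact MemLp.toLp_congr _ _ (ae_of_all _ fun x =>
      deriv_add (testSpace.differentiable ψ x) (testSpace.differentiable χ x))
  map_smul' c ψ := by
    rw [RingHom.id_apply, ← MemLp.toLp_const_smul]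
    exact MemLp.toLp_congr _ _ (ae_of_all _ fun x =>
      deriv_const_smul c (testSpace.differentiable ψ x))

/-- A test function minus its mean, as an element of `L²(μ)`. -/
def centerL : testSpace →ₗ[ℝ] Lp ℝ 2 μ where
  toFun ψ := (testSpace.memLp_center ψ μ).toLp
  map_add' ψ χ := by
    rw [← MemLp.toLp_add]
    refine MemLp.toLp_congr _ _ (ae_of_all _ fun x => ?_)
    simp only [Submodule.coe_add, Pi.add_apply]
    rw [integral_add (testSpace.integrable ψ μ) (testSpace.integrable χ μ)]
    ring
  map_smul' c ψ := by
    rw [RingHom.id_apply, ← MemLp.toLp_const_smul]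
    refine MemLp.toLp_congr _ _ (ae_of_all _ fun x => ?_)
    simp only [Submodule.coe_smul, Pi.smul_apply, smul_eq_mul]
    rw [integral_const_mul]
    ring

/-- The bounded operator of `L²(μ)` which maps the derivative of a function to the function
minus its mean. -/
def antideriv : Lp ℝ 2 μ →L[ℝ] Lp ℝ 2 μ := (centerL μ).extendOfNorm (derivL μ)

variable {μ}

lemma coeFn_derivL (ψ : testSpace) : derivL μ ψ =ᵐ[μ] deriv (ψ : ℝ → ℝ) :=
  (testSpace.memLp_deriv ψ μ).coeFn_toLp

lemma coeFn_centerL (ψ : testSpace) :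
    centerL μ ψ =ᵐ[μ] fun x => (ψ : ℝ → ℝ) x - ∫ y, (ψ : ℝ → ℝ) y ∂μ :=
  (testSpace.memLp_center ψ μ).coeFn_toLp

lemma norm_derivL_sq (ψ : testSpace) : ‖derivL μ ψ‖ ^ 2 = ∫ x, deriv (ψ : ℝ → ℝ) x ^ 2 ∂μ :=
  norm_sq_toLp (testSpace.memLp_deriv ψ μ)

lemma norm_centerL_sq (ψ : testSpace) :
    ‖centerL μ ψ‖ ^ 2 = ∫ x, ((ψ : ℝ → ℝ) x - ∫ y, (ψ : ℝ → ℝ) y ∂μ) ^ 2 ∂μ :=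
  norm_sq_toLp (testSpace.memLp_center ψ μ)

lemma le_sqrt_mul_of_sq_le {a b C : ℝ} (hb : 0 ≤ b) (hC : 0 ≤ C) (h : a ^ 2 ≤ C * b ^ 2) :
    a ≤ √C * b := by
  refine abs_le_of_sq_le_sq' ?_ (by positivity) |>.2
  rw [mul_pow, Real.sq_sqrt hC]
  exact h

lemma PoincareInequality.norm_centerL_le (hP : PoincareInequality μ) :
    ∃ C, 0 ≤ C ∧ ∀ ψ : testSpace, ‖centerL μ ψ‖ ≤ C * ‖derivL μ ψ‖ := by
  obtain ⟨C, hC, h⟩ := hP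
  refine ⟨√C, Real.sqrt_nonneg _, fun ψ => le_sqrt_mul_of_sq_le (norm_nonneg _) hC.le ?_⟩
  rw [norm_centerL_sq, norm_derivL_sq]
  exact h _ ((testSpace.contDiff ψ).of_le (by simp)) (testSpace.hasCompactSupport ψ)

end operators

namespace RegularDensity

variable {V r h : ℝ → ℝ} {μ : Measure ℝ}

lemma memLp_weight (hr : RegularDensity V r h μ) (hV : AdmissiblePotential V μ) (ψ : testSpace) :
    MemLp (fun x => deriv V x * ((ψ : ℝ → ℝ) x - ∫ y, (ψ : ℝ → ℝ) y ∂μ)) 2 μ := by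
  obtain ⟨C, -, hC⟩ := hr.exists_confinement hV
  obtain ⟨M, hM, hM'⟩ := testSpace.exists_bound ψ (∫ y, (ψ : ℝ → ℝ) y ∂μ)
  have := (hC _ _ M (fun x => (testSpace.differentiable ψ x).hasDerivAt.sub_const _)
    (testSpace.continuous_deriv ψ) hM hM').1
  rw [memLp_two_iff_integrable_sq, hr.integrable_iff]
  · exact this.congr (ae_of_all _ fun x => mul_comm _ _)
  · exact (hV.continuous_deriv.mul
      ((testSpace.continuous ψ).sub continuous_const)).aestronglyMeasurable

variable [IsProbabilityMeasure μ]

/-- Derivatives of test functions are dense in `L²(μ)`. -/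
lemma denseRange_derivL (hr : RegularDensity V r h μ) : DenseRange (derivL μ) := by
  have h1 : (LinearMap.range (derivL μ))ᗮ = ⊥ := by
    rw [Submodule.eq_bot_iff]
    intro g hg
    rw [Submodule.mem_orthogonal] at hg
    have hw : HasWeakDeriv (fun x => r x * g x) (fun _ => 0) := by
      refine ⟨(hr.integrable_iff.1 (integrable_lp g)).locallyIntegrable,
        locallyIntegrable_const 0, fun ψ hs hc => ?_⟩
      have h2 := hg _ ⟨⟨ψ, hs, hc⟩, rfl⟩
      change inner ℝ (testSpace.memLp_deriv ⟨ψ, hs, hc⟩ μ).toLp g = 0 at h2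
      rw [inner_toLp, hr.integral_eq] at h2
      simp only [zero_mul, integral_zero, neg_zero]
      rw [← h2]
      congr 1
      ext x
      ring
    obtain ⟨c, hc⟩ := hw.ae_eq_const
    have h3 := (hr.eq_zero_of_memLp (Lp.memLp g) (c := c) (by
      filter_upwards [hc] with x hx
      rw [mul_comm, hx])).2
    rw [← hr.ae_eq] at h3
    exact (Lp.eq_zero_iff_ae_eq_zero).2 h3
  have h2 := Submodule.topologicalClosure_eq_top_iff.2 h1
  rw [← Submodule.dense_iff_topologicalClosure_eq_top] at h2
  exact h2

lemma antideriv_derivL (hr : RegularDensity V r h μ) (hP : PoincareInequality μ) (ψ : testSpace) :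
    antideriv μ (derivL μ ψ) = centerL μ ψ := by
  obtain ⟨C, -, hC⟩ := hP.norm_centerL_le
  exact LinearMap.extendOfNorm_eq hr.denseRange_derivL ⟨C, hC⟩ ψ

lemma memLp_inv_mul (hr : RegularDensity V r h μ) {f : ℝ → ℝ} (hf : Continuous f)
    (hc : HasCompactSupport f) : MemLp (fun x => (r x)⁻¹ * f x) 2 μ :=
  (hr.continuous_inv.mul hf).memLp_of_hasCompactSupport (hc.mul_left (f := fun x => (r x)⁻¹))

/-- The antiderivative has the given weak derivative. -/
lemma hasWeakDeriv_antideriv (hr : RegularDensity V r h μ) (hP : PoincareInequality μ)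
    (g : Lp ℝ 2 μ) : HasWeakDeriv (antideriv μ g) g := by
  refine ⟨hr.locallyIntegrable (integrable_lp _), hr.locallyIntegrable (integrable_lp _),
    fun η hs hc => ?_⟩
  have m1 := hr.memLp_inv_mul (hs.continuous_deriv (by simp)) hc.deriv
  have m2 := hr.memLp_inv_mul hs.continuous hc
  have e1 : ∀ g : Lp ℝ 2 μ, inner ℝ m1.toLp g = ∫ x, g x * deriv η x := fun g => by
    rw [inner_toLp, hr.integral_inv_mul]
  have e2 : ∀ g : Lp ℝ 2 μ, inner ℝ m2.toLp g = ∫ x, g x * η x := fun g => by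
    rw [inner_toLp, hr.integral_inv_mul]
  rw [← e1, ← e2]
  refine hr.denseRange_derivL.induction_on
    (p := fun g => inner ℝ m1.toLp (antideriv μ g) = -inner ℝ m2.toLp g) g
    (isClosed_eq (by fun_prop) (by fun_prop)) fun ψ => ?_
  rw [hr.antideriv_derivL hP, e1, e2]
  have hw : HasWeakDeriv (fun x => (ψ : ℝ → ℝ) x - ∫ y, (ψ : ℝ → ℝ) y ∂μ) (deriv (ψ : ℝ → ℝ)) :=
    (IsPrimitive.of_hasDerivAt (fun x => ((testSpace.differentiable ψ x).hasDerivAt.sub_const _))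
      (testSpace.continuous_deriv ψ)).hasWeakDeriv
  have c1 : (centerL μ ψ : ℝ → ℝ) =ᵐ[volume] _ := hr.ae_eq ▸ coeFn_centerL ψ
  have c2 : (derivL μ ψ : ℝ → ℝ) =ᵐ[volume] _ := hr.ae_eq ▸ coeFn_derivL ψ
  exact (hw.congr c1.symm c2.symm).2.2 η hs hc

lemma integral_antideriv (hr : RegularDensity V r h μ) (hP : PoincareInequality μ)
    (g : Lp ℝ 2 μ) : ∫ x, antideriv μ g x ∂μ = 0 := by
  have m1 : MemLp (fun _ : ℝ => (1 : ℝ)) 2 μ := memLp_const 1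
  have e1 : ∀ g : Lp ℝ 2 μ, inner ℝ m1.toLp g = ∫ x, g x ∂μ := fun g => by
    rw [inner_toLp]
    simp
  rw [← e1]
  refine hr.denseRange_derivL.induction_on
    (p := fun g => inner ℝ m1.toLp (antideriv μ g) = 0) g
    (isClosed_eq (by fun_prop) (by fun_prop)) fun ψ => ?_
  rw [hr.antideriv_derivL hP, e1, integral_congr_ae (coeFn_centerL ψ),
    integral_sub (testSpace.integrable ψ μ) (integrable_const _)]
  simp

/-! ### Confinement of the antiderivative -/

/-- `V' (ψ - ∫ ψ)` as an element of `L²(μ)`. -/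
def weightL (hr : RegularDensity V r h μ) (hV : AdmissiblePotential V μ) :
    testSpace →ₗ[ℝ] Lp ℝ 2 μ where
  toFun ψ := (hr.memLp_weight hV ψ).toLp
  map_add' ψ χ := by
    rw [← MemLp.toLp_add]
    refine MemLp.toLp_congr _ _ (ae_of_all _ fun x => ?_)
    simp only [Submodule.coe_add, Pi.add_apply]
    rw [integral_add (testSpace.integrable ψ μ) (testSpace.integrable χ μ)]
    ring
  map_smul' c ψ := by
    rw [RingHom.id_apply, ← MemLp.toLp_const_smul]
    refine MemLp.toLp_congr _ _ (ae_of_all _ fun x => ?_)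
    simp only [Submodule.coe_smul, Pi.smul_apply, smul_eq_mul]
    rw [integral_const_mul]
    ring

lemma norm_weightL_le (hr : RegularDensity V r h μ) (hV : AdmissiblePotential V μ) :
    ∃ C, 0 ≤ C ∧ ∀ ψ : testSpace, ‖hr.weightL hV ψ‖ ≤ C * ‖derivL μ ψ‖ := by
  obtain ⟨C, hC0, hC⟩ := hr.exists_confinement hV
  obtain ⟨D, hD0, hD⟩ := hV.poincare
  refine ⟨√(C * (1 + D)), Real.sqrt_nonneg _,
    fun ψ => le_sqrt_mul_of_sq_le (norm_nonneg _) (by positivity) ?_⟩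
  obtain ⟨M, hM, hM'⟩ := testSpace.exists_bound ψ (∫ y, (ψ : ℝ → ℝ) y ∂μ)
  have h1 := (hC _ _ M (fun x => (testSpace.differentiable ψ x).hasDerivAt.sub_const _)
    (testSpace.continuous_deriv ψ) hM hM').2
  have h2 := hD _ ((testSpace.contDiff ψ).of_le (by simp)) (testSpace.hasCompactSupport ψ)
  have e : ∀ f : ℝ → ℝ, ∫ x, f x * r x = ∫ x, f x ∂μ := fun f => by
    rw [hr.integral_eq]
    simp only [mul_comm]
  rw [e, e, e] at h1
  rw [norm_derivL_sq]
  change ‖(hr.memLp_weight hV ψ).toLp‖ ^ 2 ≤ _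
  rw [norm_sq_toLp]
  nlinarith

/-- `V'` times the antiderivative is square integrable. -/
lemma memLp_deriv_mul_antideriv (hr : RegularDensity V r h μ) (hV : AdmissiblePotential V μ) :
    ∃ W : Lp ℝ 2 μ →L[ℝ] Lp ℝ 2 μ, ∀ g : Lp ℝ 2 μ,
      W g =ᵐ[μ] fun x => deriv V x * antideriv μ g x := by
  have hP := hV.poincare
  obtain ⟨C, -, hC⟩ := hr.norm_weightL_le hV
  have hW := LinearMap.extendOfNorm_eq hr.denseRange_derivL ⟨C, hC⟩
  set W := (hr.weightL hV).extendOfNorm (derivL μ)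
  refine ⟨W, fun g => ?_⟩
  rw [Filter.EventuallyEq, hr.ae_eq]
  have l1 : LocallyIntegrable fun x => deriv V x * antideriv μ g x := by
    have := ((hr.locallyIntegrable (integrable_lp (antideriv μ g))).locallyIntegrableOn
      Set.univ).continuousOn_mul hV.continuous_deriv.continuousOn isOpen_univ.isLocallyClosed
    rwa [locallyIntegrableOn_univ] at this
  refine ae_eq_of_integral_contDiff_smul_eq (hr.locallyIntegrable (integrable_lp _)) l1
    fun η hs hc => ?_
  have m1 := hr.memLp_inv_mul hs.continuous hc
  have m2 := hr.memLp_inv_mul (hV.continuous_deriv.mul hs.continuous)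
    (hc.mul_left (f := deriv V))
  have e1 : ∀ g : Lp ℝ 2 μ, inner ℝ m1.toLp g = ∫ x, η x • g x := fun g => by
    rw [inner_toLp, hr.integral_inv_mul]
    simp only [smul_eq_mul, mul_comm]
  have e2 : ∀ g : Lp ℝ 2 μ, inner ℝ m2.toLp g = ∫ x, η x • (deriv V x * g x) := fun g => by
    rw [inner_toLp, hr.integral_inv_mul]
    congr 1
    ext x
    simp only [smul_eq_mul, Pi.mul_apply]
    ring
  rw [← e1, ← e2]
  refine hr.denseRange_derivL.induction_on
    (p := fun g => inner ℝ m1.toLp (W g) = inner ℝ m2.toLp (antideriv μ g)) g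
    (isClosed_eq (by fun_prop) (by fun_prop)) fun ψ => ?_
  rw [hr.antideriv_derivL hP, hW, e1, e2]
  have c1 : (centerL μ ψ : ℝ → ℝ) =ᵐ[volume] _ := hr.ae_eq ▸ coeFn_centerL ψ
  have c2 : (hr.weightL hV ψ : ℝ → ℝ) =ᵐ[volume] _ :=
    hr.ae_eq ▸ (hr.memLp_weight hV ψ).coeFn_toLp
  refine integral_congr_ae ?_
  filter_upwards [c1, c2] with x h1 h2
  rw [h1, h2]

end RegularDensity

/-! ### Compactness of the antiderivative -/

/-- An operator which can be approximated by finite dimensional subspaces is compact. -/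
lemma isCompactOperator_of_finiteDimensional_approx {X H E : Type*} [NormedAddCommGroup H]
    [InnerProductSpace ℝ H] [NormedAddCommGroup E] [InnerProductSpace ℝ E] [CompleteSpace E]
    (T : H →L[ℝ] E) {e : X → H} (he : DenseRange e)
    (h : ∀ ε : ℝ, 0 < ε → ∃ F : Submodule ℝ E, FiniteDimensional ℝ F ∧
      ∀ x, ∃ y ∈ F, ‖T (e x) - y‖ ≤ ε * ‖e x‖) :
    IsCompactOperator T := by
  choose! F hF hFx using h
  set ε : ℕ → ℝ := fun n => 1 / ((n : ℝ) + 1)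
  have hε0 : ∀ n, 0 < ε n := fun n => by positivity
  have hfd : ∀ n, FiniteDimensional ℝ (F (ε n)) := fun n => hF _ (hε0 n)
  let S : ℕ → H →L[ℝ] E := fun n => ((F (ε n)).subtypeL ∘L (F (ε n)).orthogonalProjectionOnto) ∘L T
  have hS : ∀ n, IsCompactOperator (S n) := fun n => by
    have h1 : IsCompactOperator ((F (ε n)).orthogonalProjectionOnto ∘L T) :=
      haveI := FiniteDimensional.proper ℝ (F (ε n))
      isCompactOperator_of_locallyCompactSpace_dom
        ((F (ε n)).orthogonalProjectionOnto ∘L T)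
    exact h1.clm_comp (F (ε n)).subtypeL
  refine isCompactOperator_of_tendsto (l := atTop) (F := S) ?_ (Eventually.of_forall hS)
  rw [tendsto_iff_norm_sub_tendsto_zero]
  refine squeeze_zero (fun _ => norm_nonneg _) (fun n => ?_) tendsto_one_div_add_atTop_nhds_zero_nat
  refine ContinuousLinearMap.opNorm_le_bound _ (hε0 n).le fun g => ?_
  refine he.induction_on (p := fun g => ‖(S n - T) g‖ ≤ ε n * ‖g‖) g
    (isClosed_le (by fun_prop) (by fun_prop)) fun x => ?_
  obtain ⟨y, hy, hxy⟩ := hFx _ (hε0 n) x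
  refine le_trans ?_ hxy
  have : (S n - T) (e x) = (F (ε n)).starProjection (T (e x)) - T (e x) := rfl
  rw [this, norm_sub_rev]
  rw [(F (ε n)).starProjection_minimal]
  exact ciInf_le ⟨0, by rintro _ ⟨z, rfl⟩; positivity⟩ (⟨y, hy⟩ : F (ε n))

/-- The Cauchy-Schwarz estimate of an increment by the derivative. -/
lemma sq_sub_le_mul_integral_sq {φ φ' : ℝ → ℝ} (hφ : ∀ x, HasDerivAt φ (φ' x) x)
    (hφ' : Continuous φ') {a b : ℝ} (hab : a ≤ b) :
    (φ b - φ a) ^ 2 ≤ (b - a) * ∫ x in a..b, φ' x ^ 2 := by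
  rcases hab.eq_or_lt with rfl | hlt
  · simp
  have e : ∫ x in a..b, φ' x = φ b - φ a :=
    intervalIntegral.integral_eq_sub_of_hasDerivAt (fun x _ => hφ x) (hφ'.intervalIntegrable _ _)
  have hL : 0 < b - a := sub_pos.2 hlt
  set I := φ b - φ a
  have h1 : 0 ≤ ∫ x in a..b, (φ' x - I / (b - a)) ^ 2 :=
    intervalIntegral.integral_nonneg hab fun x _ => sq_nonneg _
  have h2 : ∫ x in a..b, (φ' x - I / (b - a)) ^ 2 =
      (∫ x in a..b, φ' x ^ 2) - 2 * (I / (b - a)) * I + (I / (b - a)) ^ 2 * (b - a) := by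
    have : ∀ x, (φ' x - I / (b - a)) ^ 2 =
        φ' x ^ 2 - 2 * (I / (b - a)) * φ' x + (I / (b - a)) ^ 2 := fun x => by ring
    simp only [this]
    rw [intervalIntegral.integral_add, intervalIntegral.integral_sub,
      intervalIntegral.integral_const_mul, e, intervalIntegral.integral_const, smul_eq_mul]
    · ring
    all_goals exact Continuous.intervalIntegrable (by fun_prop) _ _
  rw [h2] at h1
  have h3 : (∫ x in a..b, φ' x ^ 2) - 2 * (I / (b - a)) * I + (I / (b - a)) ^ 2 * (b - a) =
      (∫ x in a..b, φ' x ^ 2) - I ^ 2 / (b - a) := by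
    field_simp
    ring
  rw [h3, sub_nonneg, div_le_iff₀ hL] at h1
  linarith

/-- The step function with the values `c` on the `n` intervals of length `δ` that follow `a`. -/
def stepFun (a δ : ℝ) (n : ℕ) (c : Fin n → ℝ) : ℝ → ℝ :=
  (Set.Ici a).indicator fun x =>
    if hk : ⌊(x - a) / δ⌋₊ < n then c ⟨⌊(x - a) / δ⌋₊, hk⟩ else 0

lemma memLp_stepFun (μ : Measure ℝ) [IsFiniteMeasure μ] (a δ : ℝ) (n : ℕ) (c : Fin n → ℝ) :
    MemLp (stepFun a δ n c) 2 μ := by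
  have hm : Measurable (stepFun a δ n c) := by
    refine Measurable.indicator ?_ measurableSet_Ici
    have h1 : Measurable fun k : ℕ => if hk : k < n then c ⟨k, hk⟩ else 0 :=
      Measurable.of_discrete
    exact h1.comp (Nat.measurable_floor.comp (by fun_prop))
  refine MemLp.of_bound hm.aestronglyMeasurable (∑ k, |c k|) (ae_of_all _ fun x => ?_)
  have h0 : 0 ≤ ∑ k, |c k| := Finset.sum_nonneg fun _ _ => abs_nonneg _
  rw [stepFun, Set.indicator_apply]
  split_ifs
  · exact Finset.single_le_sum (f := fun k => |c k|) (fun _ _ => abs_nonneg _) (Finset.mem_univ _)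
  · simpa using h0
  · simpa using h0

/-- The step functions, as a linear map. -/
def stepL (μ : Measure ℝ) [IsFiniteMeasure μ] (a δ : ℝ) (n : ℕ) :
    (Fin n → ℝ) →ₗ[ℝ] Lp ℝ 2 μ where
  toFun c := (memLp_stepFun μ a δ n c).toLp
  map_add' c d := by
    rw [← MemLp.toLp_add]
    refine MemLp.toLp_congr _ _ (ae_of_all _ fun x => ?_)
    simp only [stepFun, Set.indicator_apply, Pi.add_apply]
    split_ifs <;> simp
  map_smul' t c := by
    rw [RingHom.id_apply, ← MemLp.toLp_const_smul]
    refine MemLp.toLp_congr _ _ (ae_of_all _ fun x => ?_)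
    simp only [stepFun, Set.indicator_apply, Pi.smul_apply]
    split_ifs <;> simp

/-- The step function which interpolates `φ` approximates it on `[-R, R]` and vanishes outside. -/
lemma exists_stepFun_approx {R : ℝ} (hR : 0 < R) {n : ℕ} (hn : 0 < n) (φ : ℝ → ℝ) :
    ∃ c : Fin n → ℝ, ∀ x,
      (x ∈ Set.Ico (-R) R → ∃ y ∈ Set.Icc (-R) x, x - y ≤ 2 * R / n ∧
        stepFun (-R) (2 * R / n) n c x = φ y) ∧
      (x ∉ Set.Ico (-R) R → stepFun (-R) (2 * R / n) n c x = 0) := by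
  have hn' : (0 : ℝ) < n := by exact_mod_cast hn
  set δ := 2 * R / n with hδ
  have hδ0 : 0 < δ := by positivity
  refine ⟨fun k => φ (-R + k * δ), fun x => ⟨fun hx => ?_, fun hx => ?_⟩⟩
  · have h0 : 0 ≤ (x - -R) / δ := div_nonneg (by linarith [hx.1]) hδ0.le
    have h1 := Nat.floor_le h0
    have h2 := Nat.lt_floor_add_one ((x - -R) / δ)
    have hk : ⌊(x - -R) / δ⌋₊ < n := by
      rw [Nat.floor_lt h0, div_lt_iff₀ hδ0, hδ]
      have : (n : ℝ) * (2 * R / n) = 2 * R := by field_simp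
      rw [this]
      linarith [hx.2]
    rw [le_div_iff₀ hδ0] at h1
    rw [div_lt_iff₀ hδ0] at h2
    refine ⟨-R + ⌊(x - -R) / δ⌋₊ * δ, ⟨by
      have : 0 ≤ (⌊(x - -R) / δ⌋₊ : ℝ) * δ := by positivity
      linarith, by linarith⟩, by linarith, ?_⟩
    rw [stepFun, Set.indicator_of_mem (show x ∈ Set.Ici (-R) from hx.1), dif_pos hk]
  · rw [stepFun, Set.indicator_apply]
    split_ifs with h1 h2
    · exfalso
      have h0 : 0 ≤ (x - -R) / δ := div_nonneg (by linarith [Set.mem_Ici.1 h1]) hδ0.le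
      rw [Nat.floor_lt h0, div_lt_iff₀ hδ0, hδ] at h2
      have : (n : ℝ) * (2 * R / n) = 2 * R := by field_simp
      rw [this] at h2
      exact hx ⟨h1, by linarith⟩
    · rfl
    · rfl

namespace RegularDensity

variable {V r h : ℝ → ℝ} {μ : Measure ℝ} [IsProbabilityMeasure μ]

/-- The antiderivative is a compact operator of `L²(μ)`. -/
lemma isCompactOperator_antideriv (hr : RegularDensity V r h μ) (hV : AdmissiblePotential V μ) :
    IsCompactOperator (antideriv μ) := by
  have hP := hV.poincare
  refine isCompactOperator_of_finiteDimensional_approx _ hr.denseRange_derivL fun ε hε => ?_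
  obtain ⟨C, hC0, hC⟩ := hr.norm_weightL_le hV
  set Λ := 2 * (C + 1) / ε with hΛ
  have hΛ0 : 0 < Λ := by positivity
  obtain ⟨R, hR0, hR⟩ : ∃ R : ℝ, 0 < R ∧ ∀ x, x ∉ Set.Ico (-R) R → Λ ≤ |deriv V x| := by
    have h1 := hV.abs_deriv_tendsto_top.eventually_ge_atTop Λ
    rw [Filter.Eventually, mem_cocompact] at h1
    obtain ⟨K, hK, hKs⟩ := h1
    obtain ⟨R, hR⟩ := hK.isBounded.subset_closedBall 0
    refine ⟨|R| + 1, by positivity, fun x hx => hKs fun hxK => hx ?_⟩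
    have := hR hxK
    rw [Metric.mem_closedBall, dist_zero_right, Real.norm_eq_abs] at this
    have := abs_lt.1 (show |x| < |R| + 1 by linarith [le_abs_self R])
    exact ⟨this.1.le, this.2⟩
  obtain ⟨m, hm0, hm⟩ : ∃ m : ℝ, 0 < m ∧ ∀ x ∈ Set.Icc (-R) R, m ≤ r x := by
    obtain ⟨x₀, -, hx₀⟩ := isCompact_Icc.exists_isMinOn (Set.nonempty_Icc.2 (by linarith :
      -R ≤ R)) hr.continuous.continuousOn
    exact ⟨r x₀, hr.pos x₀, fun x hx => hx₀ hx⟩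
  obtain ⟨n, hn⟩ := exists_nat_gt (4 * R / (m * ε ^ 2))
  have hn0 : (0 : ℝ) < n := lt_of_le_of_lt (by positivity) hn
  set δ := 2 * R / n with hδ
  have hδm : δ / m ≤ ε ^ 2 / 2 := by
    rw [div_lt_iff₀ (by positivity)] at hn
    rw [hδ, div_div, div_le_div_iff₀ (by positivity) (by norm_num)]
    linarith
  refine ⟨LinearMap.range (stepL μ (-R) δ n), inferInstance, fun ψ => ?_⟩
  set φ : ℝ → ℝ := fun x => (ψ : ℝ → ℝ) x - ∫ y, (ψ : ℝ → ℝ) y ∂μ with hφ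
  obtain ⟨c, hc⟩ := exists_stepFun_approx hR0 (by exact_mod_cast hn0 : 0 < n) φ
  refine ⟨_, ⟨c, rfl⟩, ?_⟩
  rw [hr.antideriv_derivL hP]
  have hφd : ∀ x, HasDerivAt φ (deriv (ψ : ℝ → ℝ) x) x := fun x =>
    (testSpace.differentiable ψ x).hasDerivAt.sub_const _
  set D := ∫ x, deriv (ψ : ℝ → ℝ) x ^ 2 ∂μ with hD
  have hD0 : 0 ≤ D := integral_nonneg fun x => sq_nonneg _
  have hDi : Integrable (fun x => r x * deriv (ψ : ℝ → ℝ) x ^ 2) :=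
    hr.integrable_iff.1 (testSpace.memLp_deriv ψ μ).integrable_sq
  have hinc : ∀ x ∈ Set.Ico (-R) R, ∀ y ∈ Set.Icc (-R) x, x - y ≤ δ →
      (φ x - φ y) ^ 2 ≤ δ / m * D := fun x hx y hy hxy => by
    have h1 := sq_sub_le_mul_integral_sq hφd (testSpace.continuous_deriv ψ) hy.2
    have h2 : m * ∫ t in y..x, deriv (ψ : ℝ → ℝ) t ^ 2 ≤ D := by
      rw [← intervalIntegral.integral_const_mul, hD, hr.integral_eq,
        intervalIntegral.integral_of_le hy.2]
      refine (setIntegral_mono_on ?_ hDi.integrableOn measurableSet_Ioc fun t ht => ?_).trans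
        (setIntegral_le_integral hDi (ae_of_all _ fun t =>
          mul_nonneg (hr.pos t).le (sq_nonneg _)))
      · exact ((continuous_const.mul ((testSpace.continuous_deriv ψ).pow
          2)).integrableOn_Icc).mono_set Set.Ioc_subset_Icc_self
      · exact mul_le_mul_of_nonneg_right (hm t ⟨hy.1.trans ht.1.le, ht.2.trans hx.2.le⟩)
          (sq_nonneg _)
    have h3 : 0 ≤ ∫ t in y..x, deriv (ψ : ℝ → ℝ) t ^ 2 :=
      intervalIntegral.integral_nonneg hy.2 fun _ _ => sq_nonneg _
    rw [div_mul_eq_mul_div, le_div_iff₀ hm0]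
    nlinarith [hy.2]
  have hW := hC ψ
  have hWi : Integrable (fun x => (deriv V x * φ x) ^ 2) μ :=
    (hr.memLp_weight hV ψ).integrable_sq
  have hWn : ‖hr.weightL hV ψ‖ ^ 2 = ∫ x, (deriv V x * φ x) ^ 2 ∂μ :=
    norm_sq_toLp (hr.memLp_weight hV ψ)
  have hdiff : MemLp (fun x => φ x - stepFun (-R) δ n c x) 2 μ :=
    (testSpace.memLp_center ψ μ).sub (memLp_stepFun μ (-R) δ n c)
  have hnorm : ‖centerL μ ψ - stepL μ (-R) δ n c‖ ^ 2 =
      ∫ x, (φ x - stepFun (-R) δ n c x) ^ 2 ∂μ := by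
    rw [← norm_sq_toLp hdiff]
    rfl
  have hpt : ∀ x, (φ x - stepFun (-R) δ n c x) ^ 2 ≤
      δ / m * D + (Λ ^ 2)⁻¹ * (deriv V x * φ x) ^ 2 := fun x => by
    have n1 : 0 ≤ δ / m * D := by positivity
    have n2 : 0 ≤ (Λ ^ 2)⁻¹ * (deriv V x * φ x) ^ 2 := by positivity
    by_cases hx : x ∈ Set.Ico (-R) R
    · obtain ⟨y, hy, hxy, hs⟩ := (hc x).1 hx
      rw [hs]
      linarith [hinc x hx y hy hxy]
    · rw [(hc x).2 hx, sub_zero]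
      have h1 := hR x hx
      have h2 : Λ ^ 2 ≤ deriv V x ^ 2 := by
        rw [← sq_abs (deriv V x)]
        exact pow_le_pow_left₀ hΛ0.le h1 2
      have h3 : φ x ^ 2 ≤ (Λ ^ 2)⁻¹ * (deriv V x * φ x) ^ 2 := by
        rw [inv_mul_eq_div, le_div_iff₀ (by positivity), mul_pow, mul_comm]
        exact mul_le_mul_of_nonneg_right h2 (sq_nonneg _)
      linarith
  have hint := integral_mono hdiff.integrable_sq ((integrable_const (δ / m * D)).add
    (hWi.const_mul (Λ ^ 2)⁻¹)) hpt
  simp only [Pi.add_apply] at hint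
  rw [integral_add (integrable_const _) (hWi.const_mul _), integral_const, integral_const_mul,
    probReal_univ, one_smul, ← hWn, ← hnorm] at hint
  have hDn : ‖derivL μ ψ‖ ^ 2 = D := norm_derivL_sq ψ
  have hW2 : ‖hr.weightL hV ψ‖ ^ 2 ≤ C ^ 2 * D := by
    rw [← hDn, ← mul_pow]
    exact pow_le_pow_left₀ (norm_nonneg _) hW 2
  have hCΛ : (Λ ^ 2)⁻¹ * (C ^ 2 * D) ≤ ε ^ 2 / 2 * D := by
    rw [hΛ, div_pow, inv_div, div_mul_eq_mul_div, div_le_iff₀ (by positivity)]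
    have : 0 ≤ ε ^ 2 * D := by positivity
    nlinarith [mul_nonneg this (sq_nonneg C), mul_nonneg this hC0]
  have hfin : ‖centerL μ ψ - stepL μ (-R) δ n c‖ ^ 2 ≤ (ε * ‖derivL μ ψ‖) ^ 2 := by
    rw [mul_pow, hDn]
    have h1 := mul_le_mul_of_nonneg_right hδm hD0
    have h2 := mul_le_mul_of_nonneg_left hW2 (by positivity : 0 ≤ (Λ ^ 2)⁻¹)
    linarith
  exact (abs_le_of_sq_le_sq' hfin (by positivity)).2

end RegularDensity

/-! ### The operator and its inverse -/

lemma mem_L20 {μ : Measure ℝ} [IsFiniteMeasure μ] {f : Lp ℝ 2 μ} :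
    f ∈ L20 μ ↔ ∫ x, f x ∂μ = 0 := Iff.rfl

/-- The inverse of `A` on mean zero functions. -/
def invA (μ : Measure ℝ) [IsFiniteMeasure μ] : Lp ℝ 2 μ →L[ℝ] Lp ℝ 2 μ :=
  antideriv μ ∘L (antideriv μ).adjoint

/-- An integrable function with an integrable weak derivative `g` has `∫ g = 0`. -/
lemma HasWeakDeriv.integral_eq_zero {u g : ℝ → ℝ} (h : HasWeakDeriv u g) (hu : Integrable u)
    (hg : Integrable g) : ∫ x, g x = 0 := by
  obtain ⟨F, hF, hue⟩ := h.exists_isPrimitive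
  have hFi : Integrable F := hu.congr hue
  have h1 : Tendsto (fun R : ℝ => F R - F (-R)) atTop (𝓝 (∫ x, g x)) := by
    have h2 := intervalIntegral_tendsto_integral hg tendsto_neg_atTop_atBot tendsto_id
    refine h2.congr fun R => ?_
    rw [hF.eq_add_integral R, hF.eq_add_integral (-R), id,
      ← intervalIntegral.integral_add_adjacent_intervals
        (hF.locallyIntegrable.intervalIntegrable (-R) 0)
        (hF.locallyIntegrable.intervalIntegrable 0 R), intervalIntegral.integral_symm 0 (-R)]
    ring
  have h2 : Integrable fun R : ℝ => F R - F (-R) := hFi.sub hFi.comp_neg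
  refine IntegrableAtFilter.eq_zero_of_tendsto (h2.integrableAtFilter atTop) (fun s hs => ?_) h1
  obtain ⟨a, ha⟩ := mem_atTop_sets.1 hs
  exact measure_mono_top (fun x hx => ha x hx) (Real.volume_Ici (a := a))

namespace RegularDensity

variable {V r h : ℝ → ℝ} {μ : Measure ℝ} [IsProbabilityMeasure μ]

lemma antideriv_mem_L20 (hr : RegularDensity V r h μ) (hP : PoincareInequality μ)
    (g : Lp ℝ 2 μ) : antideriv μ g ∈ L20 μ := mem_L20.2 (hr.integral_antideriv hP g)

lemma memH1V_sqrt_mul_antideriv (hr : RegularDensity V r h μ) (hV : AdmissiblePotential V μ)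
    (g : Lp ℝ 2 μ) : MemH1V V fun x => √(r x) * antideriv μ g x := by
  obtain ⟨W, hW⟩ := hr.memLp_deriv_mul_antideriv hV
  have hVK : MemLp (fun x => deriv V x * antideriv μ g x) 2 μ :=
    (memLp_congr_ae (hW g)).1 (Lp.memLp _)
  have hK := Lp.memLp (antideriv μ g)
  refine ⟨⟨hr.memLp_iff.1 hK, _, ?_, (hr.hasWeakDeriv_antideriv hV.poincare g).mul_of_hasDerivAt
    hr.hasDerivAt_sqrt (hr.continuous_sqrt.mul
      ((hr.continuous_h.sub hV.continuous_deriv).div_const 2))⟩, ?_⟩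
  · have h1 : MemLp (fun x => (1 / 2 : ℝ) * (h x * antideriv μ g x) -
        (1 / 2 : ℝ) * (deriv V x * antideriv μ g x) + g x) 2 μ :=
      (((hr.memLp_bdd_mul hK).const_mul _).sub (hVK.const_mul _)).add (Lp.memLp g)
    refine (memLp_congr_ae (ae_of_all _ fun x => ?_)).1 (hr.memLp_iff.1 h1)
    ring
  · refine (memLp_congr_ae (ae_of_all _ fun x => ?_)).1 (hr.memLp_iff.1 hVK)
    ring

/-- The weak form of `-(d r)' = f r` for `d` the adjoint antiderivative of `f`. -/
lemma hasWeakDeriv_adjoint_mul (hr : RegularDensity V r h μ) (hP : PoincareInequality μ)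
    {f : Lp ℝ 2 μ} (hf : f ∈ L20 μ) :
    HasWeakDeriv (fun x => (antideriv μ).adjoint f x * r x) (fun x => -(f x * r x)) := by
  have hi : ∀ g : Lp ℝ 2 μ, Integrable fun x => g x * r x := fun g => by
    simpa only [mul_comm] using hr.integrable_iff.1 (integrable_lp g)
  refine ⟨(hi _).locallyIntegrable, (hi f).neg.locallyIntegrable, fun ψ hs hc => ?_⟩
  set χ : testSpace := ⟨ψ, hs, hc⟩
  have e1 : inner ℝ (derivL μ χ) ((antideriv μ).adjoint f) =
      ∫ x, (antideriv μ).adjoint f x * r x * deriv ψ x := by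
    change inner ℝ (testSpace.memLp_deriv χ μ).toLp _ = _
    rw [inner_toLp, hr.integral_eq]
    congr 1
    ext x
    change r x * (deriv ψ x * _) = _
    ring
  have e2 : inner ℝ (centerL μ χ) f = ∫ x, f x * r x * ψ x := by
    change inner ℝ (testSpace.memLp_center χ μ).toLp _ = _
    have i1 : Integrable (fun x => ψ x * f x) μ :=
      (hs.continuous.memLp_of_hasCompactSupport hc (p := 2)).integrable_mul (Lp.memLp f)
    have : ∀ x, ((χ : ℝ → ℝ) x - ∫ y, (χ : ℝ → ℝ) y ∂μ) * f x =
      ψ x * f x - (∫ y, (χ : ℝ → ℝ) y ∂μ) * f x := fun x => by rw [sub_mul]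
    rw [inner_toLp]
    simp only [this]
    rw [integral_sub i1 ((integrable_lp f).const_mul _), integral_const_mul, mem_L20.1 hf,
      mul_zero, sub_zero, hr.integral_eq]
    congr 1
    ext x
    ring
  rw [← e1, ContinuousLinearMap.adjoint_inner_right, hr.antideriv_derivL hP, e2, ← integral_neg]
  congr 1
  ext x
  ring

/-- `(A⁻¹ f, f)` lies in the graph of `A`. -/
lemma invA_mem_graphA (hr : RegularDensity V r h μ) (hV : AdmissiblePotential V μ)
    {f : Lp ℝ 2 μ} (hf : f ∈ L20 μ) : (invA μ f, f) ∈ graphA V μ := by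
  set d := (antideriv μ).adjoint f
  have hdens := hr.density_ae_eq
  have hφ : (invA μ f : ℝ → ℝ) =ᵐ[volume]
      fun x => √(r x) * antideriv μ d x / √(density μ x) := by
    filter_upwards [hdens] with x hx
    rw [hx, mul_div_cancel_left₀ _ (hr.sqrt_pos x).ne']
    rfl
  refine ⟨_, hr.memH1V_sqrt_mul_antideriv hV d, ?_, d, ?_, ?_⟩
  · rw [Filter.EventuallyEq, hr.ae_eq]
    exact hφ
  · exact (hr.hasWeakDeriv_antideriv hV.poincare d).congr hφ EventuallyEq.rfl
  · refine (hr.hasWeakDeriv_adjoint_mul hV.poincare hf).congr ?_ ?_ <;>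
    · filter_upwards [hdens] with x hx
      rw [hx]

/-- The functions in the domain of `A` have a square integrable weak derivative. -/
lemma exists_of_mem_graphA (hr : RegularDensity V r h μ) (hV : AdmissiblePotential V μ)
    {φ f : Lp ℝ 2 μ} (hφ : (φ, f) ∈ graphA V μ) :
    ∃ d : ℝ → ℝ, MemLp d 2 μ ∧ HasWeakDeriv φ d ∧
      HasWeakDeriv (fun x => d x * r x) (fun x => -(f x * r x)) := by
  obtain ⟨u, ⟨⟨hu, g, hg, hug⟩, huV⟩, he, d, hd, hdf⟩ := hφ
  simp only at he hdf
  have hdens := hr.density_ae_eq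
  have he' : (φ : ℝ → ℝ) =ᵐ[volume] fun x => u x / √(density μ x) := by
    rw [Filter.EventuallyEq, ← hr.ae_eq]
    exact he
  have hφd : HasWeakDeriv φ d := hd.congr he'.symm EventuallyEq.rfl
  have hprod := hug.mul_of_hasDerivAt hr.hasDerivAt_inv_sqrt
    ((hr.continuous_sqrt.inv₀ fun x => (hr.sqrt_pos x).ne').mul
      ((hr.continuous_h.sub hV.continuous_deriv).div_const 2)).neg
  have hde := hφd.unique hprod (by
    filter_upwards [he', hdens] with x h1 h2
    rw [h1, h2, div_eq_inv_mul])
  refine ⟨d, ?_, hφd, ?_⟩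
  · rw [hr.memLp_iff]
    obtain ⟨B, hB⟩ := hr.bounded_h
    have h1 : MemLp (fun x => h x * u x) 2 volume :=
      MemLp.of_le_mul (c := B) hu (hr.continuous_h.aestronglyMeasurable.mul hu.1)
        (ae_of_all _ fun x => by
          rw [norm_mul]
          exact mul_le_mul_of_nonneg_right (hB x) (norm_nonneg _))
    have h2 : MemLp (fun x => (-(1 / 2) : ℝ) * (h x * u x) +
        (1 / 2 : ℝ) * (u x * deriv V x) + g x) 2 volume :=
      ((h1.const_mul _).add (huV.const_mul _)).add hg
    refine (memLp_congr_ae ?_).1 h2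
    filter_upwards [hde] with x hx
    rw [hx]
    have := (hr.sqrt_pos x).ne'
    field_simp
    ring
  · refine hdf.congr ?_ ?_ <;>
    · filter_upwards [hdens] with x hx
      rw [hx]

/-- The range of `A` consists of mean zero functions. -/
lemma mem_L20_of_mem_graphA (hr : RegularDensity V r h μ) (hV : AdmissiblePotential V μ)
    {φ f : Lp ℝ 2 μ} (hφ : (φ, f) ∈ graphA V μ) : f ∈ L20 μ := by
  obtain ⟨d, hd, -, hw⟩ := hr.exists_of_mem_graphA hV hφ
  have i1 : Integrable fun x => d x * r x := by
    simpa only [mul_comm] using hr.integrable_iff.1 (hd.integrable (by norm_num))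
  have i2 : Integrable fun x => f x * r x := by
    simpa only [mul_comm] using hr.integrable_iff.1 (integrable_lp f)
  have := hw.integral_eq_zero i1 i2.neg
  rw [integral_neg, neg_eq_zero] at this
  rw [mem_L20, hr.integral_eq, ← this]
  simp only [mul_comm]

/-- `A` is injective on mean zero functions. -/
lemma eq_zero_of_mem_graphA (hr : RegularDensity V r h μ) (hV : AdmissiblePotential V μ)
    {φ : Lp ℝ 2 μ} (hφ : (φ, 0) ∈ graphA V μ) (hφ0 : φ ∈ L20 μ) : φ = 0 := by
  obtain ⟨d, hd, hφd, hw⟩ := hr.exists_of_mem_graphA hV hφ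
  have h0 : (fun x => -((0 : Lp ℝ 2 μ) x * r x)) =ᵐ[volume] fun _ => 0 := by
    have : ((0 : Lp ℝ 2 μ) : ℝ → ℝ) =ᵐ[volume] 0 := hr.ae_eq ▸ Lp.coeFn_zero ℝ 2 μ
    filter_upwards [this] with x hx
    rw [hx, Pi.zero_apply, zero_mul, neg_zero]
  obtain ⟨c, hc⟩ := (hw.congr EventuallyEq.rfl h0).ae_eq_const
  have hd0 := (hr.eq_zero_of_memLp hd hc).2
  obtain ⟨c', hc'⟩ := (hφd.congr EventuallyEq.rfl hd0).ae_eq_const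
  rw [Filter.EventuallyEq, ← hr.ae_eq] at hc'
  have h1 := mem_L20.1 hφ0
  rw [integral_congr_ae hc'] at h1
  simp only [integral_const, probReal_univ, one_smul] at h1
  rw [Lp.eq_zero_iff_ae_eq_zero]
  filter_upwards [hc'] with x hx
  rw [hx, h1]
  rfl

lemma eq_invA_of_mem_graphA (hr : RegularDensity V r h μ) (hV : AdmissiblePotential V μ)
    {φ f : Lp ℝ 2 μ} (hφ : (φ, f) ∈ graphA V μ) (hφ0 : φ ∈ L20 μ) : φ = invA μ f := by
  have h1 := (graphA V μ).sub_mem hφ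
    (hr.invA_mem_graphA hV (hr.mem_L20_of_mem_graphA hV hφ))
  rw [Prod.mk_sub_mk, sub_self] at h1
  exact sub_eq_zero.1 (hr.eq_zero_of_mem_graphA hV h1
    ((L20 μ).sub_mem hφ0 (hr.antideriv_mem_L20 hV.poincare _)))

lemma exists_opA0_iff (hr : RegularDensity V r h μ) {φ f : Lp ℝ 2 μ} :
    (∃ hφ : φ ∈ (opA0 V μ).domain, opA0 V μ ⟨φ, hφ⟩ = f) ↔
      φ ∈ L20 μ ∧ (φ, f) ∈ graphA V μ := by
  have hg : (opA V μ).graph = graphA V μ := opA_graph V μ hr.absolutelyContinuous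
  rw [← hg, LinearPMap.mem_graph_iff]
  constructor
  · rintro ⟨hφ, he⟩
    exact ⟨hφ.1, ⟨φ, hφ.2⟩, rfl, he⟩
  · rintro ⟨h0, ⟨y, hy⟩, rfl, he⟩
    exact ⟨⟨h0, hy⟩, he⟩

/-- The inverse of `A` is injective on mean zero functions. -/
lemma eq_zero_of_invA_eq_zero (hr : RegularDensity V r h μ) (hV : AdmissiblePotential V μ)
    {f : Lp ℝ 2 μ} (hf : f ∈ L20 μ) (h0 : invA μ f = 0) : f = 0 := by
  have h1 := hr.invA_mem_graphA hV hf
  rw [h0, ← opA_graph V μ hr.absolutelyContinuous] at h1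
  exact (opA V μ).graph_fst_eq_zero_snd h1 rfl

lemma isCompactOperator_invA (hr : RegularDensity V r h μ) (hV : AdmissiblePotential V μ) :
    IsCompactOperator (invA μ) :=
  (hr.isCompactOperator_antideriv hV).comp_clm _

end RegularDensity

lemma isSymmetric_invA (μ : Measure ℝ) [IsFiniteMeasure μ] : (invA μ).IsSymmetric := by
  intro f g
  change inner ℝ (antideriv μ ((antideriv μ).adjoint f)) g =
    inner ℝ f (antideriv μ ((antideriv μ).adjoint g))
  rw [← ContinuousLinearMap.adjoint_inner_right, ContinuousLinearMap.adjoint_inner_left]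

lemma inner_invA_self_nonneg (μ : Measure ℝ) [IsFiniteMeasure μ] (f : Lp ℝ 2 μ) :
    0 ≤ inner ℝ (invA μ f) f := by
  change 0 ≤ inner ℝ (antideriv μ ((antideriv μ).adjoint f)) f
  rw [← ContinuousLinearMap.adjoint_inner_right]
  exact real_inner_self_nonneg

/-! ### Eigenbases of compact positive operators with simple spectrum -/

/-- An infinite set of reals with finitely many elements below every bound is the range of a
strictly increasing sequence. -/
lemma exists_strictMono_range_eq {S : Set ℝ} (hinf : S.Infinite)
    (hfin : ∀ R, (S ∩ Set.Iic R).Finite) :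
    ∃ lam : ℕ → ℝ, StrictMono lam ∧ Set.range lam = S ∧ Tendsto lam atTop atTop := by
  have hIcc : ∀ a b : S, (Set.Icc a b).Finite := fun a b => by
    refine Set.Finite.of_finite_image ((hfin b).subset ?_) Subtype.val_injective.injOn
    rintro _ ⟨x, hx, rfl⟩
    exact ⟨x.2, hx.2⟩
  let _ : LocallyFiniteOrder S := LocallyFiniteOrder.ofFiniteIcc hIcc
  obtain ⟨s, hs⟩ := hinf.nonempty
  obtain ⟨m, hm, hmin⟩ := Set.exists_min_image (S ∩ Set.Iic s) id (hfin s)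
    ⟨s, hs, le_refl s⟩
  let _ : OrderBot S :=
    { bot := ⟨m, hm.1⟩
      bot_le := fun a => by
        rcases le_total (a : ℝ) s with h | h
        · exact hmin a ⟨a.2, h⟩
        · exact (show m ≤ s from hm.2).trans h }
  have _ : NoMaxOrder S := ⟨fun a => by
    obtain ⟨b, hb, hab⟩ := (hinf.sdiff (hfin a)).nonempty
    exact ⟨⟨b, hb⟩, lt_of_not_ge fun h => hab ⟨hb, h⟩⟩⟩
  let _ : SuccOrder S := LinearLocallyFiniteOrder.succOrder S
  let _ : PredOrder S := LinearLocallyFiniteOrder.predOrder S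
  let e : S ≃o ℕ := orderIsoNatOfLinearSuccPredArch
  refine ⟨fun n => e.symm n, fun a b hab => e.symm.strictMono hab, ?_, ?_⟩
  · ext x
    constructor
    · rintro ⟨n, rfl⟩
      exact (e.symm n).2
    · exact fun hx => ⟨e ⟨x, hx⟩, by simp⟩
  · rw [tendsto_atTop]
    intro b
    rw [← Nat.cofinite_eq_atTop]
    have : {n : ℕ | ((e.symm n : S) : ℝ) ≤ b}.Finite := by
      refine Set.Finite.of_finite_image ((hfin b).subset ?_)
        (Subtype.val_injective.comp e.symm.injective).injOn
      rintro _ ⟨n, hn, rfl⟩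
      exact ⟨(e.symm n).2, hn⟩
    filter_upwards [this.compl_mem_cofinite] with n hn
    exact (not_le.1 (show ¬ _ ≤ b from hn)).le

section Spectral

variable {E : Type*} [NormedAddCommGroup E] [InnerProductSpace ℝ E] {T : E →L[ℝ] E}

lemma inner_eq_zero_of_eigenvalue_ne (hs : T.IsSymmetric) {s t : ℝ} (hst : s ≠ t) {x y : E}
    (hx : T x = s • x) (hy : T y = t • y) : inner ℝ x y = 0 := by
  have h := hs x y
  simp only [ContinuousLinearMap.coe_coe] at h
  rw [hx, hy, inner_smul_left, inner_smul_right] at h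
  have h2 : (s - t) * inner ℝ x y = 0 := by
    rw [sub_mul]
    exact sub_eq_zero.2 h
  exact (mul_eq_zero.1 h2).resolve_left (sub_ne_zero.2 hst)

/-- A compact symmetric operator has finitely many eigenvalues above a positive bound. -/
lemma finite_eigenvalues_ge (hc : IsCompactOperator T) (hs : T.IsSymmetric) {ε : ℝ} (hε : 0 < ε) :
    {t : ℝ | ε ≤ t ∧ ∃ x, ‖x‖ = 1 ∧ T x = t • x}.Finite := by
  by_contra hinf
  set t := Set.Infinite.natEmbedding _ hinf
  choose e he hTe using fun n => (t n).2.2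
  obtain ⟨K, hK, hsub⟩ := hc.image_closedBall_subset_compact 1
  obtain ⟨y, -, g, hg, hlim⟩ := hK.tendsto_subseq (x := fun n => T (e n)) fun n =>
    hsub ⟨e n, by simp [he n], rfl⟩
  have h1 : Tendsto (fun n => T (e (g (n + 1))) - T (e (g n))) atTop (𝓝 (y - y)) :=
    (hlim.comp (tendsto_add_atTop_nat 1)).sub hlim
  rw [sub_self] at h1
  have h2 := h1.norm
  rw [norm_zero] at h2
  obtain ⟨n, hn⟩ := (h2.eventually (gt_mem_nhds hε)).exists
  have hne : ((t (g (n + 1))) : ℝ) ≠ t (g n) := fun h =>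
    (hg (Nat.lt_succ_self n)).ne' (t.injective (Subtype.ext h))
  have h0 := inner_eq_zero_of_eigenvalue_ne hs hne (hTe _) (hTe _)
  have h3 := norm_sub_sq_real (T (e (g (n + 1)))) (T (e (g n)))
  rw [hTe, hTe, inner_smul_left, inner_smul_right, h0, norm_smul, he, mul_one] at h3
  rw [hTe, hTe] at hn
  have h4 : ε ≤ ‖((t (g (n + 1))) : ℝ)‖ := (t (g (n + 1))).2.1.trans (le_abs_self _)
  nlinarith [norm_nonneg (((t (g (n + 1))) : ℝ) • e (g (n + 1)) - ((t (g n)) : ℝ) • e (g n)),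
    sq_nonneg ‖((t (g n)) : ℝ) • e (g n)‖]

variable [CompleteSpace E]

/-- A vector orthogonal to all eigenvectors with a nonzero eigenvalue lies in the kernel. -/
lemma apply_eq_zero_of_orthogonal_eigenvectors (hc : IsCompactOperator T) (hs : T.IsSymmetric)
    {x : E} (hx : ∀ (t : ℝ) y, t ≠ 0 → T y = t • y → inner ℝ y x = 0) : T x = 0 := by
  have hbot := ContinuousLinearMap.orthogonalComplement_iSup_eigenspaces_eq_bot hc hs
  rw [← Submodule.mem_bot ℝ, ← hbot, Submodule.mem_orthogonal]
  intro y hy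
  refine Submodule.iSup_induction _ (motive := fun y => inner ℝ y (T x) = 0) hy
    (fun t y hy => ?_) (inner_zero_left _)
    fun y z hy hz => by rw [inner_add_left, hy, hz, add_zero]
  · have hy' : T y = t • y := Module.End.mem_eigenspace_iff.1 hy
    have h := hs y x
    simp only [ContinuousLinearMap.coe_coe] at h
    rw [← h, hy', inner_smul_left]
    rcases eq_or_ne t 0 with rfl | ht
    · simp
    · rw [hx t y ht hy', mul_zero]

/-- The spectral theorem for a compact positive operator on an infinite dimensional space, with
finite dimensional kernel and simple nonzero eigenvalues. -/
theorem exists_eigenbasis (hc : IsCompactOperator T) (hs : T.IsSymmetric)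
    (hpos : ∀ x, 0 ≤ inner ℝ (T x) x) (hE : ¬ FiniteDimensional ℝ E)
    (hker : FiniteDimensional ℝ T.ker)
    (hsimple : ∀ (t : ℝ) x y, t ≠ 0 → x ≠ 0 → T x = t • x → T y = t • y → ∃ c : ℝ, y = c • x) :
    ∃ (lam : ℕ → ℝ) (φ : ℕ → E), 0 < lam 0 ∧ StrictMono lam ∧ Tendsto lam atTop atTop ∧
      Orthonormal ℝ φ ∧ (∀ n, T (φ n) = (lam n)⁻¹ • φ n) ∧
      ∀ x, (∀ n, inner ℝ (φ n) x = 0) → T x = 0 := by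
  set S : Set ℝ := {s | 0 < s ∧ ∃ x, ‖x‖ = 1 ∧ T x = s⁻¹ • x}
  have hS : ∀ (t : ℝ) y, t ≠ 0 → y ≠ 0 → T y = t • y → t⁻¹ ∈ S := by
    intro t y ht hy hTy
    have h1 := hpos y
    rw [hTy, inner_smul_left] at h1
    have h2 : 0 < t := by
      refine lt_of_le_of_ne ?_ ht.symm
      exact nonneg_of_mul_nonneg_left h1 (real_inner_self_pos.2 hy)
    refine ⟨inv_pos.2 h2, ‖y‖⁻¹ • y, ?_, ?_⟩
    · rw [norm_smul, norm_inv, norm_norm, inv_mul_cancel₀ (norm_ne_zero_iff.2 hy)]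
    · rw [map_smul, hTy, inv_inv, smul_comm]
  have hfin : ∀ R, (S ∩ Set.Iic R).Finite := by
    intro R
    rcases le_or_gt R 0 with hR | hR
    · refine Set.Finite.subset Set.finite_empty ?_
      rintro s ⟨hs, hsR⟩
      exact absurd (hs.1.trans_le hsR) (not_lt.2 hR)
    · refine Set.Finite.of_finite_image ((finite_eigenvalues_ge hc hs (inv_pos.2 hR)).subset ?_)
        inv_injective.injOn
      rintro _ ⟨s, ⟨hs, hsR⟩, rfl⟩
      exact ⟨inv_anti₀ hs.1 hsR, hs.2⟩
  have hexists : ∀ s : S, ∃ x, ‖x‖ = 1 ∧ T x = (s : ℝ)⁻¹ • x := fun s => s.2.2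
  choose e he hTe using hexists
  have hcomplete : ∀ x, (∀ s, inner ℝ (e s) x = 0) → T x = 0 := by
    intro x hx
    refine apply_eq_zero_of_orthogonal_eigenvectors hc hs fun t y ht hy => ?_
    rcases eq_or_ne y 0 with rfl | hy0
    · exact inner_zero_left _
    · set s : S := ⟨t⁻¹, hS t y ht hy0 hy⟩
      obtain ⟨c, hyc⟩ := hsimple t (e s) y ht (norm_ne_zero_iff.1 (by simp [he]))
        (by simpa [s] using hTe s) hy
      rw [hyc, inner_smul_left, hx, mul_zero]
  have hinf : S.Infinite := by
    intro hfinS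
    have := hfinS.to_subtype
    set K := T.ker ⊔ Submodule.span ℝ (Set.range e)
    have : FiniteDimensional ℝ (Submodule.span ℝ (Set.range e)) :=
      FiniteDimensional.span_of_finite ℝ (Set.finite_range e)
    have hK : Kᗮ = ⊥ := by
      rw [Submodule.eq_bot_iff]
      intro x hx
      have h1 : T x = 0 := hcomplete x fun s =>
        (Submodule.mem_orthogonal _ _).1 hx _
          (Submodule.mem_sup_right (Submodule.subset_span ⟨s, rfl⟩))
      exact inner_self_eq_zero.1 ((Submodule.mem_orthogonal _ _).1 hx x
        (Submodule.mem_sup_left h1))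
    rw [Submodule.orthogonal_eq_bot_iff] at hK
    have hfd : FiniteDimensional ℝ K := inferInstance
    rw [hK] at hfd
    exact hE (Module.Finite.equiv (Submodule.topEquiv (R := ℝ) (M := E)))
  obtain ⟨lam, hmono, hrange, hlim⟩ := exists_strictMono_range_eq hinf hfin
  have hmem : ∀ n, lam n ∈ S := fun n => hrange ▸ Set.mem_range_self n
  refine ⟨lam, fun n => e ⟨lam n, hmem n⟩, (hmem 0).1, hmono, hlim, ⟨fun n => he _, ?_⟩,
    fun n => hTe _, fun x hx => hcomplete x ?_⟩
  · intro m n hmn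
    exact inner_eq_zero_of_eigenvalue_ne hs (fun h => hmn (hmono.injective (inv_injective h)))
      (hTe _) (hTe _)
  · rintro ⟨s, hs'⟩
    obtain ⟨n, rfl⟩ := hrange.symm ▸ hs'
    exact hx n

lemma hasSum_apply_of_eigenbasis {lam : ℕ → ℝ} {φ : ℕ → E} (hφ : Orthonormal ℝ φ)
    (hT : ∀ n, T (φ n) = (lam n)⁻¹ • φ n) (h0 : ∀ x, (∀ n, inner ℝ (φ n) x = 0) → T x = 0)
    (x : E) : HasSum (fun n => ((lam n)⁻¹ * inner ℝ x (φ n)) • φ n) (T x) := by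
  have hsum : Summable fun n => inner ℝ (φ n) x • φ n := by
    have := (hφ.orthogonalFamily.summable_iff_norm_sq_summable
      fun n => (inner ℝ (φ n) x : ℝ)).2 (hφ.inner_products_summable (x := x))
    simpa using this
  obtain ⟨y, hy⟩ := hsum
  have h1 : T (x - y) = 0 := by
    refine h0 _ fun m => ?_
    have h2 : HasSum (fun n => inner ℝ (φ m) (inner ℝ (φ n) x • φ n)) (inner ℝ (φ m) y) :=
      hy.mapL (innerSL ℝ (φ m))
    have h3 : HasSum (fun n => inner ℝ (φ m) (inner ℝ (φ n) x • φ n)) (inner ℝ (φ m) x) := by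
      have h4 := hasSum_single (f := fun n => inner ℝ (φ m) (inner ℝ (φ n) x • φ n)) m
        fun n hn => by rw [inner_smul_right, hφ.2 (Ne.symm hn), mul_zero]
      rwa [inner_smul_right, real_inner_self_eq_norm_sq, hφ.1 m, one_pow, mul_one] at h4
    rw [inner_sub_right, h3.unique h2, sub_self]
  rw [map_sub, sub_eq_zero] at h1
  rw [h1]
  convert! hy.mapL T using 2 with n
  rw [map_smul, hT, smul_smul, real_inner_comm, mul_comm]

end Spectral

/-! ### Simplicity of the eigenvalues -/

/-- A solution `F`, with flux `p = F' r`, of the Sturm-Liouville equation `-(F' r)' = lam F r`. -/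
structure IsSolution (r : ℝ → ℝ) (lam : ℝ) (F p : ℝ → ℝ) : Prop where
  hasDerivAt : ∀ x, HasDerivAt F (p x / r x) x
  hasDerivAt_flux : ∀ x, HasDerivAt p (-(lam * F x * r x)) x

namespace IsSolution

variable {r F p G q : ℝ → ℝ} {lam : ℝ}

lemma sub_const_mul (hF : IsSolution r lam F p) (hG : IsSolution r lam G q) (c : ℝ) :
    IsSolution r lam (fun x => F x - c * G x) (fun x => p x - c * q x) where
  hasDerivAt x := ((hF.hasDerivAt x).fun_sub ((hG.hasDerivAt x).const_mul c)).congr_deriv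
    (by ring)
  hasDerivAt_flux x := ((hF.hasDerivAt_flux x).fun_sub
    ((hG.hasDerivAt_flux x).const_mul c)).congr_deriv (by ring)

lemma eq_zero (hF : IsSolution r lam F p) (hr : Continuous r) (hpos : ∀ x, 0 < r x)
    (hF0 : F 0 = 0) (hp0 : p 0 = 0) (x : ℝ) : F x = 0 := by
  set c : ℝ → ℝ := fun x => |(r x)⁻¹ - lam * r x|
  have hc : Continuous c :=
    ((hr.inv₀ fun x => (hpos x).ne').sub (continuous_const.mul hr)).abs
  set A : ℝ → ℝ := fun x => ∫ t in (0 : ℝ)..x, c t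
  have hA : ∀ x, HasDerivAt A (c x) x := fun x =>
    hc.integral_hasStrictDerivAt 0 x |>.hasDerivAt
  set e : ℝ → ℝ := fun x => F x ^ 2 + p x ^ 2
  set e' : ℝ → ℝ := fun x => 2 * (F x * p x) * ((r x)⁻¹ - lam * r x)
  have he : ∀ x, HasDerivAt e (e' x) x := fun x =>
    (((hF.hasDerivAt x).fun_pow 2).fun_add ((hF.hasDerivAt_flux x).fun_pow 2)).congr_deriv (by
      simp only [e', div_eq_mul_inv]
      push_cast
      ring)
  have hbound : ∀ x, |e' x| ≤ c x * e x := fun x => by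
    have h1 : |2 * (F x * p x)| ≤ e x := abs_le.2
      ⟨by simp only [e]; nlinarith [sq_nonneg (F x + p x)],
        by simp only [e]; nlinarith [sq_nonneg (F x - p x)]⟩
    rw [abs_mul, mul_comm]
    exact mul_le_mul_of_nonneg_left h1 (abs_nonneg _)
  have he0 : e 0 = 0 := by simp [e, hF0, hp0]
  have key : e x ≤ 0 := by
    rcases le_total 0 x with hx | hx
    · have hd : ∀ x, HasDerivAt (fun x => e x * Real.exp (-A x))
          ((e' x - c x * e x) * Real.exp (-A x)) x := fun x =>
        ((he x).fun_mul (hA x).fun_neg.exp).congr_deriv (by ring)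
      have hanti : Antitone fun x => e x * Real.exp (-A x) :=
        antitone_of_deriv_nonpos (fun x => (hd x).differentiableAt) fun x => by
          rw [(hd x).deriv]
          exact mul_nonpos_of_nonpos_of_nonneg
            (sub_nonpos.2 ((le_abs_self _).trans (hbound x))) (Real.exp_pos _).le
      have := hanti hx
      simp only [he0, zero_mul] at this
      exact nonpos_of_mul_nonpos_left this (Real.exp_pos _)
    · have hd : ∀ x, HasDerivAt (fun x => e x * Real.exp (A x))
          ((e' x + c x * e x) * Real.exp (A x)) x := fun x =>
        ((he x).fun_mul (hA x).exp).congr_deriv (by ring)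
      have hmono : Monotone fun x => e x * Real.exp (A x) :=
        monotone_of_deriv_nonneg (fun x => (hd x).differentiableAt) fun x => by
          rw [(hd x).deriv]
          exact mul_nonneg (by linarith [(abs_le.1 (hbound x)).1]) (Real.exp_pos _).le
      have := hmono hx
      simp only [he0, zero_mul] at this
      exact nonpos_of_mul_nonpos_left this (Real.exp_pos _)
  have h2 : F x ^ 2 ≤ 0 := by
    simp only [e] at key
    nlinarith [sq_nonneg (p x)]
  exact pow_eq_zero_iff (two_ne_zero) |>.1 (le_antisymm h2 (sq_nonneg _))

/-- The Wronskian of two solutions is constant. -/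
lemma wronskian_eq (hF : IsSolution r lam F p) (hG : IsSolution r lam G q) (x : ℝ) :
    p x * G x - F x * q x = p 0 * G 0 - F 0 * q 0 := by
  have hd : ∀ x, HasDerivAt (fun x => p x * G x - F x * q x) 0 x := fun x =>
    (((hF.hasDerivAt_flux x).fun_mul (hG.hasDerivAt x)).fun_sub
      ((hF.hasDerivAt x).fun_mul (hG.hasDerivAt_flux x))).congr_deriv (by ring)
  exact is_const_of_deriv_eq_zero (fun x => (hd x).differentiableAt) (fun x => (hd x).deriv) x 0

end IsSolution

namespace RegularDensity

variable {V r h : ℝ → ℝ} {μ : Measure ℝ} [IsProbabilityMeasure μ]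

/-- Eigenfunctions of `A` are classical solutions of the Sturm-Liouville equation. -/
lemma exists_isSolution (hr : RegularDensity V r h μ) (hV : AdmissiblePotential V μ)
    {φ : Lp ℝ 2 μ} {lam : ℝ} (hφ : (φ, lam • φ) ∈ graphA V μ) :
    ∃ F p, IsSolution r lam F p ∧ φ =ᵐ[μ] F ∧ MemLp F 2 μ ∧ MemLp (fun x => p x / r x) 2 μ := by
  obtain ⟨d, hd, hφd, hdr⟩ := hr.exists_of_mem_graphA hV hφ
  obtain ⟨F, hF, hφF⟩ := hφd.exists_isPrimitive
  obtain ⟨p, hp, hdp⟩ := hdr.exists_isPrimitive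
  have hsmul : ((lam • φ : Lp ℝ 2 μ) : ℝ → ℝ) =ᵐ[volume] fun x => lam * φ x := by
    rw [Filter.EventuallyEq, ← hr.ae_eq]
    exact Lp.coeFn_smul lam φ
  have hd' : d =ᵐ[volume] fun x => p x / r x := by
    filter_upwards [hdp] with x hx
    rw [← hx, mul_div_cancel_right₀ _ (hr.pos x).ne']
  have hcp : Continuous fun x => p x / r x := hp.continuous.div hr.continuous fun x =>
    (hr.pos x).ne'
  have hcF : Continuous fun x => -(lam * F x * r x) :=
    ((continuous_const.mul hF.continuous).mul hr.continuous).neg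
  have eF : F = fun x => F 0 + ∫ t in (0 : ℝ)..x, p t / r t := by
    ext x
    rw [hF.eq_add_integral x]
    congr 1
    exact intervalIntegral.integral_congr_ae (by filter_upwards [hd'] with t ht _ using ht)
  have ep : p = fun x => p 0 + ∫ t in (0 : ℝ)..x, -(lam * F t * r t) := by
    ext x
    rw [hp.eq_add_integral x]
    congr 1
    refine intervalIntegral.integral_congr_ae ?_
    filter_upwards [hφF, hsmul] with t h1 h2 _
    rw [h2, h1]
  have hμF : φ =ᵐ[μ] F := by
    rw [Filter.EventuallyEq, hr.ae_eq]
    exact hφF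
  refine ⟨F, p, ⟨fun x => ?_, fun x => ?_⟩, hμF, (memLp_congr_ae hμF).1 (Lp.memLp φ),
    (memLp_congr_ae ?_).1 hd⟩
  · have := (hcp.integral_hasStrictDerivAt 0 x).hasDerivAt.const_add (F 0)
    rwa [← eF] at this
  · have := (hcF.integral_hasStrictDerivAt 0 x).hasDerivAt.const_add (p 0)
    rwa [← ep] at this
  · rw [Filter.EventuallyEq, hr.ae_eq]
    exact hd'

/-- Two eigenfunctions of `A` with the same eigenvalue are proportional. -/
lemma exists_eq_smul_of_eigenfunctions (hr : RegularDensity V r h μ)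
    (hV : AdmissiblePotential V μ) {φ ψ : Lp ℝ 2 μ} {lam : ℝ} (hφ0 : φ ≠ 0)
    (hφ : (φ, lam • φ) ∈ graphA V μ) (hψ : (ψ, lam • ψ) ∈ graphA V μ) :
    ∃ c : ℝ, ψ = c • φ := by
  obtain ⟨F, p, hFp, hφF, hF, hp⟩ := hr.exists_isSolution hV hφ
  obtain ⟨G, q, hGq, hψG, hG, hq⟩ := hr.exists_isSolution hV hψ
  have hprop : ∀ c : ℝ, G 0 = c * F 0 → q 0 = c * p 0 → ψ = c • φ := by
    intro c h1 h2
    have h3 := (hGq.sub_const_mul hFp c).eq_zero hr.continuous hr.pos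
      (by simp only [h1, sub_self]) (by simp only [h2, sub_self])
    apply Lp.ext
    filter_upwards [hψG, hφF, Lp.coeFn_smul c φ] with x e1 e2 e3
    rw [e3, Pi.smul_apply, e1, e2, smul_eq_mul]
    exact sub_eq_zero.1 (h3 x)
  have hmul : ∀ {a b : ℝ → ℝ}, MemLp (fun x => a x / r x) 2 μ → MemLp b 2 μ →
      Integrable fun x => a x * b x := by
    intro a b ha hb
    refine (hr.integrable_iff.1 (ha.integrable_mul hb)).congr (ae_of_all _ fun x => ?_)
    have := (hr.pos x).ne'
    simp only [Pi.mul_apply]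
    field_simp
  have hW : p 0 * G 0 - F 0 * q 0 = 0 := by
    have h1 : Integrable fun x => p x * G x - F x * q x :=
      (hmul hp hG).sub (by simpa only [mul_comm] using hmul hq hF)
    simp only [hFp.wronskian_eq hGq, integrable_const_iff] at h1
    refine h1.resolve_right fun h2 => ?_
    simpa using h2.measure_univ_lt_top
  rcases eq_or_ne (F 0) 0 with hF0 | hF0
  · rcases eq_or_ne (p 0) 0 with hp0 | hp0
    · refine absurd ((Lp.eq_zero_iff_ae_eq_zero).2 ?_) hφ0
      filter_upwards [hφF] with x hx
      rw [hx, hFp.eq_zero hr.continuous hr.pos hF0 hp0]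
      rfl
    · have hG0 : G 0 = 0 := by
        rw [hF0, zero_mul, sub_zero] at hW
        exact (mul_eq_zero.1 hW).resolve_left hp0
      exact ⟨q 0 / p 0, hprop _ (by simp [hF0, hG0]) (by field_simp)⟩
  · exact ⟨G 0 / F 0, hprop _ (by field_simp) (by field_simp; linarith)⟩

lemma eigenfunction_mem_L20 (hr : RegularDensity V r h μ) (hP : PoincareInequality μ)
    {φ : Lp ℝ 2 μ} {t : ℝ} (ht : t ≠ 0) (hφ : invA μ φ = t • φ) : φ ∈ L20 μ := by
  have h1 := (L20 μ).smul_mem t⁻¹ (hr.antideriv_mem_L20 hP ((antideriv μ).adjoint φ))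
  change t⁻¹ • invA μ φ ∈ L20 μ at h1
  rwa [hφ, inv_smul_smul₀ ht] at h1

lemma eigenfunction_mem_graphA (hr : RegularDensity V r h μ) (hV : AdmissiblePotential V μ)
    {φ : Lp ℝ 2 μ} {t : ℝ} (ht : t ≠ 0) (hφ : invA μ φ = t • φ) : (φ, t⁻¹ • φ) ∈ graphA V μ := by
  have h1 := (graphA V μ).smul_mem t⁻¹
    (hr.invA_mem_graphA hV (hr.eigenfunction_mem_L20 hV.poincare ht hφ))
  rwa [hφ, Prod.smul_mk, inv_smul_smul₀ ht] at h1

lemma finiteDimensional_ker_invA (hr : RegularDensity V r h μ) (hV : AdmissiblePotential V μ) :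
    FiniteDimensional ℝ (invA μ).ker := by
  set one : Lp ℝ 2 μ := (memLp_const (1 : ℝ)).toLp
  refine FiniteDimensional.of_injective
    ((innerSL ℝ one).toLinearMap ∘ₗ (invA μ).ker.subtype) ?_
  rw [← LinearMap.ker_eq_bot, LinearMap.ker_eq_bot']
  intro x hx
  have h1 : inner ℝ one (x : Lp ℝ 2 μ) = 0 := hx
  rw [inner_toLp] at h1
  simp only [one_mul] at h1
  exact Subtype.ext (hr.eq_zero_of_invA_eq_zero hV h1 x.2)

lemma not_finiteDimensional_lp (hr : RegularDensity V r h μ) :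
    ¬ FiniteDimensional ℝ (Lp ℝ 2 μ) := by
  intro hfd
  have hmem : ∀ n : ℕ, MemLp ((Set.Ioo (n : ℝ) (n + 1)).indicator fun _ => (1 : ℝ)) 2 μ :=
    fun n => (memLp_const 1).indicator measurableSet_Ioo
  have hmeas : ∀ n : ℕ, μ (Set.Ioo (n : ℝ) (n + 1)) ≠ 0 := fun n h0 => by
    simpa using hr.absolutelyContinuous' h0
  have hli : LinearIndependent ℝ fun n => (hmem n).toLp := by
    refine linearIndependent_of_ne_zero_of_inner_eq_zero (fun n h0 => ?_) fun m n hmn => ?_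
    · have h1 := norm_sq_toLp (hmem n)
      rw [h0] at h1
      have h2 : ∀ x, ((Set.Ioo (n : ℝ) (n + 1)).indicator (fun _ => (1 : ℝ)) x) ^ 2 =
          (Set.Ioo (n : ℝ) (n + 1)).indicator (fun _ => (1 : ℝ)) x := fun x => by
        by_cases hx : x ∈ Set.Ioo (n : ℝ) (n + 1) <;> simp [hx]
      simp only [h2, norm_zero] at h1
      rw [integral_indicator measurableSet_Ioo, setIntegral_const] at h1
      simp only [smul_eq_mul, mul_one, measureReal_def] at h1
      have h3 := ENNReal.toReal_pos (hmeas n) (measure_ne_top _ _)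
      simp at h1
      rw [← h1] at h3
      exact lt_irrefl _ h3
    · change inner ℝ (hmem m).toLp (hmem n).toLp = 0
      rw [inner_toLp]
      refine integral_eq_zero_of_ae ?_
      filter_upwards [(hmem n).coeFn_toLp] with x hx
      rw [hx, ← Set.indicator_mul_left, Pi.zero_apply]
      refine Set.indicator_apply_eq_zero.2 fun h1 => ?_
      rw [one_mul]
      refine Set.indicator_of_notMem (fun h2 => hmn ?_) _
      have a1 : (m : ℝ) < n + 1 := h1.1.trans h2.2
      have a2 : (n : ℝ) < m + 1 := h2.1.trans h1.2
      have b1 : m < n + 1 := by exact_mod_cast a1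
      have b2 : n < m + 1 := by exact_mod_cast a2
      omega
  exact not_finite_iff_infinite.2 (inferInstance : Infinite ℕ) hli.finite

end RegularDensity

lemma isClosed_L20 (μ : Measure ℝ) [IsFiniteMeasure μ] : IsClosed (L20 μ : Set (Lp ℝ 2 μ)) := by
  have : (L20 μ : Set (Lp ℝ 2 μ)) =
      {f | inner ℝ ((memLp_const (1 : ℝ)).toLp : Lp ℝ 2 μ) f = 0} := by
    ext f
    rw [Set.mem_ofPred_eq, inner_toLp]
    simp only [one_mul]
    exact mem_L20
  rw [this]
  exact isClosed_eq (continuous_const.inner continuous_id) continuous_const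

end HighTemp

end

theorem theorem6p2 (V : ℝ → ℝ) (P : ℝ) (hP : 0 < P)
    (μ : Measure ℝ) [IsProbabilityMeasure μ]
    (hμ : HighTemp.IsEquilibriumMeasure V P μ)
    (hV : HighTemp.AdmissiblePotential V μ) :
    ∃ (lam : ℕ → ℝ) (φ : ℕ → Lp ℝ 2 μ),
      0 < lam 0 ∧ StrictMono lam ∧ Tendsto lam atTop atTop ∧
      (Submodule.span ℝ (Set.range φ)).topologicalClosure = HighTemp.L20 μ ∧
      Orthonormal ℝ φ ∧
      (∀ n, ∃ h : φ n ∈ (HighTemp.opA0 V μ).domain,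
        HighTemp.opA0 V μ ⟨φ n, h⟩ = lam n • φ n) ∧
      Set.BijOn (fun w : (HighTemp.opA0 V μ).domain => HighTemp.opA0 V μ w) Set.univ
        (HighTemp.L20 μ : Set (Lp ℝ 2 μ)) ∧
      ∀ u ∈ HighTemp.L20 μ, ∃ w : (HighTemp.opA0 V μ).domain,
        HighTemp.opA0 V μ w = u ∧
        HasSum (fun n => ((lam n)⁻¹ * inner ℝ u (φ n)) • φ n) (w : Lp ℝ 2 μ) := by
  obtain ⟨r, h, hr⟩ := hμ.exists_regularDensity hP hV
  have hinv : ∀ u ∈ HighTemp.L20 μ, ∃ hu : HighTemp.invA μ u ∈ (HighTemp.opA0 V μ).domain,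
      HighTemp.opA0 V μ ⟨HighTemp.invA μ u, hu⟩ = u := fun u hu =>
    hr.exists_opA0_iff.2 ⟨hr.antideriv_mem_L20 hV.poincare _, hr.invA_mem_graphA hV hu⟩
  have hopA0 : ∀ w : (HighTemp.opA0 V μ).domain, (w : Lp ℝ 2 μ) ∈ HighTemp.L20 μ ∧
      ((w : Lp ℝ 2 μ), HighTemp.opA0 V μ w) ∈ HighTemp.graphA V μ := fun w =>
    hr.exists_opA0_iff.1 ⟨w.2, rfl⟩
  obtain ⟨lam, φ, h0, hmono, hlim, hφ, hT, hcomplete⟩ := HighTemp.exists_eigenbasis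
    (hr.isCompactOperator_invA hV) (HighTemp.isSymmetric_invA μ)
    (HighTemp.inner_invA_self_nonneg μ) hr.not_finiteDimensional_lp
    (hr.finiteDimensional_ker_invA hV) fun t x y ht hx hTx hTy =>
      hr.exists_eq_smul_of_eigenfunctions hV hx (hr.eigenfunction_mem_graphA hV ht hTx)
        (hr.eigenfunction_mem_graphA hV ht hTy)
  have hpos : ∀ n, (lam n)⁻¹ ≠ 0 := fun n =>
    inv_ne_zero (h0.trans_le (hmono.monotone (Nat.zero_le n))).ne'
  have hφ0 : ∀ n, φ n ∈ HighTemp.L20 μ := fun n =>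
    hr.eigenfunction_mem_L20 hV.poincare (hpos n) (hT n)
  refine ⟨lam, φ, h0, hmono, hlim, ?_, hφ, fun n => ?_, ⟨?_, ?_, ?_⟩, fun u hu => ?_⟩
  · set S := (Submodule.span ℝ (Set.range φ)).topologicalClosure
    have hSL : S ≤ HighTemp.L20 μ :=
      Submodule.topologicalClosure_minimal _
        (Submodule.span_le.2 (Set.range_subset_iff.2 hφ0)) (HighTemp.isClosed_L20 μ)
    have hφS : ∀ n, φ n ∈ S := fun n =>
      Submodule.le_topologicalClosure _ (Submodule.subset_span (Set.mem_range_self n))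
    have : CompleteSpace S := (Submodule.isClosed_topologicalClosure _).completeSpace_coe
    refine le_antisymm hSL fun f hf => ?_
    have h1 : f - S.starProjection f ∈ Sᗮ := Submodule.sub_starProjection_mem_orthogonal f
    have h2 : S.starProjection f ∈ S := Submodule.starProjection_apply_mem S f
    have h3 := hr.eq_zero_of_invA_eq_zero hV ((HighTemp.L20 μ).sub_mem hf (hSL h2))
      (hcomplete _ fun n => (Submodule.mem_orthogonal _ _).1 h1 _ (hφS n))
    rw [sub_eq_zero.1 h3]
    exact h2
  · have h1 := hr.eigenfunction_mem_graphA hV (hpos n) (hT n)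
    rw [inv_inv] at h1
    exact hr.exists_opA0_iff.2 ⟨hφ0 n, h1⟩
  · exact fun w _ => hr.mem_L20_of_mem_graphA hV (hopA0 w).2
  · intro w _ w' _ hww
    apply Subtype.ext
    rw [hr.eq_invA_of_mem_graphA hV (hopA0 w).2 (hopA0 w).1,
      hr.eq_invA_of_mem_graphA hV (hopA0 w').2 (hopA0 w').1]
    exact congrArg _ hww
  · intro u hu
    obtain ⟨hw, he⟩ := hinv u hu
    exact ⟨⟨_, hw⟩, Set.mem_univ _, he⟩
  · obtain ⟨hw, he⟩ := hinv u hu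
    exact ⟨⟨_, hw⟩, he, HighTemp.hasSum_apply_of_eigenbasis hφ hT hcomplete u⟩
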